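/- Let $N\ge 1$ and $\alpha\in\mathbb R$. **Models.** Let $G$ be an $N\times N$ Hermitian random matrix with real ($\beta=1$, GOE), complex ($\beta=2$, GUE) or real quaternion ($\beta=4$, GSE) entries and density proportional to $e^{-\mathrm{Tr}\,G^2/2}$; that is, the entries on and above the diagonal are independent, the diagonal entries are real $\mathrm N[0,1]$, and each of the $\beta$ real components of an entry above the diagonal is a centred Gaussian of variance $1/2$, independent of the others. Put $\tilde G=(2\beta N)^{-1/2}G$ and $\hat{\mathbf 1}_N=N^{-1/2}(1,\dots,1)^T$, and consider the rank one perturbation $$\tilde G+\alpha\,\hat{\mathbf 1}_N\hat{\mathbf 1}_N^T .\tag{1}$$ For every real $\beta>0$ let $$T_\beta=\frac1{\sqrt{2\beta N}}\,(C_0+C_1+C_1^T),\tag{2}$$ where $C_0=\mathrm{diag}\big(\mathrm N[\alpha\sqrt{2\beta N},1],\mathrm N[0,1],\dots,\mathrm N[0,1]\big)$, where $C_1$ has the entries $\tilde\chi_{\beta(N-1)},\tilde\chi_{\beta(N-2)},\dots,\tilde\chi_{\beta}$ immediately above the diagonal (in this order, from the top) and zeros elsewhere, where all these entries are independent, and where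 $\tilde\chi_k$ is the square root of a variable with the gamma distribution $\Gamma[k/2,1]$ of shape $k/2$ and rate $1$. **Claim.** (a) The random matrix (1) with $\beta=1$ has almost surely $N$ distinct real eigenvalues, and the joint probability density of its eigenvalues, ordered $\lambda_1>\cdots>\lambda_N$, is, up to a positive normalisation constant independent of $\lambda_1,\dots,\lambda_N$, $$\prod_{j=1}^N e^{-N\lambda_j^2}\prod_{1\le j<k\le N}(\lambda_j-\lambda_k)\int_{-\infty-ic}^{\infty-ic}e^{it}\prod_{j=1}^N\big(it-2\alpha N\lambda_j\big)^{-1/2}\,dt .$$ (b) More generally, for every real $\beta>0$ the matrix $T_\beta$ of (2) has almost surely $N$ distinct real eigenvalues, and the joint probability density of its eigenvalues, ordered $\lambda_1>\cdots>\lambda_N$, is, up to a positive normalisation constant independent of $\lambda_1,\dots,\lambda_N$, $$\prod_{j=1}^N e^{-\beta N\lambda_j^2}\prod_{1\le j<k\le N}|\lambda_j-\lambda_k|^{\beta}\int_{-\infty-ic}^{\infty-ic}e^{it}\prod_{j=1}^N\big(it-2\alpha\beta N\lambda_j\big)^{-\beta/2}\,dt .$$ For $\beta=1,2,4$ the random matrix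 (1), with real, complex and quaternion entries respectively, has the same ordered eigenvalue density. Here $c$ is any real number with $c>2\alpha\beta N\lambda_j$ for all $j$ (with $\beta=1$ in (a)); for $\alpha\ge 0$ this says $c>2\alpha\beta N\lambda_1$. The powers are principal branches, and the integral is the improper integral along the horizontal line $\mathrm{Im}\,t=-c$, the two ends of which tend to infinity independently. It converges (conditionally, if $N\beta\le 2$), and its value is real, nonnegative and independent of $c$. -/

import Mathlib

open MeasureTheory ProbabilityTheory Filter Topology
open scoped Quaternion

noncomputable section

namespace RankOne

/-! ### Eigenvalues and their density -/

/-- `l` lists, in strictly decreasing order, `N` distinct real eigenvalues of the `N × N` matrix `H`.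
The entries of `H` may be real, complex or quaternionic; in the quaternionic case the eigenvectors
are column vectors, and the real scalar `l j` commutes with everything. A Hermitian `N × N` matrix
has at most `N` distinct eigenvalues, so `l` is then the full spectrum, and it is unique. -/
def IsOrderedSpectrum {N : ℕ} {K : Type*} [Ring K] [Algebra ℝ K]
    (H : Matrix (Fin N) (Fin N) K) (l : Fin N → ℝ) : Prop :=
  StrictAnti l ∧ ∀ j, ∃ v : Fin N → K, v ≠ 0 ∧ H.mulVec v = l j • v

/-- The random matrix `H` on the space `(Ω, P)` has almost surely `N` distinct real eigenvalues, and
the random vector `Λ` of its eigenvalues in decreasing order is absolutely continuous, with density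
`f` on the region `λ₁ > ⋯ > λ_N` of `ℝ^N`. -/
def HasOrderedEigenvaluePDF {Ω : Type*} [MeasurableSpace Ω] {N : ℕ} {K : Type*} [Ring K]
    [Algebra ℝ K] (P : Measure Ω) (H : Ω → Matrix (Fin N) (Fin N) K)
    (f : (Fin N → ℝ) → ℝ) : Prop :=
  (∀ l, StrictAnti l → 0 ≤ f l) ∧
  ∃ Λ : Ω → Fin N → ℝ, AEMeasurable Λ P ∧
    (∀ᵐ ω ∂P, IsOrderedSpectrum (H ω) (Λ ω)) ∧
    P.map Λ =
      (volume.restrict {l : Fin N → ℝ | StrictAnti l}).withDensity (fun l => ENNReal.ofReal (f l))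

/-! ### The contour integral -/

/-- `∫_{-∞ - ic}^{∞ - ic} F(t) dt = I`, as a (possibly only conditionally convergent) improper
integral along the horizontal line through `-ic`, both ends tending to infinity independently. -/
def HasLineIntegral (F : ℂ → ℂ) (c : ℝ) (I : ℂ) : Prop :=
  Tendsto (fun R : ℝ × ℝ => ∫ x in (-R.1)..R.2, F ((x : ℂ) - Complex.I * (c : ℂ)))
    (atTop ×ˢ atTop) (𝓝 I)

/-! ### Gaussian ensembles with real, complex and quaternion entries -/

/-- The positions strictly above the diagonal of an `N × N` matrix. -/
abbrev Upper (N : ℕ) : Type := {p : Fin N × Fin N // p.1 < p.2}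

/-- The independent real coordinates of an `N × N` Hermitian matrix whose off-diagonal entries have
`m` real components: the diagonal, and the components of the entries above the diagonal. -/
abbrev Coords (N m : ℕ) : Type := (Fin N → ℝ) × (Upper N → Fin m → ℝ)

/-- The Hermitian matrix with the given coordinates; `e` lists the real basis of the algebra of
entries. -/
def hermitianOf {N m : ℕ} {K : Type*} [Ring K] [StarRing K] [Algebra ℝ K] (e : Fin m → K)
    (x : Coords N m) : Matrix (Fin N) (Fin N) K :=
  Matrix.of fun i j =>
    if i = j then algebraMap ℝ K (x.1 i)
    else if h : i < j then ∑ k, x.2 ⟨(i, j), h⟩ k • e k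
    else if h : j < i then star (∑ k, x.2 ⟨(j, i), h⟩ k • e k)
    else 0

/-- The probability measure on Hermitian matrices with density proportional to `exp (-Tr G² / 2)`,
in coordinates. Since `Tr G² = ∑ᵢ gᵢᵢ² + 2 ∑_{i<j} |gᵢⱼ|²`, all coordinates are independent centred
Gaussians, of variance `1` on the diagonal and of variance `1/2` for each component of an
off-diagonal entry. -/
def gaussianEnsemble (N m : ℕ) : Measure (Coords N m) :=
  (Measure.pi fun _ : Fin N => gaussianReal 0 1).prod
    (Measure.pi fun _ : Upper N => Measure.pi fun _ : Fin m => gaussianReal 0 (1 / 2))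

/-- The real basis of `ℝ`. -/
def realUnits : Fin 1 → ℝ := ![1]

/-- The real basis of `ℂ`. -/
def complexUnits : Fin 2 → ℂ := ![1, Complex.I]

/-- The real basis of the quaternions. -/
def quaternionUnits : Fin 4 → ℍ[ℝ] := ![⟨1, 0, 0, 0⟩, ⟨0, 1, 0, 0⟩, ⟨0, 0, 1, 0⟩, ⟨0, 0, 0, 1⟩]

/-- The unit column vector all of whose components are equal, `N^{-1/2} (1, …, 1)`. -/
def unitOnes (N : ℕ) (K : Type*) [Ring K] [Algebra ℝ K] : Fin N → K :=
  fun _ => algebraMap ℝ K (1 / Real.sqrt N)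

/-- The rank one perturbation `(2 β N)^{-1/2} G + α u uᵀ`, where `u` is the unit vector with all
components equal. -/
def rankOnePerturbed {N : ℕ} {K : Type*} [Ring K] [Algebra ℝ K] (β α : ℝ)
    (G : Matrix (Fin N) (Fin N) K) : Matrix (Fin N) (Fin N) K :=
  (1 / Real.sqrt (2 * β * N)) • G + α • Matrix.vecMulVec (unitOnes N K) (unitOnes N K)

/-! ### The tridiagonal model -/

/-- The law of the square root of a variable with the gamma distribution `Γ[k/2, 1]`
(shape `k/2`, rate `1`). -/
def chiTilde (k : ℝ) : Measure ℝ := (gammaMeasure (k / 2) 1).map Real.sqrt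

/-- The joint law of the entries of `√(2βN) T_β`: the diagonal entries, which are independent
Gaussians of variance `1`, the first with mean `α √(2βN)` and the others centred, and the independent
off-diagonal entries, distributed as `χ̃_{β(N-1)}, χ̃_{β(N-2)}, …, χ̃_β`. -/
def tridiagonalLaw (N : ℕ) (β α : ℝ) : Measure ((Fin N → ℝ) × (Fin (N - 1) → ℝ)) :=
  (Measure.pi fun i : Fin N =>
      gaussianReal (if i.1 = 0 then α * Real.sqrt (2 * β * N) else 0) 1).prod
    (Measure.pi fun i : Fin (N - 1) => chiTilde (β * ((N : ℝ) - 1 - (i.1 : ℝ))))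

/-- The real symmetric tridiagonal matrix `(2βN)^{-1/2} (C₀ + C₁ + C₁ᵀ)`, with `C₀` the diagonal
matrix of `x.1`, and `C₁` having the entries of `x.2` immediately above the diagonal. -/
def tridiagonal {N : ℕ} (β : ℝ) (x : (Fin N → ℝ) × (Fin (N - 1) → ℝ)) :
    Matrix (Fin N) (Fin N) ℝ :=
  (1 / Real.sqrt (2 * β * N)) • Matrix.of fun i j =>
    if i = j then x.1 i
    else if h : i.1 + 1 = j.1 then x.2 ⟨i.1, by have := j.2; omega⟩
    else if h : j.1 + 1 = i.1 then x.2 ⟨j.1, by have := i.2; omega⟩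
    else 0

end RankOne

end

/-! Border a Jacobi matrix `T`, with eigenvalues m and spectral weights w (squared first components
of the normalized eigenvectors), by a corner a and an off-diagonal entry b. In an eigenbasis of `T`
the result is an arrow matrix with secular function x - a - ∑ b² w_j / (x - m_j) = ∏ (x - l_i) / ∏
(x - m_j). Its zeros l interlace with m and are the new eigenvalues; the residues of the reciprocal
are the new weights (`SpectralData.border`).

If w has a Dirichlet law with all parameters β/2 and b² is an independent gamma variable of the
matching shape, the numbers b² w_j are independent gamma variables. Hence the induction hypothesis
`IsSpectralMap`: eigenvalues, and weights scaled by an independent gamma variable, have a product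
law. That variable is exactly the squared off-diagonal entry of the next bordering. The induction
step `map_step` is Tonelli's theorem on triples (l, m, s), with two substitutions: (a, g) becomes l
for fixed m, and g becomes (s, m) for fixed l. Both Jacobians contain the same bordered Cauchy
determinant, which is therefore never evaluated. The remaining factors agree (`jointDensity_eq`)
because the weights sum to 1, because of the trace of the squared matrix, and because squared
Vandermonde times weights is ∏ |l_i - m_j| on both sides.

The perturbation only moves the mean of the corner entry to μ = α √(2βN). This multiplies the law by
exp(μ x₀ - μ²/2), where x₀ = ∑ w_i l_i. Integrating out the weights leaves the Dirichlet moment E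
exp(μ ∑ w_i l_i) as an additional factor of the eigenvalue density
(`map_eigenvalues_tridiagonalLaw`).

This moment is the contour integral. Independent gamma variables are g = r w with r independent of
w, so ∏ (s - a_j)^(-k) is a Laplace transform in r, and the contour integral inverts it at r = 1.
The product may decay too slowly for absolute convergence; inversion is applied to minus its
derivative, which is integrable along the line, and integration by parts returns to the product
(`integral_exp_resolventSum`, `tendsto_lineIntegral`).

For β = 1, 2, 4 the Gaussian ensemble is invariant under unitary conjugation. One rotation carries
the vector of equal components to the first unit vector, and a Householder reduction fixing that
vector produces the tridiagonal model (`exists_tridiagonalization`). The rank one term becomes the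
shift of the corner. -/

noncomputable section

namespace RankOne

open Finset Polynomial

/-! ### Interlacing sequences and partial fractions -/

/-- The points of `m` strictly separate the decreasing points of `l`. -/
def Interlace {n : ℕ} (l : Fin (n + 1) → ℝ) (m : Fin n → ℝ) : Prop :=
  ∀ j : Fin n, l j.succ < m j ∧ m j < l j.castSucc

/-- The derivative of `∏ (x - v k)` at the node `v i`. -/
def nodeProd {n : ℕ} (v : Fin n → ℝ) (i : Fin n) : ℝ := ∏ k ∈ univ.erase i, (v i - v k)

/-- Minus the residue at `m j` of `∏ (x - l i) / ∏ (x - m k)`. -/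
def poleWeight {n : ℕ} (l : Fin (n + 1) → ℝ) (m : Fin n → ℝ) (j : Fin n) : ℝ :=
  -(∏ i, (m j - l i)) / nodeProd m j

/-- The residue at `l i` of `∏ (x - m j) / ∏ (x - l k)`. -/
def zeroWeight {n : ℕ} (l : Fin (n + 1) → ℝ) (m : Fin n → ℝ) (i : Fin (n + 1)) : ℝ :=
  (∏ j, (l i - m j)) / nodeProd l i

variable {n : ℕ}

/-- Positivity of all residues reduces to counting negative factors, which interlacing determines.
-/
theorem prod_sign (f : Fin n → ℝ) (r : ℕ) (hr : r ≤ n) (hneg : ∀ i, i.1 < r → f i < 0)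
    (hpos : ∀ i, r ≤ i.1 → 0 < f i) : 0 < (-1 : ℝ) ^ r * ∏ i, f i := by
  have h1 : ∏ i, f i = ∏ i, ((if i.1 < r then (-1 : ℝ) else 1) * |f i|) := by
    refine Finset.prod_congr rfl fun i _ => ?_
    split_ifs with h
    · rw [abs_of_neg (hneg i h)]; ring
    · rw [abs_of_pos (hpos i (not_lt.mp h))]; ring
  have h2 : ∏ i : Fin n, (if i.1 < r then (-1 : ℝ) else 1) = (-1) ^ r := by
    rw [Finset.prod_ite, Finset.prod_const, Finset.prod_const_one, mul_one,
      Fin.card_filter_val_lt, min_eq_right hr]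
  rw [h1, Finset.prod_mul_distrib, h2, ← mul_assoc, ← mul_pow]
  simp only [mul_neg, mul_one, neg_neg, one_pow, one_mul]
  refine Finset.prod_pos fun i _ => abs_pos.mpr ?_
  rcases lt_or_ge i.1 r with h | h
  · exact (hneg i h).ne
  · exact (hpos i h).ne'

theorem nodeProd_sign {v : Fin n → ℝ} (hv : StrictAnti v) (i : Fin n) :
    0 < (-1 : ℝ) ^ i.1 * nodeProd v i := by
  have h : nodeProd v i = ∏ k, (if k = i then 1 else v i - v k) := by
    rw [nodeProd, ← Finset.mul_prod_erase univ _ (mem_univ i), if_pos rfl, one_mul]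
    exact Finset.prod_congr rfl fun k hk => by rw [if_neg (Finset.ne_of_mem_erase hk)]
  rw [h]
  refine prod_sign _ _ i.2.le (fun k hk => ?_) fun k hk => ?_
  · have : k < i := hk
    rw [if_neg this.ne]; linarith [hv this]
  · split_ifs with hki
    · exact one_pos
    · have : i < k := lt_of_le_of_ne hk (Ne.symm hki)
      linarith [hv this]

theorem nodeProd_ne_zero {v : Fin n → ℝ} (hv : StrictAnti v) (i : Fin n) : nodeProd v i ≠ 0 :=
  fun h => by simpa [h] using nodeProd_sign hv i

theorem pow_neg_one_mul_self (i : ℕ) : ((-1 : ℝ) ^ i) * (-1) ^ i = 1 := by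
  rw [← mul_pow]; simp

theorem div_pos_of_sign {a b : ℝ} (i : ℕ) (ha : 0 < (-1 : ℝ) ^ i * a) (hb : 0 < (-1 : ℝ) ^ i * b) :
    0 < a / b := by
  have := div_pos ha hb
  rwa [mul_div_mul_left _ _ (pow_ne_zero _ (by norm_num))] at this

namespace Interlace

variable {l : Fin (n + 1) → ℝ} {m : Fin n → ℝ}

theorem strictAnti_left (h : Interlace l m) : StrictAnti l :=
  Fin.strictAnti_iff_succ_lt.mpr fun j => (h j).1.trans (h j).2

theorem lt_left (h : Interlace l m) {i : Fin (n + 1)} {j : Fin n} (hij : i.1 ≤ j.1) : m j < l i :=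
  (h j).2.trans_le (h.strictAnti_left.antitone (show i ≤ j.castSucc from hij))

theorem left_lt (h : Interlace l m) {i : Fin (n + 1)} {j : Fin n} (hij : j.1 < i.1) : l i < m j :=
  (h.strictAnti_left.antitone (show j.succ ≤ i from hij)).trans_lt (h j).1

theorem strictAnti_right (h : Interlace l m) : StrictAnti m := fun i j hij =>
  ((h.lt_left (i := i.succ) (j := j) hij).trans (h i).1)

theorem ne (h : Interlace l m) (i : Fin (n + 1)) (j : Fin n) : l i - m j ≠ 0 := by
  rcases le_or_gt i.1 j.1 with hij | hij
  · exact (sub_pos.mpr (h.lt_left hij)).ne'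
  · exact (sub_neg.mpr (h.left_lt hij)).ne

theorem poleWeight_pos (h : Interlace l m) (j : Fin n) : 0 < poleWeight l m j := by
  refine div_pos_of_sign j.1 ?_ (nodeProd_sign h.strictAnti_right j)
  have := prod_sign (fun i => m j - l i) (j.1 + 1) (by omega)
    (fun i hi => sub_neg.mpr (h.lt_left (Nat.lt_succ_iff.mp hi)))
    (fun i hi => sub_pos.mpr (h.left_lt hi))
  rw [pow_succ] at this
  linarith

theorem zeroWeight_pos (h : Interlace l m) (i : Fin (n + 1)) : 0 < zeroWeight l m i := by
  refine div_pos_of_sign i.1 ?_ (nodeProd_sign h.strictAnti_left i)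
  exact prod_sign (fun j => l i - m j) i.1 (by omega)
    (fun j hj => sub_neg.mpr (h.left_lt hj))
    (fun j hj => sub_pos.mpr (h.lt_left hj))

end Interlace

/-- The signs alternate along `v`, so the intermediate value theorem gives one zero in each gap. -/
theorem exists_roots {n : ℕ} {f : ℝ → ℝ} (hf : Continuous f) {v : Fin (n + 1) → ℝ} (hv : StrictAnti v)
    (hs : ∀ i, 0 < (-1 : ℝ) ^ i.1 * f (v i)) :
    ∃ r : Fin n → ℝ, Interlace v r ∧ ∀ j, f (r j) = 0 := by
  have key : ∀ j : Fin n, ∃ x, (v j.succ < x ∧ x < v j.castSucc) ∧ f x = 0 := by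
    intro j
    have hlt : v j.succ < v j.castSucc := hv (Fin.castSucc_lt_succ)
    have h1 := hs j.succ
    have h2 := hs j.castSucc
    simp only [Fin.val_succ, Fin.val_castSucc, pow_succ] at h1 h2
    set g : ℝ → ℝ := fun x => (-1 : ℝ) ^ j.1 * f x with hg
    have hgc : ContinuousOn g (Set.Icc (v j.succ) (v j.castSucc)) := by fun_prop
    have hmem : (0 : ℝ) ∈ Set.Ioo (g (v j.succ)) (g (v j.castSucc)) := by
      constructor <;> simp only [hg] <;> linarith
    obtain ⟨x, hx, hx0⟩ := intermediate_value_Ioo hlt.le hgc hmem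
    refine ⟨x, ⟨hx.1, hx.2⟩, ?_⟩
    simpa [hg] using hx0
  choose r hr using key
  exact ⟨r, fun j => (hr j).1, fun j => (hr j).2⟩

/-- A finite set has only one monotone enumeration; negation reduces to the increasing case. -/
theorem strictAnti_ext {v w : Fin n → ℝ} (hv : StrictAnti v) (hw : StrictAnti w)
    (h : Set.range v = Set.range w) : v = w := by
  have h1 : StrictMono (fun i => -v i) := fun i j hij => neg_lt_neg (hv hij)
  have h2 : StrictMono (fun i => -w i) := fun i j hij => neg_lt_neg (hw hij)
  have h3 : Set.range (fun i => -v i) = Set.range (fun i => -w i) := by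
    have := congrArg (fun s => (fun x : ℝ => -x) '' s) h
    simpa only [← Set.range_comp, Function.comp_def] using this
  have := (StrictMono.range_inj h1 h2).mp h3
  funext i
  simpa using congrFun this i

/-- `∏ (X - v i)`. -/
abbrev nodePoly (v : Fin n → ℝ) : ℝ[X] := ∏ i, (X - C (v i))

/-- `∏_{k ≠ i} (X - v k)`. -/
abbrev nodePolyErase (v : Fin n → ℝ) (i : Fin n) : ℝ[X] := ∏ k ∈ univ.erase i, (X - C (v k))

theorem nodePoly_monic (v : Fin n → ℝ) : (nodePoly v).Monic := monic_prod_X_sub_C _ _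

theorem nodePoly_natDegree (v : Fin n → ℝ) : (nodePoly v).natDegree = n := by
  simp [nodePoly]

theorem nodePolyErase_monic (v : Fin n → ℝ) (i : Fin n) : (nodePolyErase v i).Monic :=
  monic_prod_X_sub_C _ _

theorem nodePolyErase_natDegree (v : Fin n → ℝ) (i : Fin n) :
    (nodePolyErase v i).natDegree = n - 1 := by
  simp [nodePolyErase]

theorem eval_nodePoly_self (v : Fin n → ℝ) (i : Fin n) : (nodePoly v).eval (v i) = 0 := by
  rw [eval_prod]
  exact Finset.prod_eq_zero (mem_univ i) (by simp)

theorem eval_nodePoly_eq_zero {v : Fin n → ℝ} {x : ℝ} :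
    (nodePoly v).eval x = 0 ↔ x ∈ Set.range v := by
  rw [eval_prod, Finset.prod_eq_zero_iff]
  simp [sub_eq_zero, eq_comm]

theorem eval_nodePolyErase_self (v : Fin n → ℝ) (i : Fin n) :
    (nodePolyErase v i).eval (v i) = nodeProd v i := by
  simp [eval_prod, nodeProd]

theorem eval_nodePolyErase_ne (v : Fin n → ℝ) {i j : Fin n} (h : j ≠ i) :
    (nodePolyErase v i).eval (v j) = 0 := by
  rw [eval_prod]
  exact Finset.prod_eq_zero (Finset.mem_erase.mpr ⟨h, mem_univ j⟩) (by simp)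

theorem eval_sum_nodePolyErase (v g : Fin n → ℝ) (j : Fin n) :
    (∑ i, C (g i) * nodePolyErase v i).eval (v j) = g j * nodeProd v j := by
  rw [eval_finsetSum, Finset.sum_eq_single j]
  · simp [eval_nodePolyErase_self]
  · intro i _ hij
    rw [eval_mul, eval_nodePolyErase_ne v hij.symm, mul_zero]
  · simp

theorem degree_sum_nodePolyErase_lt (v g : Fin n → ℝ) :
    (∑ i, C (g i) * nodePolyErase v i).degree < n := by
  rw [degree_lt_iff_coeff_zero]
  intro k hk
  rw [finsetSum_coeff]
  refine Finset.sum_eq_zero fun i _ => ?_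
  have hn : 0 < n := i.pos
  rw [coeff_C_mul, coeff_eq_zero_of_natDegree_lt, mul_zero]
  rw [nodePolyErase_natDegree]; omega

theorem eq_of_degree_lt_of_eval {p q : ℝ[X]} {v : Fin n → ℝ} (hv : Function.Injective v)
    (hp : p.degree < n) (hq : q.degree < n) (h : ∀ i, p.eval (v i) = q.eval (v i)) : p = q := by
  refine Polynomial.eq_of_degrees_lt_of_eval_index_eq univ hv.injOn ?_ ?_ fun i _ => h i
  · simpa using hp
  · simpa using hq

theorem degree_sub_lt_of_monic {p q : ℝ[X]} (hp : p.Monic) (hq : q.Monic) (hpn : p.natDegree = n)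
    (hqn : q.natDegree = n) : (p - q).degree < n := by
  rw [degree_lt_iff_coeff_zero]
  intro k hk
  rcases hk.eq_or_lt with rfl | hk
  · have h1 := hp.coeff_natDegree
    have h2 := hq.coeff_natDegree
    rw [hpn] at h1; rw [hqn] at h2
    simp [h1, h2]
  · simp [coeff_eq_zero_of_natDegree_lt (hpn.trans_lt hk),
      coeff_eq_zero_of_natDegree_lt (hqn.trans_lt hk)]

theorem eq_nodePoly {p : ℝ[X]} (hp : p.Monic) (hn : p.natDegree = n) {v : Fin n → ℝ}
    (hv : Function.Injective v) (h : ∀ i, p.eval (v i) = 0) : p = nodePoly v := by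
  have := eq_of_degree_lt_of_eval (q := 0) hv
    (degree_sub_lt_of_monic hp (nodePoly_monic v) hn (nodePoly_natDegree v)) (by simp)
    (fun i => by rw [eval_sub, h i, eval_nodePoly_self]; simp)
  exact sub_eq_zero.mp this

/-- The numerator of `x - a - ∑ g j / (x - m j)`. -/
def borderPoly (a : ℝ) (m g : Fin n → ℝ) : ℝ[X] :=
  nodePoly (Fin.cons a m : Fin (n + 1) → ℝ) - ∑ j, C (g j) * nodePolyErase m j

theorem borderPoly_monic (a : ℝ) (m g : Fin n → ℝ) :
    (borderPoly a m g).Monic ∧ (borderPoly a m g).natDegree = n + 1 := by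
  have hd := degree_sum_nodePolyErase_lt m g
  have hdeg : (∑ j, C (g j) * nodePolyErase m j).degree <
      (nodePoly (Fin.cons a m : Fin (n + 1) → ℝ)).degree := by
    rw [degree_eq_natDegree (nodePoly_monic _).ne_zero, nodePoly_natDegree]
    exact hd.trans (by exact_mod_cast Nat.lt_succ_self n)
  refine ⟨(nodePoly_monic _).sub_of_left hdeg, ?_⟩
  rw [borderPoly, natDegree_sub_eq_left_of_natDegree_lt, nodePoly_natDegree]
  rw [nodePoly_natDegree]
  by_cases h0 : (∑ j, C (g j) * nodePolyErase m j) = 0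
  · rw [h0]; simp
  · exact ((natDegree_lt_iff_degree_lt h0).mpr hd).trans (Nat.lt_succ_self n)

theorem coeff_nodePoly_pred (v : Fin (n + 1) → ℝ) : (nodePoly v).coeff n = -∑ i, v i := by
  have := prod_X_sub_C_coeff_card_pred (univ : Finset (Fin (n + 1))) v (by simp)
  simpa using this

theorem coeff_borderPoly_pred (a : ℝ) (m g : Fin n → ℝ) :
    (borderPoly a m g).coeff n = -(a + ∑ j, m j) := by
  rw [borderPoly, coeff_sub, coeff_nodePoly_pred, Fin.sum_univ_succ,
    coeff_eq_zero_of_degree_lt (degree_sum_nodePolyErase_lt m g)]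
  simp

theorem eval_borderPoly (a : ℝ) (m g : Fin n → ℝ) (j : Fin n) :
    (borderPoly a m g).eval (m j) = -(g j * nodeProd m j) := by
  rw [borderPoly, eval_sub, eval_sum_nodePolyErase, eval_nodePoly_eq_zero.mpr ⟨j.succ, by simp⟩,
    zero_sub]

/-- Both sides are monic of degree n + 1. The corner is chosen to match the coefficient of degree n
and the weights to match the values at the nodes, so the difference has degree less than n and
vanishes at n points. -/
theorem nodePoly_eq_borderPoly {l : Fin (n + 1) → ℝ} {m : Fin n → ℝ} (hm : StrictAnti m) :
    nodePoly l = borderPoly (∑ i, l i - ∑ j, m j) m (poleWeight l m) := by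
  set a := ∑ i, l i - ∑ j, m j with ha
  obtain ⟨h1, h2⟩ := borderPoly_monic a m (poleWeight l m)
  have hd := degree_sub_lt_of_monic (nodePoly_monic l) h1 (nodePoly_natDegree l) h2
  have hd' : (nodePoly l - borderPoly a m (poleWeight l m)).degree < n := by
    rw [degree_lt_iff_coeff_zero] at hd ⊢
    intro k hk
    rcases hk.eq_or_lt with rfl | hk
    · rw [coeff_sub, coeff_nodePoly_pred, coeff_borderPoly_pred, ha]; ring
    · exact hd k hk
  refine sub_eq_zero.mp (eq_of_degree_lt_of_eval (q := 0) hm.injective hd' (by simp) fun j => ?_)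
  rw [eval_sub, eval_borderPoly, poleWeight, div_mul_cancel₀ _ (nodeProd_ne_zero hm j), eval_prod]
  simp

/-- Lagrange interpolation at the points of `l`. Comparing leading coefficients shows that the
weights sum to 1. -/
theorem nodePoly_eq_sum {l : Fin (n + 1) → ℝ} (m : Fin n → ℝ) (hl : StrictAnti l) :
    nodePoly m = ∑ i, C (zeroWeight l m i) * nodePolyErase l i := by
  refine eq_of_degree_lt_of_eval hl.injective ?_ (degree_sum_nodePolyErase_lt l _) fun i => ?_
  · rw [degree_eq_natDegree (nodePoly_monic _).ne_zero, nodePoly_natDegree]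
    exact_mod_cast Nat.lt_succ_self n
  · rw [eval_sum_nodePolyErase, zeroWeight, div_mul_cancel₀ _ (nodeProd_ne_zero hl i), eval_prod]
    simp

theorem coeff_sum_nodePolyErase (l g : Fin (n + 1) → ℝ) :
    (∑ i, C (g i) * nodePolyErase l i).coeff n = ∑ i, g i := by
  rw [finsetSum_coeff]
  refine Finset.sum_congr rfl fun i _ => ?_
  have := (nodePolyErase_monic l i).coeff_natDegree
  rw [nodePolyErase_natDegree, Nat.add_sub_cancel] at this
  rw [coeff_C_mul, this, mul_one]

theorem sum_zeroWeight {l : Fin (n + 1) → ℝ} (m : Fin n → ℝ) (hl : StrictAnti l) :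
    ∑ i, zeroWeight l m i = 1 := by
  have h := (nodePoly_monic m).coeff_natDegree
  rwa [nodePoly_natDegree, nodePoly_eq_sum m hl, coeff_sum_nodePolyErase] at h

theorem nodePoly_inj {v w : Fin n → ℝ} (hv : StrictAnti v) (hw : StrictAnti w)
    (h : nodePoly v = nodePoly w) : v = w := by
  refine strictAnti_ext hv hw (Set.ext fun x => ?_)
  rw [← eval_nodePoly_eq_zero, h, eval_nodePoly_eq_zero]

/-- Surjectivity of `poleMap m`. At `m j` the polynomial equals `-(g j * nodeProd m j)`, so its
signs alternate along `m`; the signs at both infinities continue the pattern, and the n + 1 gaps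
account for all roots. -/
theorem exists_interlace_poleWeight {m : Fin n → ℝ} (hm : StrictAnti m) (a : ℝ) {g : Fin n → ℝ}
    (hg : ∀ j, 0 < g j) :
    ∃ l : Fin (n + 1) → ℝ, Interlace l m ∧ ∑ i, l i - ∑ j, m j = a ∧ poleWeight l m = g := by
  set P := borderPoly a m g with hP
  obtain ⟨h1, h2⟩ := borderPoly_monic a m g
  rw [← hP] at h1 h2
  -- signs at infinity
  have htop : ∀ᶠ x in atTop, 0 < P.eval x :=
    (P.tendsto_atTop_of_leadingCoeff_nonneg
      (natDegree_pos_iff_degree_pos.mp (by omega)) (by rw [h1.leadingCoeff]; norm_num)).eventually_gt_atTop 0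
  have hbot : ∀ᶠ x in atTop, 0 < (-1 : ℝ) ^ (n + 1) * P.eval (-x) := by
    set R : ℝ[X] := C ((-1 : ℝ) ^ (n + 1)) * P.comp (-X) with hR
    have hc : ((-1 : ℝ) ^ (n + 1)) ≠ 0 := pow_ne_zero _ (by norm_num)
    have hRd : R.natDegree = n + 1 := by
      rw [hR, natDegree_C_mul hc, natDegree_comp, h2]; simp
    have hRl : R.leadingCoeff = 1 := by
      rw [hR, leadingCoeff_mul, leadingCoeff_comp (by simp), h1.leadingCoeff, h2, leadingCoeff_C]
      simp [pow_neg_one_mul_self]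
    have := (R.tendsto_atTop_of_leadingCoeff_nonneg
      (natDegree_pos_iff_degree_pos.mp (by omega)) (by rw [hRl]; norm_num)).eventually_gt_atTop 0
    filter_upwards [this] with x hx
    simpa [hR] using hx
  have hbd : ∀ᶠ x in atTop, ∀ j, |m j| < x := by
    rw [eventually_all]; exact fun j => eventually_gt_atTop _
  obtain ⟨M, ⟨⟨hM1, hM2⟩, hM3⟩, hM4⟩ := (((htop.and hbot).and hbd).and (eventually_gt_atTop 0)).exists
  -- `M` is beyond every `|m j|` and far enough for the signs at infinity, so M, m, -M is a
  -- decreasing list of n + 2 points with alternating signs.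
  set v : Fin (n + 2) → ℝ := Fin.cons M (Fin.snoc m (-M) : Fin (n + 1) → ℝ) with hv
  have hsn : StrictAnti (Fin.snoc m (-M) : Fin (n + 1) → ℝ) := by
    intro i j hij
    induction i using Fin.lastCases with
    | last => exact absurd hij (not_lt.mpr (Fin.le_last j))
    | cast i =>
      induction j using Fin.lastCases with
      | last => simp only [Fin.snoc_last, Fin.snoc_castSucc]; linarith [neg_abs_le (m i), hM3 i]
      | cast j => simpa using hm (Fin.castSucc_lt_castSucc_iff.mp hij)
  have hva : StrictAnti v := by
    refine Fin.strictAnti_iff_succ_lt.mpr fun j => ?_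
    induction j using Fin.cases with
    | zero =>
      simp only [hv, Fin.cons_succ, Fin.castSucc_zero, Fin.cons_zero]
      refine Fin.lastCases (motive := fun z => (Fin.snoc m (-M) : Fin (n + 1) → ℝ) z < M) ?_ (fun i => ?_) 0
      · simp only [Fin.snoc_last]; linarith
      · simp only [Fin.snoc_castSucc]; linarith [le_abs_self (m i), hM3 i]
    | succ j =>
      rw [Fin.castSucc_succ]
      simp only [hv, Fin.cons_succ]
      exact hsn Fin.castSucc_lt_succ
  have hs : ∀ i, 0 < (-1 : ℝ) ^ i.1 * P.eval (v i) := by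
    intro i
    induction i using Fin.cases with
    | zero => simpa [hv] using hM1
    | succ i =>
      simp only [hv, Fin.cons_succ]
      induction i using Fin.lastCases with
      | last => simpa using hM2
      | cast j =>
        simp only [Fin.snoc_castSucc, Fin.val_succ, Fin.val_castSucc]
        rw [hP, eval_borderPoly, pow_succ]
        have := mul_pos (hg j) (nodeProd_sign hm j)
        linarith
  obtain ⟨l, hl, hl0⟩ := exists_roots P.continuous hva hs
  have hint : Interlace l m := by
    intro j
    have e1 : v j.succ.castSucc = m j := by
      rw [Fin.castSucc_succ]; simp [hv]
    have e2 : v j.castSucc.succ = m j := by simp [hv]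
    exact ⟨by have := (hl j.succ).2; rwa [e1] at this,
      by have := (hl j.castSucc).1; rwa [e2] at this⟩
  have hPl : P = nodePoly l := eq_nodePoly h1 h2 hint.strictAnti_left.injective hl0
  refine ⟨l, hint, ?_, funext fun j => ?_⟩
  · have := coeff_nodePoly_pred l
    rw [← hPl, hP, coeff_borderPoly_pred] at this
    linarith
  · have := eval_borderPoly a m g j
    rw [← hP, hPl, eval_prod] at this
    rw [poleWeight, div_eq_iff (nodeProd_ne_zero hm j)]
    simp only [eval_sub, eval_X, eval_C] at this
    rw [this]; ring

/-- Surjectivity of `zeroMap l`. The numerator of ∑ g_i / (x - l_i) has alternating signs along `l`,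
so it has n interlacing zeros; its leading coefficient is the total ∑ g_i. -/
theorem exists_interlace_zeroWeight {l : Fin (n + 1) → ℝ} (hl : StrictAnti l) {g : Fin (n + 1) → ℝ}
    (hg : ∀ i, 0 < g i) :
    ∃ m : Fin n → ℝ, Interlace l m ∧ ∀ i, (∑ k, g k) * zeroWeight l m i = g i := by
  set P := ∑ i, C (g i) * nodePolyErase l i with hP
  set s := ∑ k, g k with hs
  have hs0 : 0 < s := Finset.sum_pos (fun i _ => hg i) ⟨0, mem_univ _⟩
  obtain ⟨m, hm, hm0⟩ := exists_roots P.continuous hl fun i => by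
    rw [hP, eval_sum_nodePolyErase]
    have := mul_pos (hg i) (nodeProd_sign hl i)
    linarith
  refine ⟨m, hm, fun i => ?_⟩
  have hd : P.degree < (n + 1 : ℕ) := degree_sum_nodePolyErase_lt l g
  have hc : P.coeff n = s := coeff_sum_nodePolyErase l g
  have hPm : P = C s * nodePoly m := by
    refine sub_eq_zero.mp (eq_of_degree_lt_of_eval (q := 0) hm.strictAnti_right.injective ?_ (by simp) fun j => ?_)
    · rw [degree_lt_iff_coeff_zero] at hd ⊢
      intro k hk
      have hmn := (nodePoly_monic m).coeff_natDegree
      rw [nodePoly_natDegree] at hmn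
      rcases hk.eq_or_lt with rfl | hk
      · rw [coeff_sub, hc, coeff_C_mul, hmn]; ring
      · rw [coeff_sub, hd k hk, coeff_C_mul,
          coeff_eq_zero_of_natDegree_lt ((nodePoly_natDegree m).trans_lt hk)]; ring
    · rw [eval_sub, hm0 j, eval_mul, eval_nodePoly_self]; simp
  have := eval_sum_nodePolyErase l g i
  rw [← hP, hPm, eval_mul, eval_C, eval_prod] at this
  rw [zeroWeight, mul_div_assoc', div_eq_iff (nodeProd_ne_zero hl i), ← this]
  simp

end RankOne
end

/-! ### Injectivity of the spectral parametrizations, bordered matrices and Jacobians. -/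

noncomputable section

namespace RankOne

open Finset Polynomial

variable {n : ℕ}

theorem poleWeight_injOn {l l' : Fin (n + 1) → ℝ} {m : Fin n → ℝ} (h : Interlace l m)
    (h' : Interlace l' m) (hs : ∑ i, l i = ∑ i, l' i) (hg : poleWeight l m = poleWeight l' m) :
    l = l' := by
  refine nodePoly_inj h.strictAnti_left h'.strictAnti_left ?_
  rw [nodePoly_eq_borderPoly h.strictAnti_right, nodePoly_eq_borderPoly h.strictAnti_right, hs, hg]

theorem zeroWeight_injOn {l : Fin (n + 1) → ℝ} {m m' : Fin n → ℝ} (h : Interlace l m)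
    (h' : Interlace l m') (hw : zeroWeight l m = zeroWeight l m') : m = m' := by
  refine nodePoly_inj h.strictAnti_right h'.strictAnti_right ?_
  rw [nodePoly_eq_sum m h.strictAnti_left, nodePoly_eq_sum m' h.strictAnti_left, hw]

/-! ### Matrices bordered by a row and a column -/

section Block

variable {K : Type*}

/-- The matrix `M` bordered by a corner `a`, a top row `r` and a left column `c`. -/
def block (a : K) (r c : Fin n → K) (M : Matrix (Fin n) (Fin n) K) :
    Matrix (Fin (n + 1)) (Fin (n + 1)) K :=
  Matrix.of (Fin.cons (Fin.cons a r) fun i => Fin.cons (c i) (M i))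

section
variable (a : K) (r c : Fin n → K) (M : Matrix (Fin n) (Fin n) K)
@[simp] theorem block_zero_zero : block a r c M 0 0 = a := rfl
@[simp] theorem block_zero_succ (j : Fin n) : block a r c M 0 j.succ = r j := rfl
@[simp] theorem block_succ_zero (i : Fin n) : block a r c M i.succ 0 = c i := rfl
@[simp] theorem block_succ_succ (i j : Fin n) : block a r c M i.succ j.succ = M i j := rfl
end

theorem block_mul_block [Ring K] (a a' : K) (r c r' c' : Fin n → K)
    (M M' : Matrix (Fin n) (Fin n) K) :
    block a r c M * block a' r' c' M' =
      block (a * a' + ∑ k, r k * c' k) (fun j => a * r' j + ∑ k, r k * M' k j)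
        (fun i => c i * a' + ∑ k, M i k * c' k)
        (Matrix.of fun i j => c i * r' j + ∑ k, M i k * M' k j) := by
  ext i j
  induction i using Fin.cases <;> induction j using Fin.cases <;>
    simp [Matrix.mul_apply, Fin.sum_univ_succ]

theorem block_one [Ring K] : block (n := n) (1 : K) 0 0 1 = 1 := by
  ext i j
  induction i using Fin.cases <;> induction j using Fin.cases <;>
    simp [Matrix.one_apply, Fin.ext_iff]

theorem block_transpose (a : K) (r c : Fin n → K) (M : Matrix (Fin n) (Fin n) K) :
    (block a r c M).transpose = block a c r M.transpose := by
  ext i j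
  induction i using Fin.cases <;> induction j using Fin.cases <;> simp

end Block

/-! ### Arrow matrices -/

/-- The partial fraction expansion, whose right side is the secular function of an arrow matrix. -/
theorem prod_sub_div {l : Fin (n + 1) → ℝ} {m : Fin n → ℝ} (h : Interlace l m) {x : ℝ}
    (hx : ∀ j, x - m j ≠ 0) :
    (∏ i, (x - l i)) / ∏ j, (x - m j) =
      x - (∑ i, l i - ∑ j, m j) - ∑ j, poleWeight l m j / (x - m j) := by
  have h1 := congrArg (Polynomial.eval x) (nodePoly_eq_borderPoly (l := l) h.strictAnti_right)
  have hQ : ∏ j, (x - m j) ≠ 0 := Finset.prod_ne_zero_iff.mpr fun j _ => hx j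
  rw [borderPoly, eval_sub, eval_prod, eval_prod, eval_finsetSum] at h1
  simp only [eval_sub, eval_X, eval_C, eval_mul, eval_prod] at h1
  rw [Fin.prod_univ_succ (fun i => x - (Fin.cons (∑ i, l i - ∑ j, m j) m : Fin (n + 1) → ℝ) i)] at h1
  simp only [Fin.cons_zero, Fin.cons_succ] at h1
  rw [div_eq_iff hQ, h1, sub_mul (x - _) (∑ j, _), Finset.sum_mul]
  congr 1
  refine Finset.sum_congr rfl fun j _ => ?_
  rw [← Finset.mul_prod_erase univ _ (mem_univ j)]
  have := hx j
  field_simp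

namespace Interlace

variable {l : Fin (n + 1) → ℝ} {m : Fin n → ℝ}

theorem secular (h : Interlace l m) (i : Fin (n + 1)) :
    l i - (∑ i, l i - ∑ j, m j) - ∑ j, poleWeight l m j / (l i - m j) = 0 := by
  rw [← prod_sub_div h (h.ne i), Finset.prod_eq_zero (mem_univ i) (sub_self _), zero_div]

/-- Subtracting the vanishing value at `l i` exhibits the factor `x - l i` and leaves a divided
difference. At `x = l k` this yields orthogonality of eigenvectors, and as x tends to `l i` their
normalization. -/
theorem secular_sub (h : Interlace l m) (i : Fin (n + 1)) {x : ℝ} (hx : ∀ j, x - m j ≠ 0) :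
    (∏ i, (x - l i)) / ∏ j, (x - m j) =
      (x - l i) * (1 + ∑ j, poleWeight l m j / ((l i - m j) * (x - m j))) := by
  rw [prod_sub_div h hx, ← sub_zero (x - _ - _), ← h.secular i, mul_add, Finset.mul_sum]
  have : ∀ j, (x - l i) * (poleWeight l m j / ((l i - m j) * (x - m j))) =
      poleWeight l m j / (l i - m j) - poleWeight l m j / (x - m j) := fun j => by
    have := hx j
    have := h.ne i j
    field_simp
    ring
  rw [Finset.sum_congr rfl fun j _ => this j, Finset.sum_sub_distrib]
  ring

theorem orthogonality (h : Interlace l m) {i k : Fin (n + 1)} (hik : i ≠ k) :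
    1 + ∑ j, poleWeight l m j / ((l i - m j) * (l k - m j)) = 0 := by
  have h1 := h.secular_sub i (x := l k) (h.ne k)
  rw [Finset.prod_eq_zero (mem_univ k) (sub_self _), zero_div] at h1
  exact (mul_eq_zero.mp h1.symm).resolve_left
    (sub_ne_zero.mpr fun h2 => hik (h.strictAnti_left.injective h2).symm)

theorem normalization (h : Interlace l m) (i : Fin (n + 1)) :
    zeroWeight l m i * (1 + ∑ j, poleWeight l m j / ((l i - m j) * (l i - m j))) = 1 := by
  set F : ℝ → ℝ := fun x => (∏ k ∈ univ.erase i, (x - l k)) / ∏ j, (x - m j) with hF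
  set G : ℝ → ℝ := fun x => 1 + ∑ j, poleWeight l m j / ((l i - m j) * (x - m j)) with hG
  have hQ : ∏ j, (l i - m j) ≠ 0 := Finset.prod_ne_zero_iff.mpr fun j _ => h.ne i j
  have hFc : ContinuousAt F (l i) := by
    refine ContinuousAt.div (by fun_prop) (by fun_prop) hQ
  have hGc : ContinuousAt G (l i) := by
    refine continuousAt_const.add (tendsto_finsetSum _ fun j _ => ?_)
    exact ContinuousAt.div (by fun_prop) (by fun_prop) (mul_ne_zero (h.ne i j) (h.ne i j))
  have hne : ∀ᶠ x in 𝓝[≠] (l i), ∀ j, x - m j ≠ 0 := by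
    rw [eventually_all]
    intro j
    exact ((by fun_prop : ContinuousAt (fun x => x - m j) (l i)).eventually_ne
      (h.ne i j)).filter_mono nhdsWithin_le_nhds
  -- The factor `x - l i` can be cancelled only away from `l i`; continuity of both sides extends
  -- the identity to that point.
  have heq : F =ᶠ[𝓝[≠] (l i)] G := by
    filter_upwards [hne, self_mem_nhdsWithin] with x hx hxi
    have hxi' : x - l i ≠ 0 := sub_ne_zero.mpr hxi
    have := h.secular_sub i hx
    rw [← Finset.mul_prod_erase univ _ (mem_univ i), mul_div_assoc] at this
    exact mul_left_cancel₀ hxi' this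
  have hFG : F (l i) = G (l i) :=
    tendsto_nhds_unique ((hFc.tendsto.mono_left nhdsWithin_le_nhds).congr' heq)
      (hGc.tendsto.mono_left nhdsWithin_le_nhds)
  have hN : nodeProd l i ≠ 0 := nodeProd_ne_zero h.strictAnti_left i
  change _ * G (l i) = 1
  rw [← hFG]
  simp only [hF, zeroWeight]
  change _ * (nodeProd l i / _) = 1
  field_simp

end Interlace

/-- The matrix of normalized eigenvectors of an arrow matrix. -/
def arrowVectors (l : Fin (n + 1) → ℝ) (m z : Fin n → ℝ) : Matrix (Fin (n + 1)) (Fin (n + 1)) ℝ :=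
  Matrix.of (Fin.cons (fun i => √(zeroWeight l m i))
    fun j i => √(zeroWeight l m i) * (z j / (l i - m j)))

/-- The Cauchy matrix bordered by a row of ones. -/
def cauchyBordered (l : Fin (n + 1) → ℝ) (m : Fin n → ℝ) : Matrix (Fin (n + 1)) (Fin (n + 1)) ℝ :=
  Matrix.of (Fin.cons (fun _ => 1) fun j i => 1 / (l i - m j))

section Arrow

variable {l : Fin (n + 1) → ℝ} {m z : Fin n → ℝ}

theorem arrowVectors_orthogonal (h : Interlace l m) (hz : ∀ j, z j ^ 2 = poleWeight l m j) :
    (arrowVectors l m z).transpose * arrowVectors l m z = 1 := by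
  ext i k
  have hterm : ∀ j, √(zeroWeight l m i) * (z j / (l i - m j)) *
      (√(zeroWeight l m k) * (z j / (l k - m j))) =
      √(zeroWeight l m i) * √(zeroWeight l m k) *
        (poleWeight l m j / ((l i - m j) * (l k - m j))) := fun j => by
    rw [← hz j]
    have := h.ne i j
    have := h.ne k j
    field_simp
  rw [Matrix.mul_apply, Fin.sum_univ_succ]
  simp only [arrowVectors, Matrix.transpose_apply, Matrix.of_apply, Fin.cons_zero, Fin.cons_succ]
  rw [Finset.sum_congr rfl fun j _ => hterm j, ← Finset.mul_sum, ← mul_one_add]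
  rcases eq_or_ne i k with rfl | hik
  · rw [Real.mul_self_sqrt (h.zeroWeight_pos i).le, h.normalization, Matrix.one_apply_eq]
  · rw [h.orthogonality hik, mul_zero, Matrix.one_apply_ne hik]

theorem arrowVectors_eigen (h : Interlace l m) (hz : ∀ j, z j ^ 2 = poleWeight l m j) :
    block (∑ i, l i - ∑ j, m j) z z (Matrix.diagonal m) * arrowVectors l m z =
      arrowVectors l m z * Matrix.diagonal l := by
  ext i k
  rw [Matrix.mul_diagonal, Matrix.mul_apply, Fin.sum_univ_succ]
  induction i using Fin.cases with
  | zero =>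
    simp only [arrowVectors, Matrix.of_apply, Fin.cons_zero, Fin.cons_succ, block_zero_zero,
      block_zero_succ]
    have h1 := h.secular k
    have hterm : ∀ j, z j * (√(zeroWeight l m k) * (z j / (l k - m j))) =
        √(zeroWeight l m k) * (poleWeight l m j / (l k - m j)) := fun j => by
      rw [← hz j]; ring
    rw [Finset.sum_congr rfl fun j _ => hterm j, ← Finset.mul_sum]
    linear_combination (-√(zeroWeight l m k)) * h1
  | succ i =>
    simp only [arrowVectors, Matrix.of_apply, Fin.cons_zero, Fin.cons_succ, block_succ_zero,
      block_succ_succ, Matrix.diagonal_apply, ite_mul, zero_mul, Finset.sum_ite_eq, mem_univ,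
      if_true]
    have := h.ne k i
    field_simp
    ring

/-- The trace of the squared arrow matrix, computed by diagonalization and entry by entry. This
identity merges the exponents of the Gaussian and gamma densities into that of the new eigenvalues.
-/
theorem sum_sq_interlace (h : Interlace l m) :
    ∑ i, l i ^ 2 = (∑ i, l i - ∑ j, m j) ^ 2 + 2 * ∑ j, poleWeight l m j + ∑ j, m j ^ 2 := by
  set z : Fin n → ℝ := fun j => √(poleWeight l m j)
  have hz : ∀ j, z j ^ 2 = poleWeight l m j := fun j => Real.sq_sqrt (h.poleWeight_pos j).le
  set M := block (∑ i, l i - ∑ j, m j) z z (Matrix.diagonal m)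
  set V := arrowVectors l m z
  have h1 : V.transpose * V = 1 := arrowVectors_orthogonal h hz
  have h2 : M * V = V * Matrix.diagonal l := arrowVectors_eigen h hz
  have h3 : V * V.transpose = 1 := mul_eq_one_comm.mp h1
  have h4 : (M * M).trace = (Matrix.diagonal l * Matrix.diagonal l).trace := by
    calc (M * M).trace = (M * M * (V * V.transpose)).trace := by rw [h3, mul_one]
      _ = (M * (M * V) * V.transpose).trace := by simp only [mul_assoc]
      _ = (V * Matrix.diagonal l * Matrix.diagonal l * V.transpose).trace := by
          rw [h2, ← mul_assoc M V, h2]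
      _ = _ := by rw [Matrix.trace_mul_comm, mul_assoc V, ← mul_assoc, h1, one_mul]
  have h5 : (M * M).trace =
      (∑ i, l i - ∑ j, m j) ^ 2 + 2 * ∑ j, poleWeight l m j + ∑ j, m j ^ 2 := by
    simp only [M]
    rw [block_mul_block, Matrix.trace, Fin.sum_univ_succ]
    simp only [Matrix.diag_apply, block_zero_zero, block_succ_succ, Matrix.of_apply,
      Matrix.diagonal_apply, Finset.sum_add_distrib, ← hz]
    simp [pow_two]
    ring
  rw [← h5, h4]
  simp [Matrix.trace, Matrix.diagonal_mul_diagonal, pow_two]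

end Arrow

/-! ### Spectral data of tridiagonal matrices -/

/-- `T` is symmetric with eigenvalues `l` in decreasing order, and the squared first components
of its normalized eigenvectors are the positive numbers `w`. -/
structure SpectralData (T : Matrix (Fin (n + 1)) (Fin (n + 1)) ℝ) (l w : Fin (n + 1) → ℝ) :
    Prop where
  strictAnti : StrictAnti l
  pos : ∀ i, 0 < w i
  exists_vectors : ∃ V : Matrix (Fin (n + 1)) (Fin (n + 1)) ℝ, V.transpose * V = 1 ∧
    T * V = V * Matrix.diagonal l ∧ ∀ i, V 0 i ^ 2 = w i

/-- Conjugation by diag(1, V) yields an arrow matrix with border z_j = b V_0j, since the border of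
the tridiagonal matrix meets only the first row of V. As diag(1, V) fixes the first coordinate, the
first components of the eigenvectors are those of the arrow matrix. -/
theorem SpectralData.border {T : Matrix (Fin (n + 1)) (Fin (n + 1)) ℝ} {m w : Fin (n + 1) → ℝ}
    (hT : SpectralData T m w) {a b : ℝ} {l : Fin (n + 2) → ℝ} (h : Interlace l m)
    (ha : ∑ i, l i - ∑ j, m j = a) (hb : ∀ j, poleWeight l m j = b ^ 2 * w j) :
    SpectralData (block a (Pi.single 0 b) (Pi.single 0 b) T) l (zeroWeight l m) := by
  obtain ⟨V, hV, hTV, hVw⟩ := hT.exists_vectors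
  set z : Fin (n + 1) → ℝ := fun j => b * V 0 j with hzdef
  have hz : ∀ j, z j ^ 2 = poleWeight l m j := fun j => by rw [hb, ← hVw j, mul_pow]
  refine ⟨h.strictAnti_left, h.zeroWeight_pos,
    block 1 0 0 V * arrowVectors l m z, ?_, ?_, fun i => ?_⟩
  · rw [Matrix.transpose_mul, mul_assoc, ← mul_assoc _ (block 1 0 0 V), block_transpose,
      block_mul_block]
    have : (Matrix.of fun i j => (0 : Fin (n + 1) → ℝ) i * (0 : Fin (n + 1) → ℝ) j +
        ∑ k, V.transpose i k * V k j) = (1 : Matrix (Fin (n + 1)) (Fin (n + 1)) ℝ) := by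
      rw [← hV]; ext i j; simp [Matrix.mul_apply]
    rw [this]
    have h1 : block (1 * 1 + ∑ k, (0 : Fin (n + 1) → ℝ) k * (0 : Fin (n + 1) → ℝ) k)
        (fun j => 1 * (0 : Fin (n + 1) → ℝ) j + ∑ k, (0 : Fin (n + 1) → ℝ) k * V k j)
        (fun i => (0 : Fin (n + 1) → ℝ) i * 1 + ∑ k, V.transpose i k * (0 : Fin (n + 1) → ℝ) k)
        (1 : Matrix (Fin (n + 1)) (Fin (n + 1)) ℝ) = 1 := by
      refine Eq.trans ?_ block_one
      congr 1
      · simp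
      · funext; simp
      · funext; simp
    rw [h1, one_mul, arrowVectors_orthogonal h hz]
  · have h1 : block a (Pi.single 0 b) (Pi.single 0 b) T * block 1 0 0 V =
        block 1 0 0 V * block a z z (Matrix.diagonal m) := by
      rw [block_mul_block, block_mul_block]
      have hVm : ∀ i j, ∑ k, T i k * V k j = ∑ k, V i k * Matrix.diagonal m k j := fun i j => by
        simpa only [Matrix.mul_apply] using congrFun (congrFun hTV i) j
      have hVV : V * V.transpose = 1 := mul_eq_one_comm.mp hV
      congr 1
      · simp
      · funext j; simp [hzdef, Pi.single_apply]
      · funext i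
        -- The rows of V are orthonormal as well, so V z = b V Vᵀ e₀ = b e₀.
        have : ∑ k, V i k * z k = b * (V * V.transpose) i 0 := by
          rw [Matrix.mul_apply, Finset.mul_sum]
          exact Finset.sum_congr rfl fun k _ => by simp only [hzdef, Matrix.transpose_apply]; ring
        rw [this, hVV]
        simp [Pi.single_apply, Matrix.one_apply]
      · ext i j; simp [hVm]
    rw [← mul_assoc, h1, mul_assoc, ← ha, arrowVectors_eigen h hz, mul_assoc]
  · have : (block 1 0 0 V * arrowVectors l m z) 0 i = √(zeroWeight l m i) := by
      simp [Matrix.mul_apply, Fin.sum_univ_succ, arrowVectors]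
    rw [this, Real.sq_sqrt (h.zeroWeight_pos i).le]

/-- The corner of T = V diag(l) Vᵀ. It writes the only entry moved by the perturbation in terms of
the spectral data. -/
theorem SpectralData.corner {T : Matrix (Fin (n + 1)) (Fin (n + 1)) ℝ} {l w : Fin (n + 1) → ℝ}
    (hT : SpectralData T l w) : T 0 0 = ∑ i, w i * l i := by
  obtain ⟨V, hV, hTV, hVw⟩ := hT.exists_vectors
  have hVV : V * V.transpose = 1 := mul_eq_one_comm.mp hV
  have : T = V * Matrix.diagonal l * V.transpose := by rw [← hTV, mul_assoc, hVV, mul_one]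
  rw [this, Matrix.mul_apply]
  refine Finset.sum_congr rfl fun i _ => ?_
  rw [Matrix.mul_diagonal, Matrix.transpose_apply, ← hVw]
  ring

theorem SpectralData.sum_weight {T : Matrix (Fin (n + 1)) (Fin (n + 1)) ℝ} {l w : Fin (n + 1) → ℝ}
    (hT : SpectralData T l w) : ∑ i, w i = 1 := by
  obtain ⟨V, hV, hTV, hVw⟩ := hT.exists_vectors
  have hVV : V * V.transpose = 1 := mul_eq_one_comm.mp hV
  have := congrFun (congrFun hVV 0) 0
  rw [Matrix.mul_apply, Matrix.one_apply_eq] at this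
  rw [← this]
  exact Finset.sum_congr rfl fun i _ => by rw [← hVw, Matrix.transpose_apply, pow_two]

/-- The symmetric tridiagonal matrix with diagonal `x.1` and off-diagonal entries `x.2`. -/
def jacobiMatrix (x : (Fin (n + 1) → ℝ) × (Fin n → ℝ)) : Matrix (Fin (n + 1)) (Fin (n + 1)) ℝ :=
  Matrix.of fun i j =>
    if i = j then x.1 i
    else if h : i.1 + 1 = j.1 then x.2 ⟨i.1, by have := j.2; omega⟩
    else if h : j.1 + 1 = i.1 then x.2 ⟨j.1, by have := i.2; omega⟩
    else 0

theorem jacobiMatrix_cons (a b : ℝ) (d : Fin (n + 1) → ℝ) (o : Fin n → ℝ) :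
    jacobiMatrix ((Fin.cons a d : Fin (n + 2) → ℝ), (Fin.cons b o : Fin (n + 1) → ℝ)) =
      block a (Pi.single 0 b) (Pi.single 0 b) (jacobiMatrix (d, o)) := by
  ext i j
  induction i using Fin.cases with
  | zero =>
    induction j using Fin.cases with
    | zero => simp [jacobiMatrix]
    | succ j =>
      rcases Fin.eq_zero_or_eq_succ j with rfl | ⟨j, rfl⟩
      · rw [block_zero_succ]; simp [jacobiMatrix]
      · simp [jacobiMatrix, Fin.ext_iff]
  | succ i =>
    induction j using Fin.cases with
    | zero =>
      rcases Fin.eq_zero_or_eq_succ i with rfl | ⟨i, rfl⟩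
      · rw [block_succ_zero]; simp [jacobiMatrix]
      · simp [jacobiMatrix, Fin.ext_iff]
    | succ j =>
      simp only [jacobiMatrix, Matrix.of_apply, block_succ_succ, Fin.succ_inj, Fin.cons_succ,
        Fin.val_succ, add_left_inj]
      split_ifs
      · rfl
      · exact Fin.cons_succ (α := fun _ => ℝ) b o ⟨i.1, by omega⟩
      · exact Fin.cons_succ (α := fun _ => ℝ) b o ⟨j.1, by omega⟩
      · rfl

theorem jacobiMatrix_zero_zero (x : (Fin (n + 1) → ℝ) × (Fin n → ℝ)) :
    jacobiMatrix x 0 0 = x.1 0 := by simp [jacobiMatrix]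

/-! ### Jacobians -/

/-- The map from the zeros of `x - a - ∑ g j / (x - m j)` to its coefficients `(a, g)`. -/
def poleMap (m : Fin n → ℝ) (l : Fin (n + 1) → ℝ) : Fin (n + 1) → ℝ :=
  Fin.cons (∑ i, l i - ∑ j, m j) (poleWeight l m)

/-- The map from the scale `y 0` and the zeros `y 1, …, y n` of `∑ g i / (x - l i)` to `g`. -/
def zeroMap (l : Fin (n + 1) → ℝ) (y : Fin (n + 1) → ℝ) : Fin (n + 1) → ℝ :=
  fun i => y 0 * zeroWeight l (Fin.tail y) i

/-- The Jacobian matrix of `poleMap m`. -/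
def poleMapDeriv (m : Fin n → ℝ) (l : Fin (n + 1) → ℝ) : Matrix (Fin (n + 1)) (Fin (n + 1)) ℝ :=
  Matrix.diagonal (Fin.cons 1 (poleWeight l m) : Fin (n + 1) → ℝ) * cauchyBordered l m

/-- The Jacobian matrix of `zeroMap l`. -/
def zeroMapDeriv (l : Fin (n + 1) → ℝ) (y : Fin (n + 1) → ℝ) :
    Matrix (Fin (n + 1)) (Fin (n + 1)) ℝ :=
  Matrix.diagonal (zeroWeight l (Fin.tail y)) * (cauchyBordered l (Fin.tail y)).transpose *
    Matrix.diagonal (Fin.cons 1 fun _ => -y 0 : Fin (n + 1) → ℝ)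

/-- The derivative of the weight at `m j` with respect to `l i` is that weight divided by `l i - m
j`, and the corner has derivative 1 in every direction. This produces the bordered Cauchy matrix. -/
theorem hasFDerivAt_poleMap {m : Fin n → ℝ} {l : Fin (n + 1) → ℝ} (h : Interlace l m) :
    HasFDerivAt (poleMap m) (LinearMap.toContinuousLinearMap (Matrix.toLin' (poleMapDeriv m l))) l := by
  rw [hasFDerivAt_pi']
  intro i
  induction i using Fin.cases with
  | zero =>
    have h1 : HasFDerivAt (fun x : Fin (n + 1) → ℝ => ∑ i, x i - ∑ j, m j)
        (∑ i, ContinuousLinearMap.proj (R := ℝ) (φ := fun _ : Fin (n + 1) => ℝ) i) l :=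
      (HasFDerivAt.fun_sum fun i _ => hasFDerivAt_apply i l).sub_const _
    refine h1.congr_fderiv ?_
    ext v
    simp [poleMapDeriv, Matrix.diagonal_mul, Matrix.mulVec, dotProduct, cauchyBordered]
  | succ j =>
    have h1 : HasFDerivAt (fun x : Fin (n + 1) → ℝ => ∏ i, (m j - x i))
        (∑ i, (∏ k ∈ univ.erase i, (m j - l k)) •
          (-ContinuousLinearMap.proj (R := ℝ) (φ := fun _ : Fin (n + 1) => ℝ) i)) l :=
      HasFDerivAt.finsetProd fun i _ => (hasFDerivAt_apply i l).const_sub _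
    have h2 := (h1.neg).mul_const ((nodeProd m j)⁻¹)
    refine HasFDerivAt.congr_fderiv
      (h2.congr_of_eventuallyEq (Filter.Eventually.of_forall fun x => ?_)) ?_
    · simp [poleMap, poleWeight, div_eq_mul_inv]
    · ext v
      simp only [poleMapDeriv, cauchyBordered, ContinuousLinearMap.comp_apply,
        LinearMap.coe_toContinuousLinearMap', Matrix.toLin'_apply, ContinuousLinearMap.proj_apply,
        Matrix.mulVec, dotProduct, Matrix.diagonal_mul, Fin.cons_succ, Matrix.of_apply]
      simp only [smul_neg, sum_neg_distrib, neg_neg, _root_.smul_apply,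
        _root_.sum_apply, ContinuousLinearMap.proj_apply, smul_eq_mul, Finset.mul_sum]
      refine Finset.sum_congr rfl fun i _ => ?_
      have hne := h.ne i j
      have hne' : m j - l i ≠ 0 := fun h0 => hne (by linarith)
      have hN := nodeProd_ne_zero h.strictAnti_right j
      rw [poleWeight, ← Finset.mul_prod_erase univ _ (mem_univ i)]
      field_simp
      ring

/-- With the other family of points varying, the same denominators occur with the opposite sign. The
transposed Cauchy matrix appears up to diagonal factors, so both Jacobians share one determinant. -/
theorem hasFDerivAt_zeroMap {l : Fin (n + 1) → ℝ} {y : Fin (n + 1) → ℝ}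
    (h : Interlace l (Fin.tail y)) :
    HasFDerivAt (zeroMap l) (LinearMap.toContinuousLinearMap (Matrix.toLin' (zeroMapDeriv l y))) y := by
  rw [hasFDerivAt_pi']
  intro i
  have h1 : HasFDerivAt (fun x : Fin (n + 1) → ℝ => ∏ j : Fin n, (l i - x j.succ))
      (∑ j : Fin n, (∏ k ∈ univ.erase j, (l i - y k.succ)) •
        (-ContinuousLinearMap.proj (R := ℝ) (φ := fun _ : Fin (n + 1) => ℝ) j.succ)) y :=
    HasFDerivAt.finsetProd fun j _ => (hasFDerivAt_apply j.succ y).const_sub _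
  have h2 := (hasFDerivAt_apply (0 : Fin (n + 1)) y).mul (h1.mul_const ((nodeProd l i)⁻¹))
  refine HasFDerivAt.congr_fderiv
    (h2.congr_of_eventuallyEq (Filter.Eventually.of_forall fun x => ?_)) ?_
  · simp [zeroMap, zeroWeight, div_eq_mul_inv, Fin.tail]
  · ext v
    have hN := nodeProd_ne_zero h.strictAnti_left i
    simp only [zeroMapDeriv, cauchyBordered, ContinuousLinearMap.comp_apply,
      LinearMap.coe_toContinuousLinearMap', Matrix.toLin'_apply, ContinuousLinearMap.proj_apply,
      Matrix.mulVec, dotProduct, Matrix.diagonal_mul, Matrix.mul_diagonal, Matrix.of_apply,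
      Matrix.transpose_apply, Fin.sum_univ_succ, Fin.cons_zero, Fin.cons_succ]
    simp only [smul_neg, sum_neg_distrib, _root_.smul_apply, Finset.smul_sum,
        _root_.sum_apply, ContinuousLinearMap.proj_apply, smul_eq_mul,
        _root_.add_apply, _root_.neg_apply]
    rw [add_comm]
    congr 1
    · simp only [zeroWeight, Fin.tail]; ring
    · rw [← Finset.sum_neg_distrib]
      refine Finset.sum_congr rfl fun j _ => ?_
      have hne : l i - y j.succ ≠ 0 := h.ne i j
      rw [zeroWeight, ← Finset.mul_prod_erase univ _ (mem_univ j)]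
      simp only [Fin.tail]
      field_simp

theorem abs_det_poleMapDeriv {m : Fin n → ℝ} {l : Fin (n + 1) → ℝ} (h : Interlace l m) :
    |(poleMapDeriv m l).det| = (∏ j, poleWeight l m j) * |(cauchyBordered l m).det| := by
  rw [poleMapDeriv, Matrix.det_mul, Matrix.det_diagonal, abs_mul, Fin.prod_univ_succ]
  simp only [Fin.cons_zero, Fin.cons_succ, one_mul]
  rw [abs_of_pos (Finset.prod_pos fun j _ => h.poleWeight_pos j)]

theorem abs_det_zeroMapDeriv {l y : Fin (n + 1) → ℝ} (h : Interlace l (Fin.tail y)) :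
    |(zeroMapDeriv l y).det| = |y 0| ^ n * ((∏ i, zeroWeight l (Fin.tail y) i) *
      |(cauchyBordered l (Fin.tail y)).det|) := by
  rw [zeroMapDeriv, Matrix.det_mul, Matrix.det_mul, Matrix.det_diagonal, Matrix.det_diagonal,
    Matrix.det_transpose, abs_mul, abs_mul,
    Fin.prod_univ_succ (fun i => (Fin.cons 1 (fun _ => -y 0) : Fin (n + 1) → ℝ) i)]
  simp only [Fin.cons_zero, Fin.cons_succ, one_mul, Finset.prod_const, card_univ, Fintype.card_fin,
    abs_pow, abs_neg]
  rw [abs_of_pos (Finset.prod_pos fun j _ => h.zeroWeight_pos j)]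
  ring

end RankOne
end

noncomputable section

namespace RankOne

open Finset
open scoped ENNReal

variable {n : ℕ}

/-! ### Product measures with densities -/

theorem lintegral_pi_fin_prod {n : ℕ} {E : Fin n → Type*} [∀ i, MeasurableSpace (E i)]
    (μ : ∀ i, Measure (E i)) [∀ i, SigmaFinite (μ i)] {f : ∀ i, E i → ℝ≥0∞}
    (hf : ∀ i, Measurable (f i)) :
    ∫⁻ x, ∏ i, f i (x i) ∂Measure.pi μ = ∏ i, ∫⁻ x, f i x ∂μ i := by
  induction n with
  | zero => simp
  | succ n ih =>
    have hm := (measurePreserving_piFinSuccAbove μ 0).symm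
    have h1 : Measurable fun x : ∀ i, E i => ∏ i, f i (x i) :=
      Finset.measurable_prod _ fun i _ => (hf i).comp (measurable_pi_apply i)
    rw [← hm.lintegral_comp h1, lintegral_prod
      (fun a => ∏ i, f i ((MeasurableEquiv.piFinSuccAbove E 0).symm a i))
      (h1.comp hm.measurable).aemeasurable]
    simp only [Fin.prod_univ_succ, Fin.zero_succAbove]
    have h2 : Measurable fun y : ∀ i : Fin n, E i.succ => ∏ i : Fin n, f i.succ (y i) :=
      Finset.measurable_prod _ fun i _ => (hf i.succ).comp (measurable_pi_apply i)
    have ih' := ih (fun i => μ i.succ) (f := fun i => f i.succ) fun i => hf i.succ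
    calc _ = ∫⁻ x, f 0 x * ∫⁻ y, ∏ i : Fin n, f i.succ (y i) ∂Measure.pi (fun i => μ i.succ) ∂μ 0 :=
          lintegral_congr fun x => lintegral_const_mul _ h2
      _ = _ := by rw [ih', lintegral_mul_const _ (hf 0)]

theorem lintegral_pi_prod {ι : Type*} [Fintype ι] {E : ι → Type*} [∀ i, MeasurableSpace (E i)]
    (μ : ∀ i, Measure (E i)) [∀ i, SigmaFinite (μ i)] {f : ∀ i, E i → ℝ≥0∞}
    (hf : ∀ i, Measurable (f i)) :
    ∫⁻ x, ∏ i, f i (x i) ∂Measure.pi μ = ∏ i, ∫⁻ x, f i x ∂μ i := by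
  classical
  let e := (Fintype.equivFin ι).symm
  have hm := measurePreserving_piCongrLeft μ e
  have h1 : Measurable fun x : ∀ i, E i => ∏ i, f i (x i) :=
    Finset.measurable_prod _ fun i _ => (hf i).comp (measurable_pi_apply i)
  rw [← hm.lintegral_comp h1, ← e.prod_comp, ← lintegral_pi_fin_prod _ fun i => hf (e i)]
  refine lintegral_congr fun x => ?_
  rw [← e.prod_comp]
  refine Finset.prod_congr rfl fun i _ => ?_
  rw [MeasurableEquiv.coe_piCongrLeft, Equiv.piCongrLeft_apply_apply]

theorem pi_withDensity {ι : Type*} [Fintype ι] {E : ι → Type*} [∀ i, MeasurableSpace (E i)]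
    (μ : ∀ i, Measure (E i)) [∀ i, SigmaFinite (μ i)] {f : ∀ i, E i → ℝ≥0∞}
    (hf : ∀ i, Measurable (f i)) [∀ i, SigmaFinite ((μ i).withDensity (f i))] :
    Measure.pi (fun i => (μ i).withDensity (f i)) =
      (Measure.pi μ).withDensity fun x => ∏ i, f i (x i) := by
  refine (Measure.pi_eq fun s hs => ?_)
  rw [withDensity_apply _ (MeasurableSet.univ_pi hs), Measure.restrict_pi_pi,
    lintegral_pi_prod _ hf]
  exact Finset.prod_congr rfl fun i _ => (withDensity_apply _ (hs i)).symm

/-! ### The measures on eigenvalues and weights -/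

/-- The square of the Vandermonde determinant. -/
def vandermondeSq (l : Fin n → ℝ) : ℝ := ∏ i, |nodeProd l i|

/-- The unnormalized density of the Gaussian beta ensemble with `β = 2 k`. -/
def eigenDensity (k : ℝ) (l : Fin n → ℝ) : ℝ :=
  vandermondeSq l ^ k * Real.exp (-(∑ i, l i ^ 2) / 2)

/-- The Gaussian beta ensemble with `β = 2 k` on decreasing sequences, not normalized. -/
def eigenMeasure (k : ℝ) (n : ℕ) : Measure (Fin n → ℝ) :=
  (volume.restrict {l | StrictAnti l}).withDensity fun l => ENNReal.ofReal (eigenDensity k l)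

/-- Independent gamma variables of shape `k`. -/
def gammaPi (k : ℝ) (n : ℕ) : Measure (Fin n → ℝ) := Measure.pi fun _ => gammaMeasure k 1

/-- The density of the gamma distribution on the positive half line. -/
def gammaDensity (k x : ℝ) : ℝ := (Real.Gamma k)⁻¹ * x ^ (k - 1) * Real.exp (-x)

@[fun_prop]
theorem measurable_gammaDensity (k : ℝ) : Measurable (gammaDensity k) := by
  unfold gammaDensity; fun_prop

theorem gammaMeasure_eq (k : ℝ) : gammaMeasure k 1 =
    (volume.restrict (Set.Ioi 0)).withDensity fun x => ENNReal.ofReal (gammaDensity k x) := by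
  -- The endpoint is null, and the open half line is the range of the substitutions.
  have h0 : (volume.restrict (Set.Ioi (0 : ℝ))) = volume.restrict (Set.Ici 0) :=
    Measure.restrict_congr_set Ioi_ae_eq_Ici
  rw [h0, ← withDensity_indicator measurableSet_Ici, gammaMeasure]
  congr 1
  funext x
  by_cases hx : 0 ≤ x
  · rw [Set.indicator_of_mem (Set.mem_Ici.mpr hx), gammaPDF_of_nonneg hx]
    simp [gammaDensity, div_eq_mul_inv]
  · rw [Set.indicator_of_notMem (by simpa using hx), gammaPDF_of_neg (not_le.mp hx)]

theorem measurable_nodeProd (i : Fin n) : Measurable fun l : Fin n → ℝ => nodeProd l i := by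
  unfold nodeProd; fun_prop

theorem measurable_vandermondeSq : Measurable (vandermondeSq : (Fin n → ℝ) → ℝ) := by
  unfold vandermondeSq
  exact Finset.measurable_prod _ fun i _ => (measurable_nodeProd i).abs

theorem measurable_eigenDensity (k : ℝ) : Measurable (eigenDensity k : (Fin n → ℝ) → ℝ) := by
  unfold eigenDensity
  exact (measurable_vandermondeSq.pow_const _).mul (by fun_prop)

theorem measurableSet_strictAnti : MeasurableSet {l : Fin n → ℝ | StrictAnti l} := by
  have : {l : Fin n → ℝ | StrictAnti l} = ⋂ i, ⋂ j, {l | i < j → l j < l i} := by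
    ext l; simp only [StrictAnti, Set.mem_iInter, Set.mem_ofPred_eq]
  rw [this]
  refine MeasurableSet.iInter fun i => MeasurableSet.iInter fun j => ?_
  by_cases h : i < j
  · simp only [h, true_imp_iff]
    exact measurableSet_lt (measurable_pi_apply j) (measurable_pi_apply i)
  · simp [h]

theorem measurableSet_interlace :
    MeasurableSet {p : (Fin (n + 1) → ℝ) × (Fin n → ℝ) | Interlace p.1 p.2} := by
  have : {p : (Fin (n + 1) → ℝ) × (Fin n → ℝ) | Interlace p.1 p.2} =
      ⋂ j : Fin n, {p | p.1 j.succ < p.2 j} ∩ {p | p.2 j < p.1 j.castSucc} := by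
    ext p; simp [Interlace]
  rw [this]
  exact MeasurableSet.iInter fun j =>
    (measurableSet_lt (by fun_prop) (by fun_prop)).inter (measurableSet_lt (by fun_prop) (by fun_prop))

theorem measurable_poleWeight (j : Fin n) :
    Measurable fun p : (Fin (n + 1) → ℝ) × (Fin n → ℝ) => poleWeight p.1 p.2 j := by
  unfold poleWeight
  exact Measurable.div (by fun_prop) ((measurable_nodeProd j).comp measurable_snd)

theorem measurable_zeroWeight :
    Measurable fun p : (Fin (n + 1) → ℝ) × (Fin n → ℝ) => zeroWeight p.1 p.2 := by
  refine measurable_pi_lambda _ fun i => ?_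
  unfold zeroWeight
  exact Measurable.div (by fun_prop) ((measurable_nodeProd i).comp measurable_fst)

theorem measurable_poleMap :
    Measurable fun p : (Fin (n + 1) → ℝ) × (Fin n → ℝ) => poleMap p.2 p.1 := by
  refine measurable_pi_lambda _ fun i => ?_
  induction i using Fin.cases with
  | zero => simp only [poleMap, Fin.cons_zero]; fun_prop
  | succ j => simpa only [poleMap, Fin.cons_succ] using measurable_poleWeight j

theorem poleMap_injOn (m : Fin n → ℝ) : Set.InjOn (poleMap m) {l | Interlace l m} := by
  intro l h l' h' heq
  have h0 := congrFun heq 0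
  simp only [poleMap, Fin.cons_zero] at h0
  refine poleWeight_injOn h h' (by linarith) (funext fun j => ?_)
  simpa [poleMap] using congrFun heq j.succ

/-- The scale is recovered as the sum of the image because the weights sum to 1; after division the
weights determine the zeros. -/
theorem zeroMap_injOn (l : Fin (n + 1) → ℝ) :
    Set.InjOn (zeroMap l) {y | 0 < y 0 ∧ Interlace l (Fin.tail y)} := by
  intro y h y' h' heq
  have hsum : ∀ z : Fin (n + 1) → ℝ, ∑ i, zeroMap l z i = z 0 := fun z => by
    simp only [zeroMap]
    rw [← Finset.mul_sum, sum_zeroWeight _ h.2.strictAnti_left, mul_one]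
  have h0 : y 0 = y' 0 := by rw [← hsum y, heq, hsum y']
  have ht : Fin.tail y = Fin.tail y' := by
    refine zeroWeight_injOn h.2 h'.2 (funext fun i => ?_)
    have := congrFun heq i
    simp only [zeroMap, h0] at this
    exact mul_left_cancel₀ h'.1.ne' this
  rw [← Fin.cons_self_tail y, h0, ht, Fin.cons_self_tail]

theorem image_poleMap {m : Fin n → ℝ} (hm : StrictAnti m) :
    poleMap m '' {l | Interlace l m} = {y | ∀ j : Fin n, 0 < y j.succ} := by
  ext y
  constructor
  · rintro ⟨l, hl, rfl⟩ j
    exact hl.poleWeight_pos j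
  · intro hy
    obtain ⟨l, hl, h0, hg⟩ := exists_interlace_poleWeight hm (y 0) hy
    refine ⟨l, hl, ?_⟩
    rw [poleMap, h0, hg]
    exact Fin.cons_self_tail y

theorem image_zeroMap {l : Fin (n + 1) → ℝ} (hl : StrictAnti l) :
    zeroMap l '' {y | 0 < y 0 ∧ Interlace l (Fin.tail y)} = {g | ∀ i, 0 < g i} := by
  ext g
  constructor
  · rintro ⟨y, hy, rfl⟩ i
    exact mul_pos hy.1 (hy.2.zeroWeight_pos i)
  · intro hg
    obtain ⟨m, hm, h⟩ := exists_interlace_zeroWeight hl hg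
    refine ⟨Fin.cons (∑ k, g k) m, ⟨?_, ?_⟩, funext fun i => ?_⟩
    · simpa using Finset.sum_pos (fun i _ => hg i) ⟨0, mem_univ _⟩
    · simpa using hm
    · simpa [zeroMap] using h i

/-- Measurable reconstruction of the zeros of `x - a - ∑ g j / (x - m j)`. -/
theorem exists_measurable_inverse (n : ℕ) :
    ∃ F : (Fin (n + 1) → ℝ) × (Fin n → ℝ) → Fin (n + 1) → ℝ, Measurable F ∧
      ∀ l m, Interlace l m → F (poleMap m l, m) = l := by
  let S := {p : (Fin (n + 1) → ℝ) × (Fin n → ℝ) | Interlace p.1 p.2}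
  have : StandardBorelSpace S := measurableSet_interlace.standardBorel
  let f : S → (Fin (n + 1) → ℝ) × (Fin n → ℝ) := fun p => (poleMap p.1.2 p.1.1, p.1.2)
  have hf : Measurable f :=
    (measurable_poleMap.comp measurable_subtype_coe).prodMk
      (measurable_snd.comp measurable_subtype_coe)
  have hinj : Function.Injective f := by
    rintro ⟨⟨l, m⟩, h⟩ ⟨⟨l', m'⟩, h'⟩ heq
    simp only [f, Prod.mk.injEq] at heq
    obtain ⟨h1, rfl⟩ := heq
    have := poleMap_injOn m h h' h1
    subst this
    rfl
  -- By Lusin and Souslin an injective measurable map on a standard Borel space is a measurable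
  -- embedding, so the inverse on its image extends measurably.
  obtain ⟨F, hF, hFf⟩ := (hf.measurableEmbedding hinj).exists_measurable_extend
    (g := fun p : S => p.1.1) (measurable_fst.comp measurable_subtype_coe) fun _ => inferInstance
  exact ⟨F, hF, fun l m h => congrFun hFf ⟨(l, m), h⟩⟩

theorem setLIntegral_poleMap {m : Fin n → ℝ} (hm : StrictAnti m)
    (h : (Fin (n + 1) → ℝ) → ℝ≥0∞) :
    ∫⁻ y in {y | ∀ j : Fin n, 0 < y j.succ}, h y =
      ∫⁻ l in {l | Interlace l m}, ENNReal.ofReal ((∏ j, poleWeight l m j) *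
        |(cauchyBordered l m).det|) * h (poleMap m l) := by
  have hms : MeasurableSet {l | Interlace l m} := by
    exact measurableSet_interlace.preimage (measurable_id.prodMk measurable_const)
  rw [← image_poleMap hm, lintegral_image_eq_lintegral_abs_det_fderiv_mul volume hms
    (fun l hl => (hasFDerivAt_poleMap hl).hasFDerivWithinAt) (poleMap_injOn m)]
  refine setLIntegral_congr_fun hms fun l hl => ?_
  have hl : Interlace l m := hl
  simp only [LinearMap.det_toContinuousLinearMap, LinearMap.det_toLin']
  rw [abs_det_poleMapDeriv hl]

theorem setLIntegral_zeroMap {l : Fin (n + 1) → ℝ} (hl : StrictAnti l)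
    (h : (Fin (n + 1) → ℝ) → ℝ≥0∞) :
    ∫⁻ g in {g | ∀ i, 0 < g i}, h g =
      ∫⁻ y in {y | 0 < y 0 ∧ Interlace l (Fin.tail y)}, ENNReal.ofReal (|y 0| ^ n *
        ((∏ i, zeroWeight l (Fin.tail y) i) * |(cauchyBordered l (Fin.tail y)).det|)) *
          h (zeroMap l y) := by
  have hms : MeasurableSet {y : Fin (n + 1) → ℝ | 0 < y 0 ∧ Interlace l (Fin.tail y)} := by
    refine (measurableSet_lt measurable_const (measurable_pi_apply 0)).inter
      (measurableSet_interlace.preimage (measurable_const.prodMk ?_))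
    exact measurable_pi_lambda _ fun i => measurable_pi_apply _
  rw [← image_zeroMap hl, lintegral_image_eq_lintegral_abs_det_fderiv_mul volume hms
    (fun y hy => (hasFDerivAt_zeroMap hy.2).hasFDerivWithinAt) (zeroMap_injOn l)]
  refine setLIntegral_congr_fun hms fun y hy => ?_
  simp only [LinearMap.det_toContinuousLinearMap, LinearMap.det_toLin']
  rw [abs_det_zeroMapDeriv hy.2]

end RankOne
end

/-! ### Border densities and the two factorizations of the joint density. -/

noncomputable section

namespace RankOne

open Finset
open scoped ENNReal

variable {n : ℕ}

theorem measurePreserving_cons (μ : Fin (n + 1) → Measure ℝ) [∀ i, SigmaFinite (μ i)] :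
    MeasurePreserving (fun p : ℝ × (Fin n → ℝ) => (Fin.cons p.1 p.2 : Fin (n + 1) → ℝ))
      ((μ 0).prod (Measure.pi fun j => μ j.succ)) (Measure.pi μ) := by
  have := (measurePreserving_piFinSuccAbove μ 0).symm
  convert this using 1
  · funext p
    simp [MeasurableEquiv.piFinSuccAbove]
    rfl
  · simp only [Fin.zero_succAbove]

theorem volume_preserving_cons :
    MeasurePreserving (fun p : ℝ × (Fin n → ℝ) => (Fin.cons p.1 p.2 : Fin (n + 1) → ℝ))
      (volume.prod volume) volume :=
  measurePreserving_cons fun _ => volume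

theorem measurable_cons :
    Measurable fun p : ℝ × (Fin n → ℝ) => (Fin.cons p.1 p.2 : Fin (n + 1) → ℝ) :=
  volume_preserving_cons.measurable

theorem lintegral_cons (h : (Fin (n + 1) → ℝ) → ℝ≥0∞) (hh : Measurable h) :
    ∫⁻ y, h y = ∫⁻ s, ∫⁻ m, h (Fin.cons s m) := by
  rw [← volume_preserving_cons.lintegral_comp hh,
    lintegral_prod (fun p => h (Fin.cons p.1 p.2)) (hh.comp measurable_cons).aemeasurable]

theorem measurableSet_pos : MeasurableSet {g : Fin n → ℝ | ∀ i, 0 < g i} := by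
  have : {g : Fin n → ℝ | ∀ i, 0 < g i} = ⋂ i, {g | 0 < g i} := by ext; simp
  rw [this]
  exact MeasurableSet.iInter fun i => measurableSet_lt measurable_const (measurable_pi_apply i)

theorem gammaDensity_nonneg {k x : ℝ} (hk : 0 < k) (hx : 0 < x) : 0 ≤ gammaDensity k x := by
  have := Real.Gamma_pos_of_pos hk
  unfold gammaDensity; positivity

theorem gammaPi_eq {k : ℝ} (hk : 0 < k) (n : ℕ) : gammaPi k n =
    (volume.restrict {g : Fin n → ℝ | ∀ i, 0 < g i}).withDensity
      fun g => ENNReal.ofReal (∏ i, gammaDensity k (g i)) := by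
  have h1 : gammaPi k n = Measure.pi fun _ : Fin n =>
      ((volume.restrict (Set.Ioi 0)).withDensity fun x => ENNReal.ofReal (gammaDensity k x)) := by
    rw [gammaPi]; congr 1; funext i; exact gammaMeasure_eq k
  have h2 : {g : Fin n → ℝ | ∀ i, 0 < g i} = Set.univ.pi fun _ => Set.Ioi 0 := by
    ext; simp
  rw [h1, pi_withDensity _ fun _ => (measurable_gammaDensity k).ennreal_ofReal,
    ← Measure.restrict_pi_pi, ← volume_pi, ← h2]
  refine withDensity_congr_ae ?_
  filter_upwards [ae_restrict_mem measurableSet_pos] with g hg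
  rw [ENNReal.ofReal_prod_of_nonneg fun i _ => gammaDensity_nonneg hk (hg i)]

/-- The joint density of a standard Gaussian and independent gamma variables. -/
def borderDensity (k : ℝ) (y : Fin (n + 1) → ℝ) : ℝ :=
  gaussianPDFReal 0 1 (y 0) * ∏ j : Fin n, gammaDensity k (y j.succ)

theorem measurable_borderDensity (k : ℝ) :
    Measurable (borderDensity k : (Fin (n + 1) → ℝ) → ℝ) := by
  unfold borderDensity
  exact ((measurable_gaussianPDFReal 0 1).comp (measurable_pi_apply 0)).mul
    (Finset.measurable_prod _ fun j _ => (measurable_gammaDensity k).comp (measurable_pi_apply _))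

theorem lintegral_border {k : ℝ} (hk : 0 < k) {h : (Fin (n + 1) → ℝ) → ℝ≥0∞} (hh : Measurable h) :
    ∫⁻ p, h (Fin.cons p.1 p.2) ∂((gaussianReal 0 1).prod (gammaPi k n)) =
      ∫⁻ y in {y : Fin (n + 1) → ℝ | ∀ j : Fin n, 0 < y j.succ},
        ENNReal.ofReal (borderDensity k y) * h y := by
  have hR : MeasurableSet {y : Fin (n + 1) → ℝ | ∀ j : Fin n, 0 < y j.succ} :=
    measurableSet_pos.preimage (measurable_pi_lambda _ fun j => measurable_pi_apply (Fin.succ j))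
  have hd : Measurable fun g : Fin n → ℝ => ENNReal.ofReal (∏ i, gammaDensity k (g i)) :=
    (Finset.measurable_prod _ fun j _ =>
      (measurable_gammaDensity k).comp (measurable_pi_apply _)).ennreal_ofReal
  rw [gaussianReal_of_var_ne_zero _ one_ne_zero, gammaPi_eq hk,
    prod_withDensity (measurable_gaussianPDF 0 1) hd,
    lintegral_withDensity_eq_lintegral_mul _
      (f := fun z : ℝ × (Fin n → ℝ) => gaussianPDF 0 1 z.1 *
        ENNReal.ofReal (∏ i, gammaDensity k (z.2 i)))
      (((measurable_gaussianPDF 0 1).comp measurable_fst).mul (hd.comp measurable_snd))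
      (g := fun p => h (Fin.cons p.1 p.2)) (hh.comp measurable_cons), ← lintegral_indicator hR,
    ← volume_preserving_cons.lintegral_comp
      (f := {y : Fin (n + 1) → ℝ | ∀ j : Fin n, 0 < y j.succ}.indicator
        fun y => ENNReal.ofReal (borderDensity k y) * h y)
      (((measurable_borderDensity k).ennreal_ofReal.mul hh).indicator hR)]
  have h3 : (volume : Measure ℝ).prod
      ((volume : Measure (Fin n → ℝ)).restrict {g : Fin n → ℝ | ∀ i, 0 < g i}) =
      ((volume : Measure ℝ).prod volume).restrict (Set.univ ×ˢ {g : Fin n → ℝ | ∀ i, 0 < g i}) := by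
    rw [← Measure.prod_restrict, Measure.restrict_univ]
  rw [h3, ← lintegral_indicator (MeasurableSet.univ.prod measurableSet_pos)]
  refine lintegral_congr fun p => ?_
  simp only [Set.indicator_apply, Set.mem_prod, Set.mem_univ, true_and, Set.mem_ofPred_eq,
    Fin.cons_succ, Pi.mul_apply, borderDensity, Fin.cons_zero]
  split_ifs with hp
  · rw [ENNReal.ofReal_mul (gaussianPDFReal_nonneg _ _ _)]
    rfl
  · rfl

/-! ### The induction step for the spectral measures -/

section Step

variable {l : Fin (n + 1) → ℝ} {m : Fin n → ℝ}

/-- Both sides equal ∏ |l_i - m_j|, the absolute resultant of the two node polynomials: multiplying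
a weight by its node product cancels the denominator. -/
theorem vandermondeSq_mul_poleWeight (h : Interlace l m) :
    vandermondeSq m * ∏ j, poleWeight l m j = vandermondeSq l * ∏ i, zeroWeight l m i := by
  have h1 : vandermondeSq m * ∏ j, poleWeight l m j = ∏ j, ∏ i, |l i - m j| := by
    rw [vandermondeSq, ← Finset.prod_mul_distrib]
    refine Finset.prod_congr rfl fun j _ => ?_
    rw [← abs_of_pos (h.poleWeight_pos j), poleWeight, abs_div, abs_neg, mul_div_cancel₀,
      Finset.abs_prod]
    · exact Finset.prod_congr rfl fun i _ => abs_sub_comm _ _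
    · exact abs_ne_zero.mpr (nodeProd_ne_zero h.strictAnti_right j)
  have h2 : vandermondeSq l * ∏ i, zeroWeight l m i = ∏ i, ∏ j, |l i - m j| := by
    rw [vandermondeSq, ← Finset.prod_mul_distrib]
    refine Finset.prod_congr rfl fun i _ => ?_
    rw [← abs_of_pos (h.zeroWeight_pos i), zeroWeight, abs_div, mul_div_cancel₀,
      Finset.abs_prod]
    exact abs_ne_zero.mpr (nodeProd_ne_zero h.strictAnti_left i)
  rw [h1, h2, Finset.prod_comm]

theorem prod_gammaDensity (k : ℝ) {g : Fin n → ℝ} (hg : ∀ i, 0 < g i) :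
    ∏ i, gammaDensity k (g i) =
      (Real.Gamma k)⁻¹ ^ n * (∏ i, g i) ^ (k - 1) * Real.exp (-∑ i, g i) := by
  unfold gammaDensity
  rw [Finset.prod_mul_distrib, Finset.prod_mul_distrib, Finset.prod_const, card_univ,
    Fintype.card_fin, Real.finsetProd_rpow _ _ fun i _ => (hg i).le, ← Real.exp_sum,
    Finset.sum_neg_distrib]

theorem vandermondeSq_pos {v : Fin n → ℝ} (hv : StrictAnti v) : 0 < vandermondeSq v :=
  Finset.prod_pos fun i _ => abs_pos.mpr (nodeProd_ne_zero hv i)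

/-- The joint density of eigenvalues `l` of a bordered matrix, eigenvalues `m` of its minor, and an
independent gamma variable `s`. -/
def jointDensity (k : ℝ) (l : Fin (n + 1) → ℝ) (m : Fin n → ℝ) (s : ℝ) : ℝ :=
  eigenDensity k m * (((∏ j, poleWeight l m j) * |(cauchyBordered l m).det|) *
    (borderDensity k (poleMap m l) * gammaDensity ((n + 1) * k) s))

/-- The constant relating the two factorizations of the joint density. -/
def stepConst (n : ℕ) (k : ℝ) : ℝ :=
  (√(2 * Real.pi))⁻¹ * Real.Gamma k * (Real.Gamma ((n + 1) * k))⁻¹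

theorem stepConst_pos {k : ℝ} (hk : 0 < k) : 0 < stepConst n k := by
  have h1 := Real.Gamma_pos_of_pos hk
  have h2 := Real.Gamma_pos_of_pos (show 0 < ((n : ℝ) + 1) * k by positivity)
  unfold stepConst
  positivity

/-- The Cauchy determinant is common to both sides. The k-th power of `vandermondeSq_mul_poleWeight`
matches Vandermonde factors and weights, `sum_sq_interlace` matches the exponentials, and n + (n +
1)(k - 1) = (n + 1)k - 1 matches the powers of s. Only constants remain: n against n + 1 factors
1/Γ(k), the Gaussian constant, and 1/Γ((n + 1)k). -/
theorem jointDensity_eq {k : ℝ} (hk : 0 < k) (h : Interlace l m) {s : ℝ} (hs : 0 < s) :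
    jointDensity k l m s = stepConst n k * (eigenDensity k l *
      ((|s| ^ n * ((∏ i, zeroWeight l m i) * |(cauchyBordered l m).det|)) *
        ∏ i, gammaDensity k (s * zeroWeight l m i))) := by
  have hΓ := (Real.Gamma_pos_of_pos hk).ne'
  set G := ∏ j, poleWeight l m j with hG
  set W := ∏ i, zeroWeight l m i with hW
  have hG0 : 0 < G := Finset.prod_pos fun j _ => h.poleWeight_pos j
  have hW0 : 0 < W := Finset.prod_pos fun j _ => h.zeroWeight_pos j
  have hDm := vandermondeSq_pos h.strictAnti_right
  have hDl := vandermondeSq_pos h.strictAnti_left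
  have hX : (vandermondeSq m) ^ k * G ^ k = (vandermondeSq l) ^ k * W ^ k := by
    rw [← Real.mul_rpow hDm.le hG0.le, vandermondeSq_mul_poleWeight h, Real.mul_rpow hDl.le hW0.le]
  have hGk : G * G ^ (k - 1) = G ^ k := by
    rw [mul_comm, ← Real.rpow_add_one hG0.ne']; ring_nf
  have hWk : W * W ^ (k - 1) = W ^ k := by
    rw [mul_comm, ← Real.rpow_add_one hW0.ne']; ring_nf
  have hprod : ∏ i, s * zeroWeight l m i = s ^ (n + 1) * W := by
    rw [Finset.prod_mul_distrib, Finset.prod_const, card_univ, Fintype.card_fin]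
  have hsum : ∑ i, s * zeroWeight l m i = s := by
    rw [← Finset.mul_sum, sum_zeroWeight m h.strictAnti_left, mul_one]
  have hspow : s ^ (((n : ℝ) + 1) * k - 1) = s ^ n * (s ^ (n + 1)) ^ (k - 1) := by
    rw [← Real.rpow_natCast, ← Real.rpow_natCast, ← Real.rpow_mul hs.le, ← Real.rpow_add hs]
    congr 1; push_cast; ring
  have hexp : Real.exp (-(∑ j, m j ^ 2) / 2) * Real.exp (-(∑ i, l i - ∑ j, m j) ^ 2 / 2) *
      Real.exp (-∑ j, poleWeight l m j) = Real.exp (-(∑ i, l i ^ 2) / 2) := by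
    rw [← Real.exp_add, ← Real.exp_add, sum_sq_interlace h]
    congr 1; ring
  rw [prod_gammaDensity k fun i => mul_pos hs (h.zeroWeight_pos i), hprod, hsum, jointDensity,
    borderDensity, eigenDensity, eigenDensity, gaussianPDFReal, ← hexp]
  simp only [poleMap, Fin.cons_zero, Fin.cons_succ]
  rw [prod_gammaDensity k h.poleWeight_pos, ← hG, gammaDensity, hspow, stepConst,
    Real.mul_rpow (pow_nonneg hs.le _) hW0.le, abs_of_pos hs]
  simp only [NNReal.coe_one, mul_one, sub_zero]
  have e1 : ∀ A B P Q R E1 E2 E3 E4 Sn S1 d N N' : ℝ,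
      A * E1 * (G * d * (P * E2 * (Q ^ n * G ^ (k - 1) * E3) * (R * (Sn * S1) * E4))) =
      (A * (G * G ^ (k - 1))) * (E1 * E2 * E3) * (d * P * Q ^ n * R * Sn * S1 * E4) := by
    intros; ring
  rw [e1, hGk, hX, ← hWk, pow_succ (Real.Gamma k)⁻¹ n]
  · field_simp
  -- Parameters that do not occur in `e1` are left as goals by the rewriting; any number will do.
  all_goals exact 0

end Step

theorem measurable_det_cauchyBordered :
    Measurable fun p : (Fin (n + 1) → ℝ) × (Fin n → ℝ) => (cauchyBordered p.1 p.2).det := by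
  simp only [Matrix.det_apply]
  refine Finset.measurable_sum _ fun σ _ => Measurable.const_smul
    (Finset.measurable_prod _ fun i _ => ?_) _
  generalize σ i = j
  induction j using Fin.cases with
  | zero => simp only [cauchyBordered, Matrix.of_apply, Fin.cons_zero]; fun_prop
  | succ j => simp only [cauchyBordered, Matrix.of_apply, Fin.cons_succ]; fun_prop

theorem measurable_jointDensity (k : ℝ) :
    Measurable fun p : (Fin (n + 1) → ℝ) × (Fin n → ℝ) × ℝ => jointDensity k p.1 p.2.1 p.2.2 := by
  have hp : Measurable fun p : (Fin (n + 1) → ℝ) × (Fin n → ℝ) × ℝ => (p.1, p.2.1) := by fun_prop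
  unfold jointDensity
  refine ((measurable_eigenDensity k).comp (by fun_prop)).mul ((Measurable.mul ?_ ?_).mul
    (Measurable.mul ?_ ?_))
  · exact Finset.measurable_prod _ fun j _ => (measurable_poleWeight j).comp hp
  · exact (measurable_det_cauchyBordered.comp hp).abs
  · exact (measurable_borderDensity k).comp (measurable_poleMap.comp hp)
  · exact (measurable_gammaDensity _).comp (by fun_prop)

end RankOne
end

/-! ### The transformation of the spectral law under bordering. -/

noncomputable section

namespace RankOne

open Finset
open scoped ENNReal

variable {n : ℕ}

/-- The domain of the joint density. -/
def jointDomain (n : ℕ) : Set ((Fin (n + 1) → ℝ) × (Fin n → ℝ) × ℝ) :=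
  {p | Interlace p.1 p.2.1 ∧ 0 < p.2.2}

theorem measurableSet_jointDomain : MeasurableSet (jointDomain n) :=
  (measurableSet_interlace.preimage
    (show Measurable fun p : (Fin (n + 1) → ℝ) × (Fin n → ℝ) × ℝ => (p.1, p.2.1) by fun_prop)).inter
    (measurableSet_lt measurable_const
      (show Measurable fun p : (Fin (n + 1) → ℝ) × (Fin n → ℝ) × ℝ => p.2.2 by fun_prop))

/-- The integrand of both iterated integrals, in the variables `l`, `m` and `s`. -/
def jointIntegrand (k : ℝ) (f : (Fin (n + 1) → ℝ) × (Fin (n + 1) → ℝ) → ℝ≥0∞) :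
    (Fin (n + 1) → ℝ) × (Fin n → ℝ) × ℝ → ℝ≥0∞ :=
  (jointDomain n).indicator fun p =>
    ENNReal.ofReal (jointDensity k p.1 p.2.1 p.2.2) * f (p.1, p.2.2 • zeroWeight p.1 p.2.1)

variable {k : ℝ} {f : (Fin (n + 1) → ℝ) × (Fin (n + 1) → ℝ) → ℝ≥0∞}

theorem measurable_scaledWeight :
    Measurable fun p : (Fin (n + 1) → ℝ) × (Fin n → ℝ) × ℝ =>
      (p.1, p.2.2 • zeroWeight p.1 p.2.1) := by
  have h1 : Measurable fun p : (Fin (n + 1) → ℝ) × (Fin n → ℝ) × ℝ => zeroWeight p.1 p.2.1 :=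
    measurable_zeroWeight.comp
      (show Measurable fun p : (Fin (n + 1) → ℝ) × (Fin n → ℝ) × ℝ => (p.1, p.2.1) by fun_prop)
  have h2 : Measurable fun p : (Fin (n + 1) → ℝ) × (Fin n → ℝ) × ℝ => p.2.2 := by fun_prop
  exact measurable_fst.prodMk (h2.smul h1)

theorem measurable_jointIntegrand (hf : Measurable f) : Measurable (jointIntegrand k f) :=
  ((measurable_jointDensity k).ennreal_ofReal.mul (hf.comp measurable_scaledWeight)).indicator
    measurableSet_jointDomain

theorem lintegral_withDensity_ofReal {α : Type*} [MeasurableSpace α] (μ : Measure α) {d : α → ℝ}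
    (hd : Measurable d) (h : α → ℝ≥0∞) :
    ∫⁻ x, h x ∂μ.withDensity (fun x => ENNReal.ofReal (d x)) =
      ∫⁻ x, ENNReal.ofReal (d x) * h x ∂μ :=
  lintegral_withDensity_eq_lintegral_mul_non_measurable μ hd.ennreal_ofReal
    (Eventually.of_forall fun _ => ENNReal.ofReal_lt_top) h

theorem eigenDensity_nonneg (k : ℝ) (l : Fin n → ℝ) : 0 ≤ eigenDensity k l := by
  have : 0 ≤ vandermondeSq l := Finset.prod_nonneg fun i _ => abs_nonneg _
  unfold eigenDensity; positivity

/-- For fixed m, the substitution (a, g) = `poleMap m l` replaces the random border by the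
interlacing eigenvalues; `F` then returns l itself. -/
theorem lintegral_step_left (hk : 0 < k)
    {F : (Fin (n + 1) → ℝ) × (Fin n → ℝ) → Fin (n + 1) → ℝ} (hF : Measurable F)
    (hFl : ∀ l m, Interlace l m → F (poleMap m l, m) = l) (hf : Measurable f) :
    ∫⁻ m, ∫⁻ p, ∫⁻ s, f (F (Fin.cons p.1 p.2, m), s • zeroWeight (F (Fin.cons p.1 p.2, m)) m)
      ∂gammaMeasure ((n + 1) * k) 1 ∂((gaussianReal 0 1).prod (gammaPi k n)) ∂eigenMeasure k n =
    ∫⁻ m, ∫⁻ l, ∫⁻ s, jointIntegrand k f (l, m, s) := by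
  have hnk : 0 < ((n : ℝ) + 1) * k := by positivity
  have : IsProbabilityMeasure (gammaMeasure ((n + 1) * k) 1) :=
    isProbabilityMeasure_gammaMeasure hnk one_pos
  rw [eigenMeasure, lintegral_withDensity_ofReal _ (measurable_eigenDensity k),
    ← lintegral_indicator measurableSet_strictAnti]
  refine lintegral_congr fun m => ?_
  by_cases hm : StrictAnti m
  · rw [Set.indicator_of_mem (show m ∈ {l | StrictAnti l} from hm)]
    set H : (Fin (n + 1) → ℝ) → ℝ≥0∞ := fun y =>
      ∫⁻ s, f (F (y, m), s • zeroWeight (F (y, m)) m) ∂gammaMeasure ((n + 1) * k) 1 with hH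
    have hHm : Measurable H := by
      have h1 : Measurable fun q : (Fin (n + 1) → ℝ) × ℝ =>
          f (F (q.1, m), q.2 • zeroWeight (F (q.1, m)) m) := by
        have h2 : Measurable fun q : (Fin (n + 1) → ℝ) × ℝ => (F (q.1, m), m, q.2) :=
          (hF.comp (measurable_fst.prodMk measurable_const)).prodMk
            (measurable_const.prodMk measurable_snd)
        exact hf.comp (measurable_scaledWeight.comp h2)
      exact h1.lintegral_prod_right'
    have hI : MeasurableSet {l | Interlace l m} :=
      measurableSet_interlace.preimage (measurable_id.prodMk measurable_const)
    change _ * ∫⁻ p : ℝ × (Fin n → ℝ), H (Fin.cons p.1 p.2) ∂_ = _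
    rw [lintegral_border hk hHm, setLIntegral_poleMap hm,
      ← lintegral_const_mul' _ _ ENNReal.ofReal_ne_top, ← lintegral_indicator hI]
    refine lintegral_congr fun l => ?_
    by_cases hl : Interlace l m
    · rw [Set.indicator_of_mem (show l ∈ {l | Interlace l m} from hl)]
      simp only [hH, hFl l m hl]
      rw [gammaMeasure_eq, lintegral_withDensity_ofReal _ (measurable_gammaDensity _),
        ← lintegral_const_mul' _ _ ENNReal.ofReal_ne_top,
        ← lintegral_const_mul' _ _ ENNReal.ofReal_ne_top,
        ← lintegral_const_mul' _ _ ENNReal.ofReal_ne_top, ← lintegral_indicator measurableSet_Ioi]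
      refine lintegral_congr fun s => ?_
      by_cases hs : 0 < s
      · rw [Set.indicator_of_mem (Set.mem_Ioi.mpr hs), jointIntegrand,
          Set.indicator_of_mem (show (l, m, s) ∈ jointDomain n from ⟨hl, hs⟩)]
        have hg : ∀ j : Fin n, 0 < poleMap m l j.succ := fun j => hl.poleWeight_pos j
        have h1 : 0 ≤ (∏ j, poleWeight l m j) * |(cauchyBordered l m).det| :=
          mul_nonneg (Finset.prod_nonneg fun j _ => (hl.poleWeight_pos j).le) (abs_nonneg _)
        have h2 : 0 ≤ borderDensity k (poleMap m l) :=
          mul_nonneg (gaussianPDFReal_nonneg _ _ _)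
            (Finset.prod_nonneg fun j _ => gammaDensity_nonneg hk (hg j))
        rw [jointDensity, ENNReal.ofReal_mul (eigenDensity_nonneg k m), ENNReal.ofReal_mul h1,
          ENNReal.ofReal_mul h2]
        ring
      · rw [Set.indicator_of_notMem (by simpa using hs), jointIntegrand,
          Set.indicator_of_notMem fun h => hs h.2]
    · rw [Set.indicator_of_notMem (by simpa using hl)]
      symm
      rw [lintegral_eq_zero_of_ae_eq_zero]
      exact Eventually.of_forall fun s => Set.indicator_of_notMem (fun h => hl h.1) _
  · rw [Set.indicator_of_notMem (by simpa using hm)]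
    symm
    rw [lintegral_eq_zero_of_ae_eq_zero]
    refine Eventually.of_forall fun l => ?_
    change (∫⁻ s, jointIntegrand k f (l, m, s)) = 0
    rw [lintegral_eq_zero_of_ae_eq_zero]
    · exact Eventually.of_forall fun s =>
        Set.indicator_of_notMem (fun h => hm h.1.strictAnti_right) _

/-- For fixed l, the substitution g = `zeroMap l` (s, m) separates a gamma vector into its sum s and
the interlacing points that encode its direction. -/
theorem lintegral_step_right (hk : 0 < k) (hf : Measurable f) :
    ENNReal.ofReal (stepConst n k) * ∫⁻ l, ∫⁻ g, f (l, g) ∂gammaPi k (n + 1) ∂eigenMeasure k (n + 1) =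
    ∫⁻ l, ∫⁻ s, ∫⁻ m, jointIntegrand k f (l, m, s) := by
  rw [eigenMeasure, lintegral_withDensity_ofReal _ (measurable_eigenDensity k),
    ← lintegral_indicator measurableSet_strictAnti,
    ← lintegral_const_mul' _ _ ENNReal.ofReal_ne_top]
  refine lintegral_congr fun l => ?_
  by_cases hl : StrictAnti l
  · have hms : MeasurableSet {y : Fin (n + 1) → ℝ | 0 < y 0 ∧ Interlace l (Fin.tail y)} := by
      refine (measurableSet_lt measurable_const (measurable_pi_apply 0)).inter
        (measurableSet_interlace.preimage (measurable_const.prodMk ?_))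
      exact measurable_pi_lambda _ fun i => measurable_pi_apply _
    have hgm : Measurable fun g : Fin (n + 1) → ℝ => ∏ i, gammaDensity k (g i) :=
      Finset.measurable_prod _ fun j _ => (measurable_gammaDensity k).comp (measurable_pi_apply _)
    have hjm : Measurable fun y : Fin (n + 1) → ℝ => jointIntegrand k f (l, Fin.tail y, y 0) := by
      refine (measurable_jointIntegrand hf).comp (measurable_const.prodMk (Measurable.prodMk ?_ ?_))
      · exact measurable_pi_lambda _ fun i => measurable_pi_apply _
      · exact measurable_pi_apply 0
    have hsplit := lintegral_cons _ hjm
    simp only [Fin.tail_cons, Fin.cons_zero] at hsplit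
    rw [Set.indicator_of_mem (show l ∈ {l | StrictAnti l} from hl), gammaPi_eq hk,
      lintegral_withDensity_ofReal _ hgm, setLIntegral_zeroMap hl, ← hsplit,
      ← lintegral_const_mul' _ _ ENNReal.ofReal_ne_top,
      ← lintegral_const_mul' _ _ ENNReal.ofReal_ne_top, ← lintegral_indicator hms]
    refine lintegral_congr fun y => ?_
    by_cases hy : 0 < y 0 ∧ Interlace l (Fin.tail y)
    · rw [Set.indicator_of_mem (s := {y : Fin (n + 1) → ℝ | 0 < y 0 ∧ Interlace l (Fin.tail y)}) hy, jointIntegrand,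
        Set.indicator_of_mem (show (l, Fin.tail y, y 0) ∈ jointDomain n from ⟨hy.2, hy.1⟩)]
      have h1 : 0 ≤ |y 0| ^ n * ((∏ i, zeroWeight l (Fin.tail y) i) *
          |(cauchyBordered l (Fin.tail y)).det|) :=
        mul_nonneg (pow_nonneg (abs_nonneg _) _)
          (mul_nonneg (Finset.prod_nonneg fun j _ => (hy.2.zeroWeight_pos j).le) (abs_nonneg _))
      rw [jointDensity_eq hk hy.2 hy.1, ENNReal.ofReal_mul (stepConst_pos hk).le,
        ENNReal.ofReal_mul (eigenDensity_nonneg k l), ENNReal.ofReal_mul h1]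
      have h2 : y 0 • zeroWeight l (Fin.tail y) = zeroMap l y := rfl
      have h3 : ∏ i, gammaDensity k (y 0 * zeroWeight l (Fin.tail y) i) =
        ∏ i, gammaDensity k (zeroMap l y i) := rfl
      rw [h2, h3]
      ring
    · rw [Set.indicator_of_notMem
        (s := {y : Fin (n + 1) → ℝ | 0 < y 0 ∧ Interlace l (Fin.tail y)}) hy, jointIntegrand,
        Set.indicator_of_notMem fun h => hy ⟨h.2, h.1⟩]
  · rw [Set.indicator_of_notMem (by simpa using hl), mul_zero]
    symm
    rw [lintegral_eq_zero_of_ae_eq_zero]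
    refine Eventually.of_forall fun s => ?_
    change (∫⁻ m, jointIntegrand k f (l, m, s)) = 0
    rw [lintegral_eq_zero_of_ae_eq_zero]
    · exact Eventually.of_forall fun m =>
        Set.indicator_of_notMem (fun h => hl h.1.strictAnti_left) _

theorem lintegral_joint_comm (hf : Measurable f) :
    ∫⁻ m, ∫⁻ l, ∫⁻ s, jointIntegrand k f (l, m, s) =
      ∫⁻ l, ∫⁻ s, ∫⁻ m, jointIntegrand k f (l, m, s) := by
  have hj := measurable_jointIntegrand (k := k) hf
  rw [lintegral_lintegral_swap]
  · refine lintegral_congr fun l => ?_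
    rw [lintegral_lintegral_swap]
    exact (hj.comp (measurable_const.prodMk measurable_id)).aemeasurable
  · refine Measurable.aemeasurable ?_
    have : Measurable fun q : ((Fin n → ℝ) × (Fin (n + 1) → ℝ)) × ℝ =>
        jointIntegrand k f (q.1.2, q.1.1, q.2) := hj.comp (by fun_prop)
    exact this.lintegral_prod_right'

theorem isProbabilityMeasure_gammaPi {k : ℝ} (hk : 0 < k) (n : ℕ) :
    IsProbabilityMeasure (gammaPi k n) := by
  have := isProbabilityMeasure_gammaMeasure hk one_pos
  unfold gammaPi; infer_instance

/-- Tested against a function, the two measures become integrals of one and the same integrand over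
(l, m, s) in different orders. -/
theorem map_step (hk : 0 < k)
    {F : (Fin (n + 1) → ℝ) × (Fin n → ℝ) → Fin (n + 1) → ℝ} (hF : Measurable F)
    (hFl : ∀ l m, Interlace l m → F (poleMap m l, m) = l) :
    (((eigenMeasure k n).prod (gammaPi k n)).prod
      ((gaussianReal 0 1).prod (gammaMeasure ((n + 1) * k) 1))).map
      (fun p => (F (Fin.cons p.2.1 p.1.2, p.1.1),
        p.2.2 • zeroWeight (F (Fin.cons p.2.1 p.1.2, p.1.1)) p.1.1)) =
    ENNReal.ofReal (stepConst n k) • (eigenMeasure k (n + 1)).prod (gammaPi k (n + 1)) := by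
  have hnk : 0 < ((n : ℝ) + 1) * k := by positivity
  have := isProbabilityMeasure_gammaMeasure hnk one_pos
  have := isProbabilityMeasure_gammaPi hk n
  have := isProbabilityMeasure_gammaPi hk (n + 1)
  have hT : Measurable fun p : ((Fin n → ℝ) × (Fin n → ℝ)) × (ℝ × ℝ) =>
      (F (Fin.cons p.2.1 p.1.2, p.1.1),
        p.2.2 • zeroWeight (F (Fin.cons p.2.1 p.1.2, p.1.1)) p.1.1) := by
    have h1 : Measurable fun p : ((Fin n → ℝ) × (Fin n → ℝ)) × (ℝ × ℝ) =>
        (F (Fin.cons p.2.1 p.1.2, p.1.1), p.1.1, p.2.2) := by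
      refine Measurable.prodMk (hF.comp (Measurable.prodMk ?_ ?_)) (by fun_prop)
      · exact measurable_cons.comp
          (show Measurable fun p : ((Fin n → ℝ) × (Fin n → ℝ)) × (ℝ × ℝ) => (p.2.1, p.1.2) by fun_prop)
      · fun_prop
    exact measurable_scaledWeight.comp h1
  refine Measure.ext_of_lintegral _ fun f hf => ?_
  have hfT : Measurable fun p : ((Fin n → ℝ) × (Fin n → ℝ)) × (ℝ × ℝ) =>
      f (F (Fin.cons p.2.1 p.1.2, p.1.1),
        p.2.2 • zeroWeight (F (Fin.cons p.2.1 p.1.2, p.1.1)) p.1.1) := hf.comp hT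
  rw [lintegral_map hf hT, lintegral_smul_measure, smul_eq_mul,
    lintegral_prod _ hf.aemeasurable, lintegral_step_right hk hf, ← lintegral_joint_comm hf,
    ← lintegral_step_left hk hF hFl hf]
  rw [lintegral_prod _ hfT.aemeasurable, lintegral_prod _ hfT.lintegral_prod_right'.aemeasurable]
  refine lintegral_congr fun m => ?_
  have hfm : Measurable fun q : ((Fin n → ℝ) × ℝ) × ℝ =>
      f (F (Fin.cons q.1.2 q.1.1, m), q.2 • zeroWeight (F (Fin.cons q.1.2 q.1.1, m)) m) := by
    have : Measurable fun q : ((Fin n → ℝ) × ℝ) × ℝ =>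
      (((m, q.1.1), (q.1.2, q.2)) : ((Fin n → ℝ) × (Fin n → ℝ)) × (ℝ × ℝ)) := by fun_prop
    exact hfT.comp this
  have hfm' := hfm.lintegral_prod_right' (ν := gammaMeasure ((n + 1) * k) 1)
  have hsw := hfm'.comp (measurable_swap (α := ℝ) (β := Fin n → ℝ))
  calc _ = ∫⁻ g, ∫⁻ a, ∫⁻ s, f (F (Fin.cons a g, m), s • zeroWeight (F (Fin.cons a g, m)) m)
        ∂gammaMeasure ((n + 1) * k) 1 ∂gaussianReal 0 1 ∂gammaPi k n := by
        refine lintegral_congr fun g => ?_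
        have : Measurable fun q : ℝ × ℝ =>
            f (F (Fin.cons q.1 g, m), q.2 • zeroWeight (F (Fin.cons q.1 g, m)) m) :=
          hfT.comp (show Measurable fun q : ℝ × ℝ =>
            (((m, g), q) : ((Fin n → ℝ) × (Fin n → ℝ)) × (ℝ × ℝ)) by fun_prop)
        exact lintegral_prod _ this.aemeasurable
    _ = ∫⁻ a, ∫⁻ g, ∫⁻ s, f (F (Fin.cons a g, m), s • zeroWeight (F (Fin.cons a g, m)) m)
        ∂gammaMeasure ((n + 1) * k) 1 ∂gammaPi k n ∂gaussianReal 0 1 :=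
        lintegral_lintegral_swap hfm'.aemeasurable
    _ = _ := (lintegral_prod _ hsw.aemeasurable).symm

end RankOne
end

noncomputable section

namespace RankOne

open Finset
open scoped ENNReal

/-! ### The spectral measure of a random tridiagonal matrix -/

variable {n : ℕ}

theorem measurePreserving_prod_prod_comm {A B C D : Type*} [MeasurableSpace A] [MeasurableSpace B]
    [MeasurableSpace C] [MeasurableSpace D] (a : Measure A) (b : Measure B) (c : Measure C)
    (d : Measure D) [SFinite a] [SFinite b] [SFinite c] [SFinite d] :
    MeasurePreserving (fun p : (A × B) × (C × D) => ((p.1.1, p.2.1), (p.1.2, p.2.2)))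
      ((a.prod b).prod (c.prod d)) ((a.prod c).prod (b.prod d)) := by
  have h1 := measurePreserving_prodAssoc a b (c.prod d)
  have h2 := (measurePreserving_prodAssoc b c d).symm
  have h3 := (Measure.measurePreserving_swap (μ := b) (ν := c)).prod (MeasurePreserving.id d)
  have h4 := measurePreserving_prodAssoc c b d
  have h5 := (measurePreserving_prodAssoc a c (b.prod d)).symm
  exact h5.comp (((MeasurePreserving.id a).prod (h4.comp (h3.comp h2))).comp h1)

/-- The joint law of the entries of the unscaled, unshifted tridiagonal matrix. -/
def jacobiLaw (β : ℝ) (n : ℕ) : Measure ((Fin (n + 1) → ℝ) × (Fin n → ℝ)) :=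
  (Measure.pi fun _ : Fin (n + 1) => gaussianReal 0 1).prod
    (Measure.pi fun i : Fin n => chiTilde (β * ((n : ℝ) - i.1)))

theorem isProbabilityMeasure_chiTilde {r : ℝ} (hr : 0 < r) : IsProbabilityMeasure (chiTilde r) := by
  have := isProbabilityMeasure_gammaMeasure (half_pos hr) one_pos
  exact Measure.isProbabilityMeasure_map Real.continuous_sqrt.measurable.aemeasurable

theorem chiTilde_index_pos {β : ℝ} (hβ : 0 < β) (i : Fin n) : 0 < β * ((n : ℝ) - i.1) := by
  have : (i.1 : ℝ) < n := by exact_mod_cast i.2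
  exact mul_pos hβ (by linarith)

theorem isProbabilityMeasure_jacobiLaw {β : ℝ} (hβ : 0 < β) (n : ℕ) :
    IsProbabilityMeasure (jacobiLaw β n) := by
  have := fun i : Fin n => isProbabilityMeasure_chiTilde (chiTilde_index_pos hβ i)
  unfold jacobiLaw; infer_instance

theorem gammaMeasure_pos_ae (k : ℝ) : ∀ᵐ s ∂gammaMeasure k 1, 0 < s := by
  rw [gammaMeasure_eq]
  exact (withDensity_absolutelyContinuous _ _).ae_le (ae_restrict_mem measurableSet_Ioi)

theorem gammaPi_pos_ae {k : ℝ} (hk : 0 < k) (n : ℕ) : ∀ᵐ g ∂gammaPi k n, ∀ i, 0 < g i := by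
  rw [gammaPi_eq hk]
  exact (withDensity_absolutelyContinuous _ _).ae_le (ae_restrict_mem measurableSet_pos)

/-- Adding a corner entry `a` and an off-diagonal entry `√s` to a tridiagonal matrix. -/
def jacobiCons (p : (((Fin (n + 1) → ℝ) × (Fin n → ℝ)) × ℝ) × ℝ) :
    (Fin (n + 2) → ℝ) × (Fin (n + 1) → ℝ) :=
  (Fin.cons p.2 p.1.1.1, Fin.cons (√p.1.2) p.1.1.2)

/-- The square root of the gamma variable is the top off-diagonal entry of the larger matrix;
everything else is a rearrangement of independent coordinates. -/
theorem measurePreserving_jacobiCons {β : ℝ} (hβ : 0 < β) (n : ℕ) :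
    MeasurePreserving (jacobiCons (n := n))
      (((jacobiLaw β n).prod (gammaMeasure (((n : ℝ) + 1) * (β / 2)) 1)).prod (gaussianReal 0 1))
      (jacobiLaw β (n + 1)) := by
  have hk : 0 < ((n : ℝ) + 1) * (β / 2) := by positivity
  have := isProbabilityMeasure_gammaMeasure hk one_pos
  have := fun i : Fin n => isProbabilityMeasure_chiTilde (chiTilde_index_pos hβ i)
  have := fun i : Fin (n + 1) => isProbabilityMeasure_chiTilde (chiTilde_index_pos hβ i)
  set Γ := gammaMeasure (((n : ℝ) + 1) * (β / 2)) 1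
  set N := gaussianReal 0 1
  set D := Measure.pi fun _ : Fin (n + 1) => gaussianReal 0 1
  set O := Measure.pi fun i : Fin n => chiTilde (β * ((n : ℝ) - i.1))
  have hsq : MeasurePreserving Real.sqrt Γ (chiTilde (β * (((n + 1 : ℕ) : ℝ) - (0 : Fin (n + 1)).1))) := by
    refine ⟨Real.continuous_sqrt.measurable, ?_⟩
    rw [chiTilde]
    have : (((n : ℝ) + 1) * (β / 2)) = β * (((n + 1 : ℕ) : ℝ) - (0 : Fin (n + 1)).1) / 2 := by
      push_cast [Fin.val_zero]
      ring
    rw [← this]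
  have h1 : MeasurePreserving (fun p : (((Fin (n + 1) → ℝ) × (Fin n → ℝ)) × ℝ) × ℝ =>
      ((p.2, p.1.2), p.1.1)) (((D.prod O).prod Γ).prod N) ((N.prod Γ).prod (D.prod O)) := by
    have e1 := Measure.measurePreserving_swap (μ := (D.prod O).prod Γ) (ν := N)
    have e2 := (MeasurePreserving.id N).prod
      (Measure.measurePreserving_swap (μ := D.prod O) (ν := Γ))
    have e3 := (measurePreserving_prodAssoc N Γ (D.prod O)).symm
    exact e3.comp (e2.comp e1)
  have h2 := measurePreserving_prod_prod_comm N Γ D O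
  have h3 := measurePreserving_cons (fun _ : Fin (n + 2) => gaussianReal 0 1)
  have h4 := measurePreserving_cons
    (fun i : Fin (n + 1) => chiTilde (β * (((n + 1 : ℕ) : ℝ) - i.1)))
  -- The shapes are counted from the bottom of the matrix: removing the top entry shifts size and
  -- index together.
  have hO : (Measure.pi fun j : Fin n => chiTilde (β * (((n + 1 : ℕ) : ℝ) - j.succ.1))) = O := by
    simp only [O]
    congr 1
    funext j
    rw [Fin.val_succ]
    push_cast
    ring_nf
  rw [hO] at h4
  exact (h3.prod (h4.comp (hsq.prod (MeasurePreserving.id O)))).comp (h2.comp h1)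

/-- A measurable choice of the eigenvalues and the spectral weights of a tridiagonal matrix, together
with the joint law of the eigenvalues and of the weights scaled by a gamma variable. -/
structure IsSpectralMap (β : ℝ) (n : ℕ)
    (Ψ : (Fin (n + 1) → ℝ) × (Fin n → ℝ) → (Fin (n + 1) → ℝ) × (Fin (n + 1) → ℝ)) : Prop where
  measurable : Measurable Ψ
  ae_spectralData : ∀ᵐ x ∂jacobiLaw β n, SpectralData (jacobiMatrix x) (Ψ x).1 (Ψ x).2
  exists_map : ∃ c : ℝ, 0 < c ∧
    ((jacobiLaw β n).prod (gammaMeasure (((n : ℝ) + 1) * (β / 2)) 1)).map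
      (fun p => ((Ψ p.1).1, p.2 • (Ψ p.1).2)) =
    ENNReal.ofReal c • (eigenMeasure (β / 2) (n + 1)).prod (gammaPi (β / 2) (n + 1))

theorem measurable_spectralScale
    {Ψ : (Fin (n + 1) → ℝ) × (Fin n → ℝ) → (Fin (n + 1) → ℝ) × (Fin (n + 1) → ℝ)}
    (h : Measurable Ψ) : Measurable fun p : ((Fin (n + 1) → ℝ) × (Fin n → ℝ)) × ℝ =>
      ((Ψ p.1).1, p.2 • (Ψ p.1).2) := by
  have h1 : Measurable fun p : ((Fin (n + 1) → ℝ) × (Fin n → ℝ)) × ℝ => Ψ p.1 :=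
    h.comp measurable_fst
  exact (measurable_fst.comp h1).prodMk (measurable_snd.smul (measurable_snd.comp h1))

/-- For a 1 × 1 matrix the entry is the eigenvalue, the weight is 1 and the Vandermonde factor is an
empty product, so only the Gaussian constant has to be tracked. -/
theorem isSpectralMap_zero {β : ℝ} (hβ : 0 < β) : IsSpectralMap β 0 fun x => (x.1, fun _ => 1) := by
  have hk : 0 < β / 2 := half_pos hβ
  refine ⟨by fun_prop, Eventually.of_forall fun x => ?_, (√(2 * Real.pi))⁻¹, by positivity, ?_⟩
  · refine ⟨Subsingleton.strictAnti (α := Fin 1) _, fun _ => one_pos, 1, by simp, ?_, by simp⟩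
    ext i j
    fin_cases i; fin_cases j
    simp [jacobiMatrix]
  · have := isProbabilityMeasure_gammaMeasure hk one_pos
    have := isProbabilityMeasure_gammaPi hk 1
    have e0 : (((0 : ℕ) : ℝ) + 1) * (β / 2) = β / 2 := by push_cast; ring
    rw [e0]
    have := isProbabilityMeasure_jacobiLaw hβ 0
    have := fun i : Fin 0 => isProbabilityMeasure_chiTilde (chiTilde_index_pos hβ i)
    have h1 : MeasurePreserving (fun x : (Fin 1 → ℝ) × (Fin 0 → ℝ) => x.1) (jacobiLaw β 0)
        (Measure.pi fun _ : Fin 1 => gaussianReal 0 1) := by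
      unfold jacobiLaw
      exact measurePreserving_fst
    have h2 : MeasurePreserving (fun (s : ℝ) (_ : Fin 1) => s) (gammaMeasure (β / 2) 1)
        (gammaPi (β / 2) 1) :=
      (measurePreserving_piUnique (fun _ : Fin 1 => gammaMeasure (β / 2) 1)).symm
    have h3 : (Measure.pi fun _ : Fin 1 => gaussianReal 0 1) =
        ENNReal.ofReal (√(2 * Real.pi))⁻¹ • eigenMeasure (β / 2) 1 := by
      rw [gaussianReal_of_var_ne_zero _ one_ne_zero]
      have : SigmaFinite ((volume : Measure ℝ).withDensity (gaussianPDF 0 1)) := by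
        rw [← gaussianReal_of_var_ne_zero _ one_ne_zero]; infer_instance
      rw [pi_withDensity _ fun _ => measurable_gaussianPDF 0 1, eigenMeasure,
        ← withDensity_smul _ (measurable_eigenDensity _).ennreal_ofReal]
      have h4 : {l : Fin 1 → ℝ | StrictAnti l} = Set.univ :=
        Set.eq_univ_of_forall fun l => Subsingleton.strictAnti l
      rw [h4, Measure.restrict_univ, volume_pi]
      congr 1
      funext l
      rw [Pi.smul_apply, smul_eq_mul, ← ENNReal.ofReal_mul (by positivity)]
      simp [gaussianPDF, gaussianPDFReal, eigenDensity, vandermondeSq, nodeProd]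
    have h5 := (h1.prod h2).map_eq
    rw [h3, Measure.prod_smul_left] at h5
    rw [← h5]
    congr 1
    funext p
    refine Prod.ext rfl (funext fun _ => ?_)
    simp

theorem exists_isSpectralMap {β : ℝ} (hβ : 0 < β) (n : ℕ) : ∃ Ψ, IsSpectralMap β n Ψ := by
  have hk : 0 < β / 2 := half_pos hβ
  induction n with
  | zero => exact ⟨_, isSpectralMap_zero hβ⟩
  | succ n ih =>
    obtain ⟨Ψ, hΨm, hΨs, c, hc, hΨ⟩ := ih
    obtain ⟨F, hF, hFl⟩ := exists_measurable_inverse (n + 1)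
    have hk1 : 0 < ((n : ℝ) + 1) * (β / 2) := by positivity
    have hk2 : 0 < (((n + 1 : ℕ) : ℝ) + 1) * (β / 2) := by positivity
    have := isProbabilityMeasure_gammaMeasure hk1 one_pos
    have := isProbabilityMeasure_gammaMeasure hk2 one_pos
    have := isProbabilityMeasure_jacobiLaw hβ n
    have := isProbabilityMeasure_jacobiLaw hβ (n + 1)
    have := isProbabilityMeasure_gammaPi hk (n + 1)
    set Γ₁ := gammaMeasure (((n : ℝ) + 1) * (β / 2)) 1
    set Γ₂ := gammaMeasure ((((n + 1 : ℕ) : ℝ) + 1) * (β / 2)) 1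
    set N := gaussianReal 0 1
    -- the spectral map after bordering, as a function of `((m, g), a)`
    set S : ((Fin (n + 1) → ℝ) × (Fin (n + 1) → ℝ)) × ℝ → (Fin (n + 2) → ℝ) × (Fin (n + 2) → ℝ) :=
      fun q => (F (Fin.cons q.2 q.1.2, q.1.1),
        zeroWeight (F (Fin.cons q.2 q.1.2, q.1.1)) q.1.1) with hS
    have hSm : Measurable S := by
      have h1 : Measurable fun q : ((Fin (n + 1) → ℝ) × (Fin (n + 1) → ℝ)) × ℝ =>
          F (Fin.cons q.2 q.1.2, q.1.1) := by
        refine hF.comp (Measurable.prodMk (measurable_cons.comp (Measurable.prodMk ?_ ?_)) ?_) <;>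
          fun_prop
      exact h1.prodMk (measurable_zeroWeight.comp (h1.prodMk (by fun_prop)))
    -- `U` extracts the eigenvalues of the minor, its weights scaled by the squared top off-diagonal
    -- entry, and the corner. `S` then solves the secular equation.
    set U : (Fin (n + 2) → ℝ) × (Fin (n + 1) → ℝ) →
        ((Fin (n + 1) → ℝ) × (Fin (n + 1) → ℝ)) × ℝ := fun y =>
      (((Ψ (Fin.tail y.1, Fin.tail y.2)).1,
        (y.2 0) ^ 2 • (Ψ (Fin.tail y.1, Fin.tail y.2)).2), y.1 0) with hU
    have hUm : Measurable U := by
      have h1 : Measurable fun y : (Fin (n + 2) → ℝ) × (Fin (n + 1) → ℝ) =>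
          Ψ (Fin.tail y.1, Fin.tail y.2) := by
        refine hΨm.comp (Measurable.prodMk ?_ ?_) <;>
          exact measurable_pi_lambda _ fun i => by simp only [Fin.tail]; fun_prop
      have h2 : Measurable fun y : (Fin (n + 2) → ℝ) × (Fin (n + 1) → ℝ) => (y.2 0) ^ 2 := by
        fun_prop
      exact ((measurable_fst.comp h1).prodMk (h2.smul (measurable_snd.comp h1))).prodMk
        (by fun_prop)
    have hκ := measurePreserving_jacobiCons hβ n
    refine ⟨S ∘ U, hSm.comp hUm, ?_, c * stepConst (n + 1) (β / 2),
      mul_pos hc (stepConst_pos hk), ?_⟩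
    · have htm : Measurable fun y : (Fin (n + 2) → ℝ) × (Fin (n + 1) → ℝ) =>
          (Fin.tail y.1, Fin.tail y.2) := by
        refine Measurable.prodMk ?_ ?_ <;>
          exact measurable_pi_lambda _ fun i => by simp only [Fin.tail]; fun_prop
      have hq : Measure.QuasiMeasurePreserving (fun y : (Fin (n + 2) → ℝ) × (Fin (n + 1) → ℝ) =>
          (Fin.tail y.1, Fin.tail y.2)) (jacobiLaw β (n + 1)) (jacobiLaw β n) := by
        refine ⟨htm, ?_⟩
        rw [← hκ.map_eq, Measure.map_map htm hκ.measurable]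
        exact (Measure.quasiMeasurePreserving_fst.comp
          Measure.quasiMeasurePreserving_fst).absolutelyContinuous
      have hb : ∀ᵐ y ∂jacobiLaw β (n + 1), 0 < y.2 0 := by
        rw [← hκ.map_eq, ae_map_iff hκ.measurable.aemeasurable
          (measurableSet_lt measurable_const (by fun_prop))]
        have : ∀ᵐ p ∂((jacobiLaw β n).prod Γ₁).prod N, 0 < p.1.2 :=
          Measure.quasiMeasurePreserving_fst.ae
            (Measure.quasiMeasurePreserving_snd.ae (gammaMeasure_pos_ae _))
        filter_upwards [this] with p hp
        simpa [jacobiCons] using hp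
      filter_upwards [hq.ae hΨs, hb] with y hy hyb
      -- Almost surely the scaled weights are positive, so the secular equation has an interlacing
      -- solution, which `F` must return.
      obtain ⟨l, hl, hla, hlg⟩ := exists_interlace_poleWeight hy.strictAnti (y.1 0)
        (g := (y.2 0) ^ 2 • (Ψ (Fin.tail y.1, Fin.tail y.2)).2)
        fun j => mul_pos (pow_pos hyb 2) (hy.pos j)
      have hFy : F (Fin.cons (y.1 0) ((y.2 0) ^ 2 • (Ψ (Fin.tail y.1, Fin.tail y.2)).2),
          (Ψ (Fin.tail y.1, Fin.tail y.2)).1) = l := by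
        rw [← hla, ← hlg]
        exact hFl l _ hl
      have hM := jacobiMatrix_cons (y.1 0) (y.2 0) (Fin.tail y.1) (Fin.tail y.2)
      rw [Fin.cons_self_tail, Fin.cons_self_tail] at hM
      simp only [Function.comp_apply, hS, hU, hFy]
      rw [show y = (y.1, y.2) from rfl, hM]
      exact hy.border hl hla fun j => by rw [hlg]; rfl
    · -- the law
      have h1 : ((jacobiLaw β (n + 1)).prod Γ₂) =
          ((((jacobiLaw β n).prod Γ₁).prod N).prod Γ₂).map (Prod.map jacobiCons id) :=
        ((hκ.prod (MeasurePreserving.id Γ₂)).map_eq).symm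
      have hT2 := measurable_spectralScale (n := n + 1) (hSm.comp hUm)
      rw [h1, Measure.map_map hT2 (hκ.measurable.prodMap measurable_id)]
      have h2 := map_step (n := n + 1) hk hF hFl
      have h3 : (((((jacobiLaw β n).prod Γ₁).prod N).prod Γ₂)).map
          (fun p => (((Ψ p.1.1.1).1, p.1.1.2 • (Ψ p.1.1.1).2), (p.1.2, p.2))) =
          ENNReal.ofReal c • ((eigenMeasure (β / 2) (n + 1)).prod (gammaPi (β / 2) (n + 1))).prod
            (N.prod Γ₂) := by
        have e1 := measurePreserving_prodAssoc ((jacobiLaw β n).prod Γ₁) N Γ₂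
        have e2 : MeasurePreserving (fun p : ((Fin (n + 1) → ℝ) × (Fin n → ℝ)) × ℝ =>
            ((Ψ p.1).1, p.2 • (Ψ p.1).2)) ((jacobiLaw β n).prod Γ₁)
            (ENNReal.ofReal c • (eigenMeasure (β / 2) (n + 1)).prod (gammaPi (β / 2) (n + 1))) :=
          ⟨measurable_spectralScale hΨm, hΨ⟩
        have e3 := (e2.prod (MeasurePreserving.id (N.prod Γ₂))).comp e1
        rw [← Measure.prod_smul_left]
        exact e3.map_eq
      have hT3 : Measurable fun p : ((((Fin (n + 1) → ℝ) × (Fin n → ℝ)) × ℝ) × ℝ) × ℝ =>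
          (((Ψ p.1.1.1).1, p.1.1.2 • (Ψ p.1.1.1).2), (p.1.2, p.2)) := by
        have := (measurable_spectralScale hΨm).comp
          (show Measurable fun p : ((((Fin (n + 1) → ℝ) × (Fin n → ℝ)) × ℝ) × ℝ) × ℝ => p.1.1 by
            fun_prop)
        exact this.prodMk (by fun_prop)
      have hT4 : Measurable fun p : ((Fin (n + 1) → ℝ) × (Fin (n + 1) → ℝ)) × (ℝ × ℝ) =>
          (F (Fin.cons p.2.1 p.1.2, p.1.1),
            p.2.2 • zeroWeight (F (Fin.cons p.2.1 p.1.2, p.1.1)) p.1.1) := by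
        have e1 : Measurable fun p : ((Fin (n + 1) → ℝ) × (Fin (n + 1) → ℝ)) × (ℝ × ℝ) =>
            S (p.1, p.2.1) := hSm.comp (by fun_prop)
        have e2 : Measurable fun p : ((Fin (n + 1) → ℝ) × (Fin (n + 1) → ℝ)) × (ℝ × ℝ) =>
            p.2.2 := by fun_prop
        exact (measurable_fst.comp e1).prodMk (e2.smul (measurable_snd.comp e1))
      rw [mul_comm c, ENNReal.ofReal_mul (stepConst_pos hk).le, mul_comm, mul_smul, ← h2,
        ← Measure.map_smul, ← h3, Measure.map_map hT4 hT3]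
      -- The entry √s squares back to s only where s ≥ 0, so the two maps agree almost everywhere.
      refine Measure.map_congr ?_
      have hpos : ∀ᵐ p ∂((((jacobiLaw β n).prod Γ₁).prod N).prod Γ₂), 0 < p.1.1.2 :=
        Measure.quasiMeasurePreserving_fst.ae (Measure.quasiMeasurePreserving_fst.ae
          (Measure.quasiMeasurePreserving_snd.ae (gammaMeasure_pos_ae _)))
      filter_upwards [hpos] with ⟨⟨⟨x, s⟩, a⟩, s'⟩ hp
      simp only [Function.comp_apply, Prod.map_apply, id_eq, jacobiCons, hS, hU, Fin.tail_cons,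
        Fin.cons_zero, Real.sq_sqrt hp.le]

end RankOne
end

noncomputable section

namespace RankOne

open Finset
open scoped ENNReal

variable {n : ℕ}

/-! ### Exponential moments of the gamma distribution -/

theorem integral_gammaMeasure {E : Type*} [NormedAddCommGroup E] [NormedSpace ℝ E] {k : ℝ}
    (hk : 0 < k) (f : ℝ → E) :
    ∫ x, f x ∂gammaMeasure k 1 = ∫ x in Set.Ioi 0, gammaDensity k x • f x := by
  rw [gammaMeasure_eq, integral_withDensity_eq_integral_toReal_smul
    (measurable_gammaDensity k).ennreal_ofReal
    (Eventually.of_forall fun _ => ENNReal.ofReal_lt_top)]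
  exact setIntegral_congr_fun measurableSet_Ioi fun x hx => by
    simp only [ENNReal.toReal_ofReal (gammaDensity_nonneg hk hx)]

theorem integral_exp_gamma {k : ℝ} (hk : 0 < k) {t : ℝ} (ht : t < 1) :
    ∫ x, Real.exp (t * x) ∂gammaMeasure k 1 = (1 - t) ^ (-k) := by
  have hΓ := (Real.Gamma_pos_of_pos hk).ne'
  have ht' : 0 < 1 - t := by linarith
  rw [integral_gammaMeasure hk]
  have h1 : ∀ x : ℝ, gammaDensity k x • Real.exp (t * x) =
      (Real.Gamma k)⁻¹ * (x ^ (k - 1) * Real.exp (-((1 - t) * x))) := fun x => by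
    rw [gammaDensity, smul_eq_mul, mul_assoc, ← Real.exp_add, mul_assoc]
    ring_nf
  simp only [h1]
  rw [integral_const_mul, Real.integral_rpow_mul_exp_neg_mul_Ioi hk ht', one_div,
    Real.inv_rpow ht'.le, Real.rpow_neg ht'.le]
  field_simp

/-- A nonintegrable function has Bochner integral 0, whereas the value already computed is positive.
-/
theorem integrable_exp_gamma {k : ℝ} (hk : 0 < k) {t : ℝ} (ht : t < 1) :
    Integrable (fun x => Real.exp (t * x)) (gammaMeasure k 1) := by
  by_contra h
  have h1 := integral_exp_gamma hk ht
  rw [integral_undef h] at h1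
  exact (Real.rpow_pos_of_pos (by linarith) (-k)).ne h1

theorem mem_interior_integrableExpSet {k : ℝ} (hk : 0 < k) {t : ℝ} (ht : t < 1) :
    t ∈ interior (integrableExpSet id (gammaMeasure k 1)) := by
  have : Set.Iio 1 ⊆ integrableExpSet id (gammaMeasure k 1) := fun u hu =>
    integrable_exp_gamma hk hu
  exact interior_mono this (by rwa [isOpen_Iio.interior_eq])

theorem one_sub_mem_slitPlane {z : ℂ} (hz : z.re < 1) : 1 - z ∈ Complex.slitPlane := by
  left; simp; exact hz

theorem hasDerivAt_one_sub_cpow (k : ℝ) {z : ℂ} (hz : z.re < 1) :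
    HasDerivAt (fun z : ℂ => (1 - z) ^ (-k : ℂ)) (k * (1 - z) ^ (-k - 1 : ℂ)) z := by
  have h1 : HasDerivAt (fun z : ℂ => 1 - z) (-1) z := (hasDerivAt_id z).const_sub 1
  have h2 := h1.cpow_const (c := (-k : ℂ)) (one_sub_mem_slitPlane hz)
  convert h2 using 1
  ring

/-- Both sides are analytic on the half plane Re z < 1 and agree at real points near 0, so the
identity theorem applies. -/
theorem complexMGF_gamma {k : ℝ} (hk : 0 < k) {z : ℂ} (hz : z.re < 1) :
    complexMGF id (gammaMeasure k 1) z = (1 - z) ^ (-k : ℂ) := by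
  set U : Set ℂ := {z | z.re < 1}
  have hU : IsOpen U := isOpen_lt Complex.continuous_re continuous_const
  have hf : AnalyticOnNhd ℂ (complexMGF id (gammaMeasure k 1)) U :=
    analyticOnNhd_complexMGF.mono fun z hz => mem_interior_integrableExpSet hk hz
  have hg : AnalyticOnNhd ℂ (fun z : ℂ => (1 - z) ^ (-k : ℂ)) U :=
    DifferentiableOn.analyticOnNhd
      (fun z hz => (hasDerivAt_one_sub_cpow k hz).differentiableAt.differentiableWithinAt) hU
  have hpre : IsPreconnected U := (convex_halfSpace_re_lt 1).isPreconnected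
  refine hf.eqOn_of_preconnected_of_frequently_eq hg hpre (z₀ := 0) (by simp [U]) ?_ hz
  have ht : Tendsto (fun t : ℝ => (t : ℂ)) (𝓝[≠] 0) (𝓝[≠] 0) := by
    refine tendsto_nhdsWithin_iff.mpr ⟨?_, ?_⟩
    · exact (Complex.continuous_ofReal.tendsto' 0 0 (by simp)).mono_left nhdsWithin_le_nhds
    · filter_upwards [self_mem_nhdsWithin] with t ht
      simpa using ht
  refine ht.frequently (Eventually.frequently ?_)
  have : ∀ᶠ t : ℝ in 𝓝[≠] 0, t < 1 :=
    (eventually_lt_nhds one_pos).filter_mono nhdsWithin_le_nhds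
  filter_upwards [this] with t ht
  rw [complexMGF_ofReal, mgf]
  simp only [id_eq]
  rw [integral_exp_gamma hk ht, Complex.ofReal_cpow (by linarith)]
  push_cast
  rfl

theorem integral_cexp_gamma {k : ℝ} (hk : 0 < k) {z : ℂ} (hz : z.re < 1) :
    ∫ x : ℝ, Complex.exp (z * x) ∂gammaMeasure k 1 = (1 - z) ^ (-k : ℂ) := by
  rw [← complexMGF_gamma hk hz]; rfl

theorem integral_mul_cexp_gamma {k : ℝ} (hk : 0 < k) {z : ℂ} (hz : z.re < 1) :
    ∫ x : ℝ, x * Complex.exp (z * x) ∂gammaMeasure k 1 = k * (1 - z) ^ (-k - 1 : ℂ) := by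
  have h1 := hasDerivAt_complexMGF (X := id) (μ := gammaMeasure k 1)
    (mem_interior_integrableExpSet hk hz)
  have h2 : complexMGF id (gammaMeasure k 1) =ᶠ[𝓝 z] fun z : ℂ => (1 - z) ^ (-k : ℂ) := by
    filter_upwards [(isOpen_lt Complex.continuous_re continuous_const).mem_nhds hz] with w hw
    exact complexMGF_gamma hk hw
  exact (h1.congr_of_eventuallyEq h2.symm).unique (hasDerivAt_one_sub_cpow k hz)

theorem cpow_ne_zero_of_re_lt {z w : ℂ} (hz : z.re < 1) : (1 - z) ^ w ≠ 0 := by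
  rw [Complex.cpow_ne_zero_iff]
  left
  exact Complex.slitPlane_ne_zero (one_sub_mem_slitPlane hz)

theorem integrable_cexp_gamma {k : ℝ} (hk : 0 < k) {z : ℂ} (hz : z.re < 1) :
    Integrable (fun x : ℝ => Complex.exp (z * x)) (gammaMeasure k 1) := by
  by_contra h
  have h1 := integral_cexp_gamma hk hz
  rw [integral_undef h] at h1
  exact cpow_ne_zero_of_re_lt hz h1.symm

theorem integrable_mul_cexp_gamma {k : ℝ} (hk : 0 < k) {z : ℂ} (hz : z.re < 1) :
    Integrable (fun x : ℝ => x * Complex.exp (z * x)) (gammaMeasure k 1) := by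
  by_contra h
  have h1 := integral_mul_cexp_gamma hk hz
  rw [integral_undef h] at h1
  exact mul_ne_zero (by exact_mod_cast hk.ne') (cpow_ne_zero_of_re_lt hz) h1.symm

/-- The logarithmic derivative form of `-(d/ds) ∏ (s - a j) ^ (-k)`. -/
def resolventSum (k : ℝ) (a : Fin (n + 1) → ℝ) (s : ℂ) : ℂ :=
  ∑ j, k * (s - a j) ^ (-k - 1 : ℂ) * ∏ i ∈ univ.erase j, (s - a i) ^ (-k : ℂ)

/-- The summand 1 in the exponent cancels the factor exp(-x) of the gamma density, which leaves a
Laplace transform at `s`. The coordinates are independent, and the factor `g j` differentiates the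
j-th factor. -/
theorem integral_sum_gammaPi {k : ℝ} (hk : 0 < k) {a : Fin (n + 1) → ℝ} {s : ℂ}
    (hs : ∀ j, a j < s.re) :
    Integrable (fun g : Fin (n + 1) → ℝ => ∑ j, (g j : ℂ) * ∏ i, Complex.exp ((1 - s + a i) * g i))
      (gammaPi k (n + 1)) ∧
    ∫ g : Fin (n + 1) → ℝ, ∑ j, (g j : ℂ) * ∏ i, Complex.exp ((1 - s + a i) * g i)
      ∂gammaPi k (n + 1) = resolventSum k a s := by
  have := isProbabilityMeasure_gammaMeasure hk one_pos
  have hre : ∀ i, (1 - s + a i).re < 1 := fun i => by simp; linarith [hs i]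
  have hfac : ∀ i, 1 - (1 - s + (a i : ℂ)) = s - a i := fun i => by ring
  let φ : Fin (n + 1) → Fin (n + 1) → ℝ → ℂ := fun j i x =>
    if i = j then x * Complex.exp ((1 - s + a i) * x) else Complex.exp ((1 - s + a i) * x)
  have hφ : ∀ j (g : Fin (n + 1) → ℝ),
      (g j : ℂ) * ∏ i, Complex.exp ((1 - s + a i) * g i) = ∏ i, φ j i (g i) := fun j g => by
    rw [← Finset.mul_prod_erase univ (fun i => φ j i (g i)) (mem_univ j),
      ← Finset.mul_prod_erase univ (fun i => Complex.exp ((1 - s + a i) * g i)) (mem_univ j),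
      ← mul_assoc]
    congr 1
    · simp [φ]
    · exact Finset.prod_congr rfl fun i hi => by simp [φ, Finset.ne_of_mem_erase hi]
  have hφi : ∀ j i, Integrable (φ j i) (gammaMeasure k 1) := fun j i => by
    simp only [φ]
    split_ifs
    · exact integrable_mul_cexp_gamma hk (hre i)
    · exact integrable_cexp_gamma hk (hre i)
  have hI : ∀ j, Integrable (fun g : Fin (n + 1) → ℝ => ∏ i, φ j i (g i)) (gammaPi k (n + 1)) :=
    fun j => Integrable.fintype_prod fun i => hφi j i
  simp only [hφ]
  refine ⟨integrable_finsetSum _ fun j _ => hI j, ?_⟩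
  rw [integral_finsetSum _ fun j _ => hI j, resolventSum]
  refine Finset.sum_congr rfl fun j _ => ?_
  rw [gammaPi, integral_fintype_prod_eq_prod (φ j), ← Finset.mul_prod_erase univ _ (mem_univ j)]
  congr 1
  · simp only [φ, if_true]
    rw [integral_mul_cexp_gamma hk (hre j), hfac]
  · refine Finset.prod_congr rfl fun i hi => ?_
    simp only [φ, if_neg (Finset.ne_of_mem_erase hi)]
    rw [integral_cexp_gamma hk (hre i), hfac]

/-! ### The Dirichlet distribution -/

/-- The Dirichlet distribution: independent gamma variables are the product of their sum,
which has a gamma distribution, and of an independent point of the simplex. -/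
theorem exists_dirichlet {k : ℝ} (hk : 0 < k) (n : ℕ) :
    ∃ D : Measure (Fin (n + 1) → ℝ), IsProbabilityMeasure D ∧
      (∀ᵐ w ∂D, (∀ i, 0 < w i) ∧ ∑ i, w i = 1) ∧
      MeasurePreserving (fun p : (Fin (n + 1) → ℝ) × ℝ => p.2 • p.1)
        (D.prod (gammaMeasure (((n : ℝ) + 1) * k) 1)) (gammaPi k (n + 1)) := by
  have hβ : 0 < 2 * k := by positivity
  -- The weights of the random Jacobi matrix with β = 2k already have the required law: scaled by
  -- the gamma variable, they are independent gamma variables up to a constant.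
  obtain ⟨Ψ, hm, hs, c, hc, hmap⟩ := exists_isSpectralMap hβ n
  rw [show 2 * k / 2 = k by ring] at hmap
  have hnk : 0 < ((n : ℝ) + 1) * k := by positivity
  have := isProbabilityMeasure_gammaMeasure hnk one_pos
  have := isProbabilityMeasure_jacobiLaw hβ n
  have := isProbabilityMeasure_gammaPi hk (n + 1)
  set Γ := gammaMeasure (((n : ℝ) + 1) * k) 1
  have hwm : Measurable fun x => (Ψ x).2 := measurable_snd.comp hm
  have hD : IsProbabilityMeasure ((jacobiLaw (2 * k) n).map fun x => (Ψ x).2) :=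
    Measure.isProbabilityMeasure_map hwm.aemeasurable
  have hsm : Measurable fun p : (Fin (n + 1) → ℝ) × ℝ => p.2 • p.1 :=
    measurable_snd.smul measurable_fst
  refine ⟨(jacobiLaw (2 * k) n).map fun x => (Ψ x).2, hD, ?_, hsm, ?_⟩
  · have hset : MeasurableSet {w : Fin (n + 1) → ℝ | (∀ i, 0 < w i) ∧ ∑ i, w i = 1} :=
      measurableSet_pos.inter (measurableSet_eq_fun
        (show Measurable fun w : Fin (n + 1) → ℝ => ∑ i, w i by fun_prop) measurable_const)
    rw [ae_map_iff hwm.aemeasurable hset]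
    filter_upwards [hs] with x hx
    exact ⟨hx.pos, hx.sum_weight⟩
  · have h1 : MeasurePreserving (fun x => (Ψ x).2) (jacobiLaw (2 * k) n)
      ((jacobiLaw (2 * k) n).map fun x => (Ψ x).2) := ⟨hwm, rfl⟩
    have h2 := (h1.prod (MeasurePreserving.id Γ)).map_eq
    have h3 := congrArg (Measure.map Prod.snd) hmap
    rw [Measure.map_map measurable_snd (measurable_spectralScale hm), Measure.map_smul,
      Measure.map_snd_prod] at h3
    have h4 : Measure.map (fun p : (Fin (n + 1) → ℝ) × ℝ => p.2 • p.1)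
        (((jacobiLaw (2 * k) n).map fun x => (Ψ x).2).prod Γ) =
        (ENNReal.ofReal c * eigenMeasure k (n + 1) Set.univ) • gammaPi k (n + 1) := by
      rw [← h2, Measure.map_map hsm (h1.prod (MeasurePreserving.id Γ)).measurable, mul_smul, ← h3]
      rfl
    -- Both measures are probability measures, so comparing total masses shows that the constant is
    -- 1.
    have h5 := congrArg (fun μ => μ Set.univ) h4
    have : IsProbabilityMeasure (Measure.map (fun p : (Fin (n + 1) → ℝ) × ℝ => p.2 • p.1)
        (((jacobiLaw (2 * k) n).map fun x => (Ψ x).2).prod Γ)) :=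
      Measure.isProbabilityMeasure_map hsm.aemeasurable
    simp only [measure_univ, Measure.smul_apply, smul_eq_mul, mul_one] at h5
    rw [h4, ← h5, one_smul]

end RankOne
end

noncomputable section

namespace RankOne

open Finset
open scoped ENNReal FourierTransform

variable {n : ℕ}

/-! ### The contour integral -/

section LineIntegral

variable {k c : ℝ} {a : Fin (n + 1) → ℝ}

/-- The Laplace transform of the Dirichlet exponential moments. -/
theorem integral_dirichlet_resolventSum (hk : 0 < k) {D : Measure (Fin (n + 1) → ℝ)}
    [IsProbabilityMeasure D] (hD : ∀ᵐ w ∂D, (∀ i, 0 < w i) ∧ ∑ i, w i = 1)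
    (hmap : MeasurePreserving (fun p : (Fin (n + 1) → ℝ) × ℝ => p.2 • p.1)
      (D.prod (gammaMeasure (((n : ℝ) + 1) * k) 1)) (gammaPi k (n + 1))) {s : ℂ}
    (hs : ∀ j, a j < s.re) :
    Integrable (fun r : ℝ => r * Complex.exp ((1 - s) * r) *
      ∫ w, Complex.exp (r * ∑ i, (a i : ℂ) * w i) ∂D) (gammaMeasure (((n : ℝ) + 1) * k) 1) ∧
    ∫ r : ℝ, r * Complex.exp ((1 - s) * r) * ∫ w, Complex.exp (r * ∑ i, (a i : ℂ) * w i) ∂D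
      ∂gammaMeasure (((n : ℝ) + 1) * k) 1 = resolventSum k a s := by
  have hnk : 0 < ((n : ℝ) + 1) * k := by positivity
  have := isProbabilityMeasure_gammaMeasure hnk one_pos
  obtain ⟨hI, hR⟩ := integral_sum_gammaPi hk hs
  set Q : (Fin (n + 1) → ℝ) → ℂ := fun g =>
    ∑ j, (g j : ℂ) * ∏ i, Complex.exp ((1 - s + a i) * g i) with hQ
  have hI' : Integrable (fun p : (Fin (n + 1) → ℝ) × ℝ => Q (p.2 • p.1))
      (D.prod (gammaMeasure (((n : ℝ) + 1) * k) 1)) :=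
    (hmap.integrable_comp hI.aestronglyMeasurable).mpr hI
  -- For g = r w with ∑ w_i = 1, the sum of the g_j is r, and the exponentials combine into one
  -- exponential in r and one in w.
  have hinner : ∀ r : ℝ, ∫ w, Q (r • w) ∂D =
      r * Complex.exp ((1 - s) * r) * ∫ w, Complex.exp (r * ∑ i, (a i : ℂ) * w i) ∂D := fun r => by
    rw [← integral_const_mul]
    refine integral_congr_ae ?_
    filter_upwards [hD] with w hw
    have hw1 : ∑ i, (w i : ℂ) = 1 := by exact_mod_cast hw.2
    have e1 : ∏ i, Complex.exp ((1 - s + a i) * ((r • w) i : ℝ)) =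
        Complex.exp ((1 - s) * r) * Complex.exp (r * ∑ i, (a i : ℂ) * w i) := by
      rw [← Complex.exp_sum, ← Complex.exp_add]
      congr 1
      have : (1 - s) * r = ∑ i, (1 - s) * r * (w i : ℂ) := by rw [← Finset.mul_sum, hw1, mul_one]
      rw [this, Finset.mul_sum, ← Finset.sum_add_distrib]
      refine Finset.sum_congr rfl fun i _ => ?_
      simp only [Pi.smul_apply, smul_eq_mul, Complex.ofReal_mul]
      ring
    simp only [hQ]
    rw [← Finset.sum_mul, e1]
    have e2 : ∑ j, (((r • w) j : ℝ) : ℂ) = r := by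
      simp only [Pi.smul_apply, smul_eq_mul, Complex.ofReal_mul]
      rw [← Finset.mul_sum, hw1, mul_one]
    rw [e2]
    ring
  refine ⟨?_, ?_⟩
  · have h1 := hI'.integral_prod_right
    simp only [hinner] at h1
    exact h1
  · have h1 := integral_prod_symm _ hI'
    simp only [hinner] at h1
    rw [← h1, ← hR, ← hmap.map_eq, integral_map hmap.measurable.aemeasurable]
    rw [hmap.map_eq]
    exact hI.aestronglyMeasurable

theorem line_mem_slitPlane (hc : ∀ j, a j < c) (x : ℝ) (j : Fin (n + 1)) :
    (c + x * Complex.I - a j : ℂ) ∈ Complex.slitPlane := by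
  left; simp; exact hc j

theorem hasDerivAt_prod_cpow (hc : ∀ j, a j < c) (x : ℝ) :
    HasDerivAt (fun x : ℝ => ∏ j, (c + x * Complex.I - a j : ℂ) ^ (-k : ℂ))
      (-Complex.I * resolventSum k a (c + x * Complex.I)) x := by
  have h1 : ∀ j ∈ (univ : Finset (Fin (n + 1))),
      HasDerivAt (fun x : ℝ => (c + x * Complex.I - a j : ℂ) ^ (-k : ℂ))
      (-k * (c + x * Complex.I - a j : ℂ) ^ (-k - 1 : ℂ) * Complex.I) x := fun j _ => by
    have h2 : HasDerivAt (fun z : ℂ => c + z * Complex.I - a j) Complex.I (x : ℂ) := by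
      simpa using (((hasDerivAt_id (x : ℂ)).mul_const Complex.I).const_add (c : ℂ)).sub_const
        (a j : ℂ)
    exact (h2.cpow_const (line_mem_slitPlane hc x j)).comp_ofReal
  refine (HasDerivAt.fun_finsetProd h1).congr_deriv ?_
  rw [resolventSum, Finset.mul_sum]
  refine Finset.sum_congr rfl fun j _ => ?_
  rw [smul_eq_mul]
  ring

theorem exists_norm_line_ge (hc : ∀ j, a j < c) :
    ∃ η : ℝ, 0 < η ∧ ∀ (x : ℝ) (j : Fin (n + 1)), η * (1 + |x|) ≤ ‖(c + x * Complex.I - a j : ℂ)‖ := by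
  obtain ⟨δ, hδ, hδc⟩ : ∃ δ : ℝ, 0 < δ ∧ ∀ j, δ ≤ c - a j := by
    obtain ⟨j0, hj0⟩ := Finite.exists_min fun j => c - a j
    exact ⟨c - a j0, sub_pos.mpr (hc j0), hj0⟩
  -- The modulus is at least δ and at least |x|, hence at least half their sum, which dominates (min
  -- δ 1 / 2)(1 + |x|).
  refine ⟨min δ 1 / 2, by positivity, fun x j => ?_⟩
  have h1 : c - a j ≤ ‖(c + x * Complex.I - a j : ℂ)‖ := by
    have := Complex.re_le_norm (c + x * Complex.I - a j : ℂ)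
    simpa using this
  have h2 : |x| ≤ ‖(c + x * Complex.I - a j : ℂ)‖ := by
    have := Complex.abs_im_le_norm (c + x * Complex.I - a j : ℂ)
    simpa using this
  have h3 : min δ 1 ≤ δ := min_le_left _ _
  have h4 : min δ 1 * |x| ≤ 1 * |x| := mul_le_mul_of_nonneg_right (min_le_right _ _) (abs_nonneg _)
  have := hδc j
  linarith

theorem norm_prod_cpow_le (hk : 0 < k) {η : ℝ} (hη : 0 < η)
    (h : ∀ (x : ℝ) (j : Fin (n + 1)), η * (1 + |x|) ≤ ‖(c + x * Complex.I - a j : ℂ)‖) (x : ℝ)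
    (s : Finset (Fin (n + 1))) :
    ‖∏ j ∈ s, (c + x * Complex.I - a j : ℂ) ^ (-k : ℂ)‖ ≤ ((η * (1 + |x|)) ^ (-k)) ^ #s := by
  rw [norm_prod, ← Finset.prod_const]
  refine Finset.prod_le_prod (fun _ _ => norm_nonneg _) fun j _ => ?_
  rw [show (-k : ℂ) = ((-k : ℝ) : ℂ) by push_cast; rfl, Complex.norm_cpow_real]
  exact Real.rpow_le_rpow_of_nonpos (by positivity) (h x j) (by linarith)

/-- In each term one factor has exponent -k - 1 and n factors have exponent -k. The total decay of
order 1 + k(n + 1) is integrable for every k > 0, whereas the product itself only has order k(n +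
1). -/
theorem integrable_resolventSum (hk : 0 < k) (hc : ∀ j, a j < c) :
    Integrable fun x : ℝ => resolventSum k a (c + x * Complex.I) := by
  obtain ⟨η, hη, h⟩ := exists_norm_line_ge hc
  have hcont : Continuous fun x : ℝ => resolventSum k a (c + x * Complex.I) := by
    unfold resolventSum
    refine continuous_finsetSum _ fun j _ => (continuous_const.mul ?_).mul
      (continuous_finsetProd _ fun i _ => ?_)
    · exact Continuous.cpow (by fun_prop) continuous_const fun x => line_mem_slitPlane hc x j
    · exact Continuous.cpow (by fun_prop) continuous_const fun x => line_mem_slitPlane hc x i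
  have hdom : Integrable fun x : ℝ => ((n : ℝ) + 1) * (k * (η ^ (-(k + 1)) * (η ^ (-k)) ^ n)) *
      (1 + ‖x‖) ^ (-(1 + k * (n + 1))) := by
    refine (integrable_one_add_norm ?_).const_mul _
    simp only [Module.finrank_self, Nat.cast_one]
    have : 0 < k * ((n : ℝ) + 1) := by positivity
    linarith
  refine hdom.mono' hcont.aestronglyMeasurable (Eventually.of_forall fun x => ?_)
  unfold resolventSum
  refine (norm_sum_le _ _).trans ?_
  have hx : 0 < 1 + |x| := by positivity
  have hterm : ∀ j ∈ (univ : Finset (Fin (n + 1))),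
      ‖(k : ℂ) * (c + x * Complex.I - a j : ℂ) ^ (-k - 1 : ℂ) *
        ∏ i ∈ univ.erase j, (c + x * Complex.I - a i : ℂ) ^ (-k : ℂ)‖ ≤
      k * (η ^ (-(k + 1)) * (η ^ (-k)) ^ n) * (1 + ‖x‖) ^ (-(1 + k * (n + 1))) := fun j _ => by
    rw [norm_mul, norm_mul, Complex.norm_real, Real.norm_of_nonneg hk.le]
    have h1 : ‖(c + x * Complex.I - a j : ℂ) ^ (-k - 1 : ℂ)‖ ≤ (η * (1 + |x|)) ^ (-(k + 1)) := by
      rw [show (-k - 1 : ℂ) = ((-(k + 1) : ℝ) : ℂ) by push_cast; ring, Complex.norm_cpow_real]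
      exact Real.rpow_le_rpow_of_nonpos (by positivity) (h x j) (by linarith)
    have h2 := norm_prod_cpow_le hk hη h x (univ.erase j)
    rw [Finset.card_erase_of_mem (mem_univ j), card_univ, Fintype.card_fin, Nat.add_sub_cancel] at h2
    have h3 := mul_le_mul (mul_le_mul_of_nonneg_left h1 hk.le) h2 (norm_nonneg _) (by positivity)
    refine h3.trans (le_of_eq ?_)
    have h4 : (1 + ‖x‖) ^ (-(1 + k * (n + 1))) = (1 + |x|) ^ (-(k + 1)) * ((1 + |x|) ^ (-k)) ^ n := by
      rw [Real.norm_eq_abs, ← Real.rpow_natCast, ← Real.rpow_mul hx.le, ← Real.rpow_add hx]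
      congr 1; ring
    rw [h4, Real.mul_rpow hη.le hx.le, Real.mul_rpow hη.le hx.le, mul_pow]
    ring
  refine (Finset.sum_le_sum hterm).trans (le_of_eq ?_)
  rw [Finset.sum_const, card_univ, Fintype.card_fin, nsmul_eq_mul]
  push_cast
  ring

theorem tendsto_prod_cpow (hk : 0 < k) (hc : ∀ j, a j < c) {ι : Type*} {L : Filter ι} {u : ι → ℝ}
    (hu : Tendsto (fun i => |u i|) L atTop) :
    Tendsto (fun i => Complex.exp (c + u i * Complex.I) *
      ∏ j, (c + u i * Complex.I - a j : ℂ) ^ (-k : ℂ)) L (𝓝 0) := by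
  obtain ⟨η, hη, h⟩ := exists_norm_line_ge hc
  have h1 : Tendsto (fun i => Real.exp c * ((η * (1 + |u i|)) ^ (-k)) ^ (n + 1)) L (𝓝 0) := by
    have h2 : Tendsto (fun i => η * (1 + |u i|)) L atTop :=
      (tendsto_atTop_add_const_left _ _ hu).const_mul_atTop hη
    have h3 := (((tendsto_rpow_neg_atTop hk).comp h2).pow (n + 1)).const_mul (Real.exp c)
    simpa using h3
  refine squeeze_zero_norm (fun i => ?_) h1
  rw [norm_mul, Complex.norm_exp]
  have h4 := norm_prod_cpow_le hk hη h (u i) univ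
  rw [card_univ, Fintype.card_fin] at h4
  simp only [Complex.add_re, Complex.ofReal_re, Complex.mul_re, Complex.I_re, mul_zero,
    Complex.ofReal_im, Complex.I_im, mul_one, sub_self, add_zero]
  gcongr

/-- Integration by parts: with E the exponential, G the product and G' = -iH, the derivative of -iEG
is EG - EH. The boundary terms vanish separately at the two ends, and EH is absolutely integrable.
-/
theorem tendsto_lineIntegral (hk : 0 < k) (hc : ∀ j, a j < c) :
    Tendsto (fun R : ℝ × ℝ => ∫ x in (-R.1)..R.2, Complex.exp (c + x * Complex.I) *
        ∏ j, (c + x * Complex.I - a j : ℂ) ^ (-k : ℂ)) (atTop ×ˢ atTop)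
      (𝓝 (∫ x : ℝ, Complex.exp (c + x * Complex.I) * resolventSum k a (c + x * Complex.I))) := by
  set G : ℝ → ℂ := fun x => ∏ j, (c + x * Complex.I - a j : ℂ) ^ (-k : ℂ) with hG
  set E : ℝ → ℂ := fun x => Complex.exp (c + x * Complex.I) with hE
  set H : ℝ → ℂ := fun x => resolventSum k a (c + x * Complex.I) with hH
  have hEd : ∀ x, HasDerivAt E (E x * Complex.I) x := fun x => by
    have h2 : HasDerivAt (fun z : ℂ => c + z * Complex.I) Complex.I (x : ℂ) := by
      simpa using (((hasDerivAt_id (x : ℂ)).mul_const Complex.I).const_add (c : ℂ))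
    exact h2.cexp.comp_ofReal
  have hGd : ∀ x, HasDerivAt G (-Complex.I * H x) x := fun x => hasDerivAt_prod_cpow hc x
  have hEc : Continuous E := continuous_iff_continuousAt.mpr fun x => (hEd x).continuousAt
  have hGc : Continuous G := continuous_iff_continuousAt.mpr fun x => (hGd x).continuousAt
  have hHi : Integrable H := integrable_resolventSum hk hc
  have hEHi : Integrable fun x => E x * H x := by
    refine hHi.bdd_mul (c := Real.exp c) hEc.aestronglyMeasurable (Eventually.of_forall fun x => ?_)
    simp only [hE]
    rw [Complex.norm_exp]
    simp
  have hd : ∀ x, HasDerivAt (fun x => -Complex.I * (E x * G x)) (E x * G x - E x * H x) x :=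
    fun x => by
      refine (((hEd x).mul (hGd x)).const_mul (-Complex.I)).congr_deriv ?_
      have := Complex.I_mul_I
      linear_combination (-E x * G x + E x * H x) * this
  have hEGi : ∀ u v : ℝ, IntervalIntegrable (fun x => E x * G x) volume u v := fun u v =>
    (hEc.mul hGc).intervalIntegrable u v
  have hparts : ∀ u v : ℝ, ∫ x in u..v, E x * G x =
      (-Complex.I * (E v * G v) - -Complex.I * (E u * G u)) + ∫ x in u..v, E x * H x := fun u v => by
    have h1 := intervalIntegral.integral_eq_sub_of_hasDerivAt (a := u) (b := v)
      (fun x _ => hd x) ((hEGi u v).sub hEHi.intervalIntegrable)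
    rw [intervalIntegral.integral_sub (hEGi u v) hEHi.intervalIntegrable] at h1
    rw [← h1]; ring
  change Tendsto (fun R : ℝ × ℝ => ∫ x in (-R.1)..R.2, E x * G x) (atTop ×ˢ atTop)
    (𝓝 (∫ x, E x * H x))
  simp only [hparts]
  have ht1 : Tendsto (fun R : ℝ × ℝ => -R.1) (atTop ×ˢ atTop) atBot :=
    tendsto_neg_atTop_atBot.comp tendsto_fst
  have ht2 : Tendsto (fun R : ℝ × ℝ => R.2) (atTop ×ˢ atTop) atTop := tendsto_snd
  have hb1 := tendsto_prod_cpow (a := a) hk hc (tendsto_abs_atBot_atTop.comp ht1)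
  have hb2 := tendsto_prod_cpow (a := a) hk hc (tendsto_abs_atTop_atTop.comp ht2)
  have h3 := intervalIntegral_tendsto_integral hEHi ht1 ht2
  have h4 := ((hb2.const_mul (-Complex.I)).sub (hb1.const_mul (-Complex.I))).add h3
  rw [mul_zero, sub_self, zero_add] at h4
  exact h4

/-- On the line, `resolventSum` is the Fourier transform of a function ψ on the half line, in which
the Dirichlet moment at scale r is weighted by the gamma density. Inversion at r = 1 gives the
moment itself; the exponentials there multiply to exp(-c), which cancels the constant exp(c). -/
theorem integral_exp_resolventSum (hk : 0 < k) (hc : ∀ j, a j < c) {D : Measure (Fin (n + 1) → ℝ)}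
    [IsProbabilityMeasure D] (hD : ∀ᵐ w ∂D, (∀ i, 0 < w i) ∧ ∑ i, w i = 1)
    (hmap : MeasurePreserving (fun p : (Fin (n + 1) → ℝ) × ℝ => p.2 • p.1)
      (D.prod (gammaMeasure (((n : ℝ) + 1) * k) 1)) (gammaPi k (n + 1))) :
    ∫ x : ℝ, Complex.exp (c + x * Complex.I) * resolventSum k a (c + x * Complex.I) =
      2 * Real.pi * ((Real.Gamma (((n : ℝ) + 1) * k))⁻¹ : ℝ) *
        ∫ w, Complex.exp (∑ i, (a i : ℂ) * w i) ∂D := by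
  have hnk : 0 < ((n : ℝ) + 1) * k := by positivity
  set M : ℝ → ℂ := fun r => ∫ w, Complex.exp (r * ∑ i, (a i : ℂ) * w i) ∂D with hM
  set ψ : ℝ → ℂ := (Set.Ioi 0).indicator fun r : ℝ => gammaDensity (((n : ℝ) + 1) * k) r •
    (r * Complex.exp ((1 - c) * r) * M r) with hψ
  have hpair : ∀ x : ℝ, ∫ r : ℝ, Complex.exp (-(x * r) * Complex.I) * ψ r =
      resolventSum k a (c + x * Complex.I) := fun x => by
    have h1 := (integral_dirichlet_resolventSum (a := a) (s := c + x * Complex.I) hk hD hmap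
      (by simpa using hc)).2
    rw [integral_gammaMeasure hnk, ← integral_indicator measurableSet_Ioi] at h1
    rw [← h1]
    refine integral_congr_ae (Eventually.of_forall fun r => ?_)
    simp only [hψ, Set.indicator_apply]
    split_ifs
    · rw [Complex.real_smul, Complex.real_smul]
      have : Complex.exp ((1 - (c + x * Complex.I)) * r) =
          Complex.exp (-(x * r) * Complex.I) * Complex.exp ((1 - c) * r) := by
        rw [← Complex.exp_add]; congr 1; ring
      rw [this]
      ring
    · simp
  have hψi : Integrable ψ := by
    have h1 := (integral_dirichlet_resolventSum (a := a) (s := c) hk hD hmap (by simpa using hc)).1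
    rw [gammaMeasure_eq, integrable_withDensity_iff_integrable_smul'
      (measurable_gammaDensity _).ennreal_ofReal
      (Eventually.of_forall fun _ => ENNReal.ofReal_lt_top)] at h1
    refine (integrable_indicator_iff measurableSet_Ioi).mpr ?_
    refine IntegrableOn.congr_fun h1 (fun r hr => ?_) measurableSet_Ioi
    simp only [ENNReal.toReal_ofReal (gammaDensity_nonneg hnk hr)]
    rfl
  -- Pointwise inversion needs continuity at 1 only. For |r| < 2 the integrand is bounded by a
  -- constant because the weights lie in the simplex.
  have hMc : ContinuousAt M 1 := by
    refine continuousAt_of_dominated (bound := fun _ => Real.exp (2 * ∑ i, |a i|)) ?_ ?_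
      (integrable_const _) ?_
    · refine Eventually.of_forall fun r => Measurable.aestronglyMeasurable ?_
      fun_prop
    · have : ∀ᶠ r : ℝ in 𝓝 1, |r| < 2 :=
        (continuous_abs.tendsto' (1 : ℝ) 1 (by simp)).eventually (gt_mem_nhds one_lt_two)
      filter_upwards [this] with r hr
      filter_upwards [hD] with w hw
      rw [Complex.norm_exp]
      refine Real.exp_le_exp.mpr ?_
      have e1 : ((r : ℂ) * ∑ i, (a i : ℂ) * w i).re = r * ∑ i, a i * w i := by
        rw [← Complex.ofReal_re (r * ∑ i, a i * w i)]; push_cast; rfl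
      rw [e1]
      have e2 : |∑ i, a i * w i| ≤ ∑ i, |a i| := by
        refine (Finset.abs_sum_le_sum_abs _ _).trans (Finset.sum_le_sum fun i _ => ?_)
        rw [abs_mul, abs_of_pos (hw.1 i)]
        refine mul_le_of_le_one_right (abs_nonneg _) ?_
        rw [← hw.2]
        exact Finset.single_le_sum (fun i _ => (hw.1 i).le) (mem_univ i)
      refine (le_abs_self _).trans ?_
      rw [abs_mul]
      exact mul_le_mul hr.le e2 (abs_nonneg _) zero_le_two
    · exact Eventually.of_forall fun w => by fun_prop
  have hψc : ContinuousAt ψ 1 := by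
    have h1 : ContinuousAt (fun r : ℝ => gammaDensity (((n : ℝ) + 1) * k) r •
        (r * Complex.exp ((1 - c) * r) * M r)) 1 := by
      have h2 : ContinuousAt (fun r : ℝ => gammaDensity (((n : ℝ) + 1) * k) r) 1 := by
        unfold gammaDensity
        refine (continuousAt_const.mul ?_).mul (by fun_prop)
        exact Real.continuousAt_rpow_const _ _ (Or.inl one_ne_zero)
      have h3 : ContinuousAt (fun r : ℝ => (r : ℂ) * Complex.exp ((1 - c) * r)) 1 := by fun_prop
      exact h2.smul (h3.mul hMc)
    refine h1.congr ?_
    filter_upwards [lt_mem_nhds (zero_lt_one (α := ℝ))] with r hr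
    rw [hψ, Set.indicator_of_mem (Set.mem_Ioi.mpr hr)]
  have hF : ∀ ξ : ℝ, 𝓕 ψ ξ = resolventSum k a (c + ((2 * Real.pi * ξ : ℝ) : ℂ) * Complex.I) :=
    fun ξ => by
      rw [← hpair, Real.fourier_real_eq_integral_exp_smul]
      refine integral_congr_ae (Eventually.of_forall fun r => ?_)
      simp only [smul_eq_mul]
      congr 2
      push_cast
      ring
  have hpi : (2 * Real.pi) ≠ 0 := by positivity
  have hFi : Integrable (𝓕 ψ) := by
    have h1 := (integrable_resolventSum hk hc).comp_mul_left' hpi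
    refine h1.congr (Eventually.of_forall fun ξ => (hF ξ).symm)
  have hinv := hψi.fourierInv_fourier_eq hFi hψc
  rw [Real.fourierInv_eq'] at hinv
  -- Passing from the frequency ξ to x = 2πξ produces the factor 2π.
  have h5 := Measure.integral_comp_mul_left
    (fun x : ℝ => Complex.exp (x * Complex.I) * resolventSum k a (c + x * Complex.I)) (2 * Real.pi)
  have h6 : ∫ ξ : ℝ, Complex.exp (((2 * Real.pi * ξ : ℝ) : ℂ) * Complex.I) *
      resolventSum k a (c + ((2 * Real.pi * ξ : ℝ) : ℂ) * Complex.I) = ψ 1 := by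
    rw [← hinv]
    refine integral_congr_ae (Eventually.of_forall fun ξ => ?_)
    simp only [hF, smul_eq_mul]
    congr 2
    simp
  have hψ1 : ψ 1 = ((Real.Gamma (((n : ℝ) + 1) * k))⁻¹ : ℝ) * Complex.exp (-c) * M 1 := by
    rw [hψ, Set.indicator_of_mem (Set.mem_Ioi.mpr zero_lt_one), gammaDensity, Complex.real_smul]
    simp only [Real.one_rpow, mul_one, Complex.ofReal_one, one_mul]
    rw [Complex.ofReal_mul, Complex.ofReal_exp, mul_assoc, ← mul_assoc (Complex.exp _),
      ← Complex.exp_add, mul_assoc]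
    congr 3
    push_cast
    ring
  rw [h6, abs_of_pos (by positivity), hψ1, Complex.real_smul] at h5
  have h7 : ∫ x : ℝ, Complex.exp (c + x * Complex.I) * resolventSum k a (c + x * Complex.I) =
      Complex.exp c * ∫ x : ℝ, Complex.exp (x * Complex.I) *
        resolventSum k a (c + x * Complex.I) := by
    rw [← integral_const_mul]
    refine integral_congr_ae (Eventually.of_forall fun x => ?_)
    simp only
    rw [Complex.exp_add, mul_assoc]
  have hM1 : M 1 = ∫ w, Complex.exp (∑ i, (a i : ℂ) * w i) ∂D := by simp [hM]
  have hpi' : (2 * Real.pi : ℂ) ≠ 0 := by exact_mod_cast hpi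
  have h8 : ∫ x : ℝ, Complex.exp (x * Complex.I) * resolventSum k a (c + x * Complex.I) =
      2 * Real.pi * (((Real.Gamma (((n : ℝ) + 1) * k))⁻¹ : ℝ) * Complex.exp (-c) * M 1) := by
    rw [h5]
    push_cast
    rw [← mul_assoc, mul_inv_cancel₀ hpi', one_mul]
  rw [h7, h8, hM1]
  have h9 : Complex.exp c * Complex.exp (-c) = 1 := by rw [← Complex.exp_add]; simp
  linear_combination (2 * Real.pi * ((Real.Gamma (((n : ℝ) + 1) * k))⁻¹ : ℝ) *
    ∫ w, Complex.exp (∑ i, (a i : ℂ) * w i) ∂D) * h9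

/-- The exponential moment of the Dirichlet distribution with all parameters `k`, as a function of
the exponents, in terms of independent gamma variables. -/
def dirichletMoment (k : ℝ) (a : Fin (n + 1) → ℝ) : ℝ :=
  ∫ g, Real.exp ((∑ i, a i * g i) / ∑ i, g i) ∂gammaPi k (n + 1)

theorem dirichletMoment_nonneg (k : ℝ) (a : Fin (n + 1) → ℝ) : 0 ≤ dirichletMoment k a :=
  integral_nonneg fun _ => (Real.exp_pos _).le

/-- The exponent is invariant under scaling of g, so the gamma factor integrates out. -/
theorem dirichletMoment_eq (hk : 0 < k) (a : Fin (n + 1) → ℝ) {D : Measure (Fin (n + 1) → ℝ)}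
    [IsProbabilityMeasure D] (hD : ∀ᵐ w ∂D, (∀ i, 0 < w i) ∧ ∑ i, w i = 1)
    (hmap : MeasurePreserving (fun p : (Fin (n + 1) → ℝ) × ℝ => p.2 • p.1)
      (D.prod (gammaMeasure (((n : ℝ) + 1) * k) 1)) (gammaPi k (n + 1))) :
    ∫ w, Complex.exp (∑ i, (a i : ℂ) * w i) ∂D = (dirichletMoment k a : ℂ) := by
  have hnk : 0 < ((n : ℝ) + 1) * k := by positivity
  have := isProbabilityMeasure_gammaMeasure hnk one_pos
  have hm : Measurable fun g : Fin (n + 1) → ℝ => Real.exp ((∑ i, a i * g i) / ∑ i, g i) :=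
    (Measurable.div (by fun_prop) (by fun_prop)).exp
  rw [dirichletMoment, ← hmap.map_eq, integral_map hmap.measurable.aemeasurable
    hm.aestronglyMeasurable]
  have hae : (fun p : (Fin (n + 1) → ℝ) × ℝ =>
      Real.exp ((∑ i, a i * (p.2 • p.1) i) / ∑ i, (p.2 • p.1) i)) =ᵐ[D.prod
        (gammaMeasure (((n : ℝ) + 1) * k) 1)] fun p => Real.exp (∑ i, a i * p.1 i) := by
    filter_upwards [Measure.quasiMeasurePreserving_fst.ae hD,
      Measure.quasiMeasurePreserving_snd.ae (gammaMeasure_pos_ae _)] with p hp hp2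
    congr 1
    simp only [Pi.smul_apply, smul_eq_mul]
    rw [← Finset.mul_sum, hp.2, mul_one, div_eq_iff hp2.ne', Finset.sum_mul]
    exact Finset.sum_congr rfl fun i _ => by ring
  rw [integral_congr_ae hae, integral_fun_fst (fun w : Fin (n + 1) → ℝ => Real.exp (∑ i, a i * w i))]
  simp only [probReal_univ, one_smul]
  rw [← integral_complex_ofReal]
  refine integral_congr_ae (Eventually.of_forall fun w => ?_)
  simp

theorem hasLineIntegral_dirichletMoment (hk : 0 < k) (hc : ∀ j, a j < c) :
    HasLineIntegral (fun t => Complex.exp (Complex.I * t) *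
      ∏ j, (Complex.I * t - ((a j : ℝ) : ℂ)) ^ ((-k : ℝ) : ℂ)) c
      ((2 * Real.pi * (Real.Gamma (((n : ℝ) + 1) * k))⁻¹ * dirichletMoment k a : ℝ) : ℂ) := by
  obtain ⟨D, hDp, hD, hmap⟩ := exists_dirichlet hk n
  have h1 := tendsto_lineIntegral (a := a) hk hc
  rw [integral_exp_resolventSum hk hc hD hmap, dirichletMoment_eq hk a hD hmap] at h1
  unfold HasLineIntegral
  -- The variable s = it turns the horizontal line Im t = -c into the vertical line Re s = c.
  have e1 : ∀ x : ℝ, Complex.I * ((x : ℂ) - Complex.I * (c : ℂ)) = c + x * Complex.I := fun x => by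
    have := Complex.I_mul_I
    linear_combination -(c : ℂ) * this
  simp only [e1]
  push_cast at h1 ⊢
  exact h1

end LineIntegral

end RankOne
end

noncomputable section

namespace RankOne

open Finset
open scoped ENNReal

/-! ### The eigenvalue density of the tridiagonal model -/

section Tridiagonal

variable {n : ℕ}

/-- The quotient of two Gaussian densities of variance 1 is an exponential tilt. -/
theorem gaussianReal_eq_withDensity (m : ℝ) : gaussianReal m 1 =
    (gaussianReal 0 1).withDensity fun x => ENNReal.ofReal (Real.exp (m * x - m ^ 2 / 2)) := by
  rw [gaussianReal_of_var_ne_zero _ one_ne_zero, gaussianReal_of_var_ne_zero _ one_ne_zero,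
    ← withDensity_mul _ (measurable_gaussianPDF 0 1) (by fun_prop)]
  congr 1
  funext x
  rw [Pi.mul_apply, gaussianPDF, gaussianPDF, ← ENNReal.ofReal_mul (gaussianPDFReal_nonneg _ _ _),
    gaussianPDFReal, gaussianPDFReal, mul_assoc _ (Real.exp _), ← Real.exp_add]
  congr 3
  simp
  ring

theorem tridiagonalLaw_eq {β : ℝ} (hβ : 0 < β) (α : ℝ) {m : ℝ}
    (hm : m = α * √(2 * β * (n + 1 : ℕ))) :
    tridiagonalLaw (n + 1) β α = (jacobiLaw β n).withDensity
      fun x => ENNReal.ofReal (Real.exp (m * x.1 0 - m ^ 2 / 2)) := by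
  have hP := fun i : Fin n => isProbabilityMeasure_chiTilde (chiTilde_index_pos hβ i)
  have hg : ∀ i : Fin (n + 1), gaussianReal (if i.1 = 0 then m else 0) 1 =
      (gaussianReal 0 1).withDensity (fun x => ENNReal.ofReal (Real.exp
        ((if i.1 = 0 then m else 0) * x - (if i.1 = 0 then m else 0) ^ 2 / 2))) :=
    fun i => gaussianReal_eq_withDensity _
  have hs : ∀ i : Fin (n + 1), SigmaFinite ((gaussianReal 0 1).withDensity (fun x =>
      ENNReal.ofReal (Real.exp
        ((if i.1 = 0 then m else 0) * x - (if i.1 = 0 then m else 0) ^ 2 / 2)))) := fun i => by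
    rw [← hg]; infer_instance
  have h1 : (Measure.pi fun i : Fin (n + 1) => gaussianReal (if i.1 = 0 then m else 0) 1) =
      (Measure.pi fun _ : Fin (n + 1) => gaussianReal 0 1).withDensity
        fun x => ENNReal.ofReal (Real.exp (m * x 0 - m ^ 2 / 2)) := by
    simp only [hg]
    rw [pi_withDensity _ fun i => by fun_prop]
    congr 1
    funext x
    rw [Fin.prod_univ_succ]
    simp
  have h2 : (Measure.pi fun i : Fin n => chiTilde (β * (((n + 1 : ℕ) : ℝ) - 1 - (i.1 : ℝ)))) =
      Measure.pi fun i : Fin n => chiTilde (β * ((n : ℝ) - i.1)) := by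
    congr 1; funext i; push_cast; ring_nf
  have h3 : tridiagonalLaw (n + 1) β α =
      (Measure.pi fun i : Fin (n + 1) => gaussianReal (if i.1 = 0 then m else 0) 1).prod
        (Measure.pi fun i : Fin n => chiTilde (β * (((n + 1 : ℕ) : ℝ) - 1 - (i.1 : ℝ)))) := by
    rw [hm]; rfl
  rw [h3, h2, h1, prod_withDensity_left (by fun_prop)]
  rfl

theorem weighted_mean_le {g l : Fin (n + 1) → ℝ} (hg : ∀ i, 0 < g i) :
    (∑ i, l i * g i) / ∑ i, g i ≤ ∑ i, |l i| := by
  have hS : 0 < ∑ i, g i := Finset.sum_pos (fun i _ => hg i) univ_nonempty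
  rw [div_le_iff₀ hS, Finset.sum_mul]
  refine Finset.sum_le_sum fun i _ => ?_
  refine (mul_le_mul_of_nonneg_right (le_abs_self _) (hg i).le).trans ?_
  exact mul_le_mul_of_nonneg_left (Finset.single_le_sum (fun i _ => (hg i).le) (mem_univ i))
    (abs_nonneg _)

theorem measurable_exp_mean : Measurable fun p : (Fin (n + 1) → ℝ) × (Fin (n + 1) → ℝ) =>
    Real.exp ((∑ i, p.1 i * p.2 i) / ∑ i, p.2 i) :=
  (Measurable.div (by fun_prop) (by fun_prop)).exp

theorem ofReal_dirichletMoment {k : ℝ} (hk : 0 < k) (a : Fin (n + 1) → ℝ) :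
    ENNReal.ofReal (dirichletMoment k a) =
      ∫⁻ g, ENNReal.ofReal (Real.exp ((∑ i, a i * g i) / ∑ i, g i)) ∂gammaPi k (n + 1) := by
  have := isProbabilityMeasure_gammaPi hk (n + 1)
  refine ofReal_integral_eq_lintegral_ofReal ?_ (Eventually.of_forall fun _ => (Real.exp_pos _).le)
  refine Integrable.of_bound (C := Real.exp (∑ i, |a i|)) ?_ ?_
  · exact (measurable_exp_mean.comp (measurable_const.prodMk measurable_id)).aestronglyMeasurable
  · filter_upwards [gammaPi_pos_ae hk (n + 1)] with g hg
    rw [Real.norm_of_nonneg (Real.exp_pos _).le]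
    exact Real.exp_le_exp.mpr (weighted_mean_le hg)

theorem measurable_dirichletMoment {k : ℝ} (hk : 0 < k) :
    Measurable (dirichletMoment k : (Fin (n + 1) → ℝ) → ℝ) := by
  have := isProbabilityMeasure_gammaPi hk (n + 1)
  exact (StronglyMeasurable.integral_prod_right
    (f := fun a g : Fin (n + 1) → ℝ => Real.exp ((∑ i, a i * g i) / ∑ i, g i))
    measurable_exp_mean.stronglyMeasurable).measurable

/-- The tilt depends only on the corner, which is the mean of the eigenvalues under the spectral
weights. An auxiliary gamma scale brings the known product law into play without changing that mean,
and integrating over the scaled weights leaves the Dirichlet moment. -/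
theorem map_eigenvalues_tridiagonalLaw {β : ℝ} (hβ : 0 < β) (α : ℝ) {m : ℝ}
    (hm : m = α * √(2 * β * (n + 1 : ℕ)))
    {Ψ : (Fin (n + 1) → ℝ) × (Fin n → ℝ) → (Fin (n + 1) → ℝ) × (Fin (n + 1) → ℝ)}
    (hΨ : IsSpectralMap β n Ψ) : ∃ c : ℝ, 0 < c ∧
    (tridiagonalLaw (n + 1) β α).map (fun x => (Ψ x).1) =
      (eigenMeasure (β / 2) (n + 1)).withDensity
        fun l => ENNReal.ofReal (c * dirichletMoment (β / 2) (m • l)) := by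
  have hk : 0 < β / 2 := half_pos hβ
  obtain ⟨hΨm, hΨs, c, hc, hmap⟩ := hΨ
  refine ⟨c * Real.exp (-(m ^ 2 / 2)), by positivity, ?_⟩
  have hm1 : Measurable fun x => (Ψ x).1 := measurable_fst.comp hΨm
  have := isProbabilityMeasure_gammaMeasure (show 0 < ((n : ℝ) + 1) * (β / 2) by positivity) one_pos
  have := isProbabilityMeasure_jacobiLaw hβ n
  have := isProbabilityMeasure_gammaPi hk (n + 1)
  rw [tridiagonalLaw_eq hβ α hm]
  ext A hA
  set g : (Fin (n + 1) → ℝ) × (Fin (n + 1) → ℝ) → ℝ≥0∞ := fun p =>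
    A.indicator (fun _ => 1) p.1 * (ENNReal.ofReal (Real.exp (-(m ^ 2 / 2))) *
      ENNReal.ofReal (Real.exp ((∑ i, (m • p.1) i * p.2 i) / ∑ i, p.2 i))) with hg
  have hgm : Measurable g := by
    have h1 : Measurable fun p : (Fin (n + 1) → ℝ) × (Fin (n + 1) → ℝ) => (m • p.1, p.2) :=
      (measurable_fst.const_smul m).prodMk measurable_snd
    exact ((measurable_const.indicator hA).comp measurable_fst).mul
      ((measurable_exp_mean.comp h1).ennreal_ofReal.const_mul _)
  have hae : ∀ᵐ p ∂(jacobiLaw β n).prod (gammaMeasure (((n : ℝ) + 1) * (β / 2)) 1),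
      A.indicator (fun _ => 1) (Ψ p.1).1 *
        ENNReal.ofReal (Real.exp (m * p.1.1 0 - m ^ 2 / 2)) =
      g ((Ψ p.1).1, p.2 • (Ψ p.1).2) := by
    filter_upwards [Measure.quasiMeasurePreserving_fst.ae hΨs,
      Measure.quasiMeasurePreserving_snd.ae (gammaMeasure_pos_ae _)] with p hp hp2
    simp only [hg]
    rw [← ENNReal.ofReal_mul (Real.exp_pos _).le, ← Real.exp_add]
    have h1 : p.1.1 0 = ∑ i, (Ψ p.1).2 i * (Ψ p.1).1 i := by
      rw [← hp.corner, jacobiMatrix_zero_zero]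
    have h2 : (∑ i, (m • (Ψ p.1).1) i * (p.2 • (Ψ p.1).2) i) / ∑ i, (p.2 • (Ψ p.1).2) i =
        m * p.1.1 0 := by
      simp only [Pi.smul_apply, smul_eq_mul]
      rw [← Finset.mul_sum, hp.sum_weight, mul_one, div_eq_iff hp2.ne', h1, Finset.mul_sum,
        Finset.sum_mul]
      exact Finset.sum_congr rfl fun i _ => by ring
    rw [h2]
    ring_nf
  have hA1 : Measurable fun x => A.indicator (fun _ => (1 : ℝ≥0∞)) (Ψ x).1 *
        ENNReal.ofReal (Real.exp (m * x.1 0 - m ^ 2 / 2)) :=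
    ((measurable_const.indicator hA).comp hm1).mul (by fun_prop)
  calc _ = ∫⁻ x, A.indicator (fun _ => 1) (Ψ x).1 *
        ENNReal.ofReal (Real.exp (m * x.1 0 - m ^ 2 / 2)) ∂jacobiLaw β n := by
        rw [Measure.map_apply hm1 hA, withDensity_apply _ (hm1 hA), ← lintegral_indicator (hm1 hA)]
        refine lintegral_congr fun x => ?_
        by_cases hx : (Ψ x).1 ∈ A <;> simp [hx]
    _ = ∫⁻ p, A.indicator (fun _ => 1) (Ψ p.1).1 *
        ENNReal.ofReal (Real.exp (m * p.1.1 0 - m ^ 2 / 2))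
          ∂(jacobiLaw β n).prod (gammaMeasure (((n : ℝ) + 1) * (β / 2)) 1) := by
        rw [lintegral_prod (fun p : ((Fin (n + 1) → ℝ) × (Fin n → ℝ)) × ℝ =>
          A.indicator (fun _ => (1 : ℝ≥0∞)) (Ψ p.1).1 *
            ENNReal.ofReal (Real.exp (m * p.1.1 0 - m ^ 2 / 2)))
          (hA1.comp measurable_fst).aemeasurable]
        simp
    _ = ∫⁻ p, g p ∂((jacobiLaw β n).prod (gammaMeasure (((n : ℝ) + 1) * (β / 2)) 1)).map
          (fun p => ((Ψ p.1).1, p.2 • (Ψ p.1).2)) := by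
        rw [lintegral_map hgm (measurable_spectralScale hΨm)]
        exact lintegral_congr_ae hae
    _ = ENNReal.ofReal c * ∫⁻ l, A.indicator (fun _ => 1) l *
        (ENNReal.ofReal (Real.exp (-(m ^ 2 / 2))) * ENNReal.ofReal
          (dirichletMoment (β / 2) (m • l))) ∂eigenMeasure (β / 2) (n + 1) := by
        rw [hmap, lintegral_smul_measure, smul_eq_mul, lintegral_prod _ hgm.aemeasurable]
        congr 1
        refine lintegral_congr fun l => ?_
        have hl : Measurable fun y : Fin (n + 1) → ℝ =>
            ENNReal.ofReal (Real.exp ((∑ i, (m • l) i * y i) / ∑ i, y i)) :=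
          (measurable_exp_mean.comp (measurable_const.prodMk measurable_id)).ennreal_ofReal
        simp only [hg]
        rw [lintegral_const_mul _ (hl.const_mul _), lintegral_const_mul _ hl,
          ofReal_dirichletMoment hk]
    _ = _ := by
        rw [withDensity_apply _ hA, ← lintegral_indicator hA, ← lintegral_const_mul']
        swap
        · exact ENNReal.ofReal_ne_top
        refine lintegral_congr fun l => ?_
        by_cases hl : l ∈ A
        · simp only [Set.indicator_of_mem hl, one_mul]
          rw [← ENNReal.ofReal_mul (Real.exp_pos _).le, ← ENNReal.ofReal_mul hc.le, mul_assoc]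
        · simp [hl]

theorem withDensity_map {A B : Type*} [MeasurableSpace A] [MeasurableSpace B] (μ : Measure A)
    {e : A → B} (he : Measurable e) {F : B → ℝ≥0∞} (hF : Measurable F) :
    (μ.map e).withDensity F = (μ.withDensity (F ∘ e)).map e := by
  ext s hs
  rw [withDensity_apply _ hs, Measure.map_apply he hs, withDensity_apply _ (he hs),
    setLIntegral_map hs hF he]
  rfl

/-- A positive dilation preserves the chamber of decreasing sequences and multiplies Lebesgue
measure by a constant. -/
theorem map_inv_smul_withDensity {σ : ℝ} (hσ : 0 < σ) {F : (Fin n → ℝ) → ℝ≥0∞}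
    (hF : Measurable F) :
    ((volume.restrict {l : Fin n → ℝ | StrictAnti l}).withDensity F).map (fun l => σ⁻¹ • l) =
      ENNReal.ofReal (σ ^ n) •
        (volume.restrict {l : Fin n → ℝ | StrictAnti l}).withDensity fun l => F (σ • l) := by
  have hm : Measurable fun l : Fin n → ℝ => σ • l := measurable_const_smul σ
  have hm' : Measurable fun l : Fin n → ℝ => σ⁻¹ • l := measurable_const_smul σ⁻¹
  have h1 : (volume : Measure (Fin n → ℝ)) =
      ENNReal.ofReal (σ ^ n) • volume.map (fun l : Fin n → ℝ => σ • l) := by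
    rw [Measure.map_addHaar_smul _ hσ.ne', smul_smul, ← ENNReal.ofReal_mul (by positivity),
      Module.finrank_fin_fun, abs_of_pos (by positivity), mul_inv_cancel₀ (by positivity)]
    simp
  have hS : (fun l : Fin n → ℝ => σ • l) ⁻¹' {l | StrictAnti l} = {l | StrictAnti l} := by
    ext l
    constructor
    · intro h i j hij
      have := h hij
      simp only [Pi.smul_apply, smul_eq_mul] at this
      exact lt_of_mul_lt_mul_left this hσ.le
    · intro h i j hij
      simp only [Pi.smul_apply, smul_eq_mul]
      exact mul_lt_mul_of_pos_left (h hij) hσ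
  conv_lhs => rw [h1]
  rw [Measure.restrict_smul, withDensity_smul_measure, Measure.map_smul,
    Measure.restrict_map hm measurableSet_strictAnti, hS, withDensity_map _ hm hF,
    Measure.map_map hm' hm]
  have : (fun l : Fin n → ℝ => σ⁻¹ • l) ∘ (fun l => σ • l) = id := by
    funext l
    simp [smul_smul, inv_mul_cancel₀ hσ.ne']
  rw [this, Measure.map_id]
  rfl

theorem vandermondeSq_smul (σ : ℝ) (l : Fin n → ℝ) :
    vandermondeSq (σ • l) = (|σ| ^ (n - 1)) ^ n * vandermondeSq l := by
  unfold vandermondeSq nodeProd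
  have : ∀ i : Fin n, |∏ k ∈ univ.erase i, ((σ • l) i - (σ • l) k)| =
      |σ| ^ (n - 1) * |∏ k ∈ univ.erase i, (l i - l k)| := fun i => by
    simp only [Pi.smul_apply, smul_eq_mul, ← mul_sub]
    rw [Finset.prod_mul_distrib, Finset.prod_const, card_erase_of_mem (mem_univ _), card_univ,
      Fintype.card_fin, abs_mul, abs_pow]
  simp only [this]
  rw [Finset.prod_mul_distrib, Finset.prod_const, card_univ, Fintype.card_fin]

/-- Each pair occurs twice, once in the node product of either member. -/
theorem vandermondeSq_eq (l : Fin n → ℝ) :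
    vandermondeSq l = (∏ j, ∏ k ∈ Finset.Ioi j, |l j - l k|) ^ 2 := by
  unfold vandermondeSq nodeProd
  have h1 : ∀ i : Fin n, |∏ k ∈ univ.erase i, (l i - l k)| =
      (∏ k ∈ Finset.Ioi i, |l i - l k|) * ∏ k ∈ Finset.Iio i, |l i - l k| := fun i => by
    have : univ.erase i = (Finset.Ioi i).disjUnion (Finset.Iio i) (by
        rw [Finset.disjoint_left]; intro a; simp only [Finset.mem_Ioi, Finset.mem_Iio]
        exact fun h => h.not_gt) := by
      ext k; simp [lt_or_lt_iff_ne, ne_comm]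
    rw [this, Finset.prod_disjUnion, abs_mul, Finset.abs_prod, Finset.abs_prod]
  simp only [h1]
  rw [Finset.prod_mul_distrib, sq]
  congr 1
  rw [Finset.prod_comm' (t' := univ) (s' := fun k => Finset.Ioi k) (by simp)]
  exact Finset.prod_congr rfl fun i _ => Finset.prod_congr rfl fun j _ => abs_sub_comm _ _

theorem vandermondeSq_rpow (l : Fin n → ℝ) (β : ℝ) :
    vandermondeSq l ^ (β / 2) = ∏ j, ∏ k ∈ Finset.Ioi j, |l j - l k| ^ β := by
  have h0 : ∀ j, 0 ≤ ∏ k ∈ Finset.Ioi j, |l j - l k| := fun j =>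
    Finset.prod_nonneg fun _ _ => abs_nonneg _
  rw [vandermondeSq_eq, ← Real.rpow_natCast, ← Real.rpow_mul (Finset.prod_nonneg fun j _ => h0 j),
    ← Real.finsetProd_rpow _ _ fun j _ => h0 j]
  refine Finset.prod_congr rfl fun j _ => ?_
  rw [← Real.finsetProd_rpow _ _ fun _ _ => abs_nonneg _]
  refine Finset.prod_congr rfl fun k _ => ?_
  congr 1
  push_cast
  ring

theorem SpectralData.isOrderedSpectrum {T : Matrix (Fin (n + 1)) (Fin (n + 1)) ℝ}
    {l w : Fin (n + 1) → ℝ} (h : SpectralData T l w) {r : ℝ} (hr : 0 < r) :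
    IsOrderedSpectrum (r • T) (r • l) := by
  obtain ⟨V, hV, hTV, hVw⟩ := h.exists_vectors
  refine ⟨fun i j hij => mul_lt_mul_of_pos_left (h.strictAnti hij) hr, fun j =>
    ⟨fun i => V i j, fun h0 => ?_, ?_⟩⟩
  · have := hVw j
    rw [show V 0 j = 0 from congrFun h0 0] at this
    have hp := h.pos j
    simp [← this] at hp
  · funext i
    have h1 := congrFun (congrFun hTV i) j
    rw [Matrix.mul_apply, Matrix.mul_diagonal] at h1
    rw [Matrix.smul_mulVec, Pi.smul_apply, Matrix.mulVec, dotProduct, h1]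
    simp only [Pi.smul_apply, smul_eq_mul]
    ring

theorem eigenDensity_smul (σ β : ℝ) (l : Fin (n + 1) → ℝ) :
    eigenDensity (β / 2) (σ • l) = ((|σ| ^ n) ^ (n + 1)) ^ (β / 2) *
      ((∏ j, Real.exp (-(σ ^ 2 / 2 * l j ^ 2))) * ∏ j, ∏ k ∈ Finset.Ioi j, |l j - l k| ^ β) := by
  have h0 : 0 ≤ vandermondeSq l := Finset.prod_nonneg fun i _ => abs_nonneg _
  rw [eigenDensity, vandermondeSq_smul, Real.mul_rpow (by positivity) h0, vandermondeSq_rpow,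
    ← Real.exp_sum]
  have : -(∑ i, (σ • l) i ^ 2) / 2 = ∑ j, -(σ ^ 2 / 2 * l j ^ 2) := by
    simp only [Pi.smul_apply, smul_eq_mul]
    rw [Finset.sum_neg_distrib, neg_div, Finset.sum_div]
    exact congrArg _ (Finset.sum_congr rfl fun i _ => by ring)
  rw [this, Nat.add_sub_cancel]
  ring

/-- The contour integral in the density of the eigenvalues `l`. -/
def eigenvalueIntegral (β α : ℝ) (l : Fin (n + 1) → ℝ) : ℝ :=
  2 * Real.pi * (Real.Gamma (((n : ℝ) + 1) * (β / 2)))⁻¹ *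
    dirichletMoment (β / 2) fun j => 2 * α * β * (n + 1 : ℕ) * l j

theorem eigenvalueIntegral_nonneg {β : ℝ} (hβ : 0 < β) (α : ℝ) (l : Fin (n + 1) → ℝ) :
    0 ≤ eigenvalueIntegral β α l := by
  have h1 := Real.Gamma_pos_of_pos (show 0 < ((n : ℝ) + 1) * (β / 2) by positivity)
  have h2 := dirichletMoment_nonneg (β / 2) fun j => 2 * α * β * (n + 1 : ℕ) * l j
  unfold eigenvalueIntegral
  positivity

/-- The density of the eigenvalues, not normalized. -/
def eigenvalueDensity (β α : ℝ) (l : Fin (n + 1) → ℝ) : ℝ :=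
  (∏ j, Real.exp (-(β * (n + 1 : ℕ) * l j ^ 2))) *
    (∏ j, ∏ k ∈ Finset.Ioi j, |l j - l k| ^ β) * eigenvalueIntegral β α l

theorem exists_hasOrderedEigenvaluePDF_tridiagonal {β : ℝ} (hβ : 0 < β) (α : ℝ) (n : ℕ) :
    ∃ Z : ℝ, 0 < Z ∧ HasOrderedEigenvaluePDF (tridiagonalLaw (n + 1) β α)
      (fun x => tridiagonal β x) (fun l => Z⁻¹ * eigenvalueDensity β α l) := by
  have hk : 0 < β / 2 := half_pos hβ
  obtain ⟨Ψ, hΨ⟩ := exists_isSpectralMap hβ n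
  set σ := √(2 * β * (n + 1 : ℕ)) with hσdef
  have hσ : 0 < σ := Real.sqrt_pos.mpr (by positivity)
  have hσ2 : σ ^ 2 = 2 * β * (n + 1 : ℕ) := Real.sq_sqrt (by positivity)
  obtain ⟨c, hc, hmap⟩ := map_eigenvalues_tridiagonalLaw hβ α (m := α * σ) rfl hΨ
  have hΓ := Real.Gamma_pos_of_pos (show 0 < ((n : ℝ) + 1) * (β / 2) by positivity)
  set Γ := Real.Gamma (((n : ℝ) + 1) * (β / 2)) with hΓdef
  set C : ℝ := ((|σ| ^ n) ^ (n + 1)) ^ (β / 2) with hC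
  have hC0 : 0 < C := by
    have : 0 < |σ| := abs_pos.mpr hσ.ne'
    positivity
  -- The factors come from Lebesgue measure, from the Vandermonde product and from the spectral law;
  -- `Γ / (2 * Real.pi)` undoes the prefactor of the contour integral.
  set z : ℝ := σ ^ (n + 1) * C * c * Γ / (2 * Real.pi) with hz
  have hz0 : 0 < z := by positivity
  have hΛ : Measurable fun x => σ⁻¹ • (Ψ x).1 := (measurable_fst.comp hΨ.measurable).const_smul σ⁻¹
  refine ⟨z⁻¹, inv_pos.mpr hz0, fun l _ => ?_, fun x => σ⁻¹ • (Ψ x).1, hΛ.aemeasurable, ?_, ?_⟩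
  · have := eigenvalueIntegral_nonneg hβ α l
    have h1 : 0 ≤ ∏ j, ∏ k ∈ Finset.Ioi j, |l j - l k| ^ β :=
      Finset.prod_nonneg fun _ _ => Finset.prod_nonneg fun _ _ => by positivity
    have h2 : 0 ≤ ∏ j, Real.exp (-(β * (n + 1 : ℕ) * l j ^ 2)) :=
      Finset.prod_nonneg fun _ _ => (Real.exp_pos _).le
    simp only [inv_inv, eigenvalueDensity]
    positivity
  · have h1 : ∀ᵐ x ∂tridiagonalLaw (n + 1) β α,
        SpectralData (jacobiMatrix x) (Ψ x).1 (Ψ x).2 := by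
      rw [tridiagonalLaw_eq hβ α rfl]
      exact (withDensity_absolutelyContinuous _ _).ae_le hΨ.ae_spectralData
    filter_upwards [h1] with x hx
    have := hx.isOrderedSpectrum (inv_pos.mpr hσ)
    rw [← one_div σ] at this ⊢
    exact this
  · have h1 : (tridiagonalLaw (n + 1) β α).map (fun x => σ⁻¹ • (Ψ x).1) =
        ((tridiagonalLaw (n + 1) β α).map fun x => (Ψ x).1).map fun l => σ⁻¹ • l := by
      have hs : Measurable fun l : Fin (n + 1) → ℝ => σ⁻¹ • l := measurable_id.const_smul σ⁻¹
      exact (Measure.map_map hs (measurable_fst.comp hΨ.measurable)).symm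
    have hq : Measurable fun l : Fin (n + 1) → ℝ =>
        ENNReal.ofReal (c * dirichletMoment (β / 2) ((α * σ) • l)) :=
      (((measurable_dirichletMoment hk).comp (measurable_id.const_smul (α * σ))).const_mul
        c).ennreal_ofReal
    have he : Measurable fun l : Fin (n + 1) → ℝ => ENNReal.ofReal (eigenDensity (β / 2) l) :=
      (measurable_eigenDensity _).ennreal_ofReal
    refine h1.trans ((congrArg (Measure.map fun l => σ⁻¹ • l) hmap).trans ?_)
    rw [eigenMeasure, ← withDensity_mul _ he hq, map_inv_smul_withDensity hσ (he.mul hq),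
      ← withDensity_smul' _ _ ENNReal.ofReal_ne_top]
    congr 1
    funext l
    -- The tilt contributes α σ and the rescaling another σ; since σ² = 2βN, the integral contains
    -- 2αβN.
    have h2 : ((α * σ) • σ • l) = fun j => 2 * α * β * (n + 1 : ℕ) * l j := by
      funext j
      simp only [Pi.smul_apply, smul_eq_mul]
      linear_combination α * l j * hσ2
    have h3 : (∏ j, Real.exp (-(σ ^ 2 / 2 * l j ^ 2))) =
        ∏ j, Real.exp (-(β * (n + 1 : ℕ) * l j ^ 2)) := by
      rw [hσ2]
      exact Finset.prod_congr rfl fun j _ => by ring_nf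
    simp only [Pi.smul_apply, Pi.mul_apply, smul_eq_mul]
    rw [← ENNReal.ofReal_mul (eigenDensity_nonneg _ _), ← ENNReal.ofReal_mul (by positivity),
      eigenDensity_smul, h2, h3, eigenvalueDensity, eigenvalueIntegral, ← hΓdef, ← hC, inv_inv, hz]
    congr 1
    field_simp

end Tridiagonal

end RankOne
end

noncomputable section

namespace RankOne

open Finset
open scoped ENNReal

/-! ### Sums of squares of Gaussian variables -/

/-- In the factorization of a gamma vector into scale and point of the simplex, the sum is the
scale. -/
theorem measurePreserving_sum_gammaPi {k : ℝ} (hk : 0 < k) (n : ℕ) :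
    MeasurePreserving (fun g : Fin (n + 1) → ℝ => ∑ i, g i) (gammaPi k (n + 1))
      (gammaMeasure (((n : ℝ) + 1) * k) 1) := by
  obtain ⟨D, hDp, hD, hmap⟩ := exists_dirichlet hk n
  have := isProbabilityMeasure_gammaMeasure (show 0 < ((n : ℝ) + 1) * k by positivity) one_pos
  have hs : Measurable fun g : Fin (n + 1) → ℝ => ∑ i, g i := by fun_prop
  refine ⟨hs, ?_⟩
  rw [← hmap.map_eq, Measure.map_map hs hmap.measurable]
  have hae : (fun g : Fin (n + 1) → ℝ => ∑ i, g i) ∘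
      (fun p : (Fin (n + 1) → ℝ) × ℝ => p.2 • p.1)
      =ᵐ[D.prod (gammaMeasure (((n : ℝ) + 1) * k) 1)] Prod.snd := by
    filter_upwards [Measure.quasiMeasurePreserving_fst.ae hD] with p hp
    simp only [Function.comp_apply, Pi.smul_apply, smul_eq_mul]
    rw [← Finset.mul_sum, hp.2, mul_one]
  rw [Measure.map_congr hae]
  exact measurePreserving_snd.map_eq

theorem gaussianPDFReal_zero_half (x : ℝ) :
    gaussianPDFReal 0 (1 / 2) x = (√Real.pi)⁻¹ * Real.exp (-x ^ 2) := by
  have h : ((1 / 2 : NNReal) : ℝ) = 1 / 2 := by norm_num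
  rw [gaussianPDFReal, h, sub_zero, show 2 * Real.pi * (1 / 2) = Real.pi by ring,
    show (2 : ℝ) * (1 / 2) = 1 by norm_num, div_one]

/-- The density exp(-x²)/√π is even, so the law is twice that of the positive half line;
substituting y = x² and Γ(1/2) = √π gives the gamma density of shape 1/2. -/
theorem measurePreserving_sq_gaussianReal :
    MeasurePreserving (fun x : ℝ => x ^ 2) (gaussianReal 0 (1 / 2)) (gammaMeasure (1 / 2) 1) := by
  have hsq : Measurable fun x : ℝ => x ^ 2 := by fun_prop
  refine ⟨hsq, Measure.ext fun A hA => ?_⟩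
  have hv : (1 / 2 : NNReal) ≠ 0 := by norm_num
  set h : ℝ → ℝ≥0∞ := A.indicator fun _ => 1 with hh
  have hhm : Measurable h := measurable_const.indicator hA
  set d : ℝ → ℝ≥0∞ := fun x => ENNReal.ofReal ((√Real.pi)⁻¹ * Real.exp (-x ^ 2)) * h (x ^ 2) with hd
  have hdm : Measurable d := by
    refine Measurable.mul (by fun_prop) (hhm.comp hsq)
  have e1 : ((gaussianReal 0 (1 / 2)).map fun x : ℝ => x ^ 2) A = ∫⁻ x, d x := by
    rw [Measure.map_apply hsq hA, gaussianReal_of_var_ne_zero _ hv, withDensity_apply _ (hsq hA),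
      ← lintegral_indicator (hsq hA)]
    refine lintegral_congr fun x => ?_
    by_cases hx : x ^ 2 ∈ A
    · rw [Set.indicator_of_mem (show x ∈ (fun x : ℝ => x ^ 2) ⁻¹' A from hx), hd]
      simp only [hh, Set.indicator_of_mem hx, mul_one]
      rw [gaussianPDF, gaussianPDFReal_zero_half]
    · rw [Set.indicator_of_notMem (show x ∉ (fun x : ℝ => x ^ 2) ⁻¹' A from hx), hd]
      simp only [hh, Set.indicator_of_notMem hx, mul_zero]
  have e2 : ∫⁻ x in Set.Iio 0, d x = ∫⁻ x in Set.Ioi 0, d x := by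
    have h1 := (Measure.measurePreserving_neg (volume : Measure ℝ)).setLIntegral_comp_preimage
      (measurableSet_Ioi (a := (0 : ℝ))) hdm
    have h2 : (Neg.neg ⁻¹' Set.Ioi (0 : ℝ)) = Set.Iio 0 := by ext; simp
    rw [h2] at h1
    rw [← h1]
    refine setLIntegral_congr_fun measurableSet_Iio fun x _ => ?_
    simp [hd]
  have e3 : ∫⁻ x, d x = 2 * ∫⁻ x in Set.Ioi 0, d x := by
    rw [← lintegral_add_compl d (measurableSet_Ioi (a := (0 : ℝ))), Set.compl_Ioi,
      ← setLIntegral_congr (Iio_ae_eq_Iic (a := (0 : ℝ))), e2, two_mul]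
  have himg : (fun x : ℝ => x ^ 2) '' Set.Ioi 0 = Set.Ioi 0 := by
    ext y
    constructor
    · rintro ⟨x, hx, rfl⟩
      exact pow_pos (Set.mem_Ioi.mp hx) 2
    · intro hy
      exact ⟨√y, Real.sqrt_pos.mpr hy, Real.sq_sqrt (Set.mem_Ioi.mp hy).le⟩
  have e4 := lintegral_image_eq_lintegral_abs_deriv_mul (f := fun x : ℝ => x ^ 2)
    (f' := fun x => 2 * x) (measurableSet_Ioi (a := (0 : ℝ)))
    (fun x _ => by simpa using (hasDerivAt_pow 2 x).hasDerivWithinAt)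
    (fun x hx y hy hxy => by
      exact (pow_left_inj₀ (Set.mem_Ioi.mp hx).le (Set.mem_Ioi.mp hy).le two_ne_zero).mp hxy)
    (fun y => ENNReal.ofReal (gammaDensity (1 / 2) y) * h y)
  rw [himg] at e4
  rw [e1, e3, gammaMeasure_eq, withDensity_apply _ hA, ← lintegral_indicator hA,
    ← lintegral_const_mul _ hdm]
  have e5 : ∫⁻ y in Set.Ioi 0, A.indicator (fun y => ENNReal.ofReal (gammaDensity (1 / 2) y)) y =
      ∫⁻ y in Set.Ioi 0, ENNReal.ofReal (gammaDensity (1 / 2) y) * h y := by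
    refine lintegral_congr fun y => ?_
    by_cases hy : y ∈ A <;> simp [hh, hy]
  rw [e5, e4]
  refine setLIntegral_congr_fun measurableSet_Ioi fun x hx => ?_
  have hx0 : 0 < x := hx
  simp only [hd]
  rw [← mul_assoc, ← mul_assoc]
  congr 1
  rw [← ENNReal.ofReal_mul (by positivity), show (2 : ℝ≥0∞) = ENNReal.ofReal 2 by simp,
    ← ENNReal.ofReal_mul (by norm_num), gammaDensity, Real.Gamma_one_half_eq, ← Real.rpow_natCast x,
    ← Real.rpow_mul hx0.le, abs_of_pos (by positivity)]
  congr 1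
  have : ((2 : ℕ) : ℝ) * (1 / 2 - 1) = -1 := by norm_num
  rw [this, Real.rpow_neg_one]
  field_simp

theorem measurePreserving_sum_sq_gaussianReal (m : ℕ) :
    MeasurePreserving (fun x : Fin (m + 1) → ℝ => ∑ k, x k ^ 2)
      (Measure.pi fun _ => gaussianReal 0 (1 / 2)) (gammaMeasure (((m : ℝ) + 1) / 2) 1) := by
  have hk : (0 : ℝ) < 1 / 2 := by norm_num
  have := isProbabilityMeasure_gammaMeasure hk one_pos
  have h1 := measurePreserving_pi (fun _ : Fin (m + 1) => gaussianReal 0 (1 / 2))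
    (fun _ => gammaMeasure (1 / 2) 1) fun _ => measurePreserving_sq_gaussianReal
  have h2 := (measurePreserving_sum_gammaPi hk m).comp h1
  rwa [show ((m : ℝ) + 1) * (1 / 2) = ((m : ℝ) + 1) / 2 by ring] at h2

theorem measurePreserving_sum_sum_sq_gaussianReal (n m : ℕ) :
    MeasurePreserving (fun x : Fin (n + 1) → Fin (m + 1) → ℝ => ∑ i, ∑ k, x i k ^ 2)
      (Measure.pi fun _ => Measure.pi fun _ => gaussianReal 0 (1 / 2))
      (gammaMeasure (((n : ℝ) + 1) * (((m : ℝ) + 1) / 2)) 1) := by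
  have hk : 0 < ((m : ℝ) + 1) / 2 := by positivity
  have := isProbabilityMeasure_gammaMeasure hk one_pos
  exact (measurePreserving_sum_gammaPi hk n).comp (measurePreserving_pi
    (fun _ : Fin (n + 1) => Measure.pi fun _ : Fin (m + 1) => gaussianReal 0 (1 / 2))
    (fun _ => gammaMeasure (((m : ℝ) + 1) / 2) 1) fun _ => measurePreserving_sum_sq_gaussianReal m)

end RankOne
end

noncomputable section

namespace RankOne

open Finset
open scoped ENNReal

/-! ### Unitary matrices over the real, complex and quaternion numbers -/

/-- A real division algebra with involution in which `a* a = a a* = |a|²` and all selfadjoint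
elements are real. -/
class CompositionStar (K : Type*) [NormedDivisionRing K] [NormedAlgebra ℝ K] [StarRing K] :
    Prop where
  star_real_smul : ∀ (r : ℝ) (a : K), star (r • a) = r • star a
  star_mul_self_eq : ∀ a : K, star a * a = algebraMap ℝ K (‖a‖ ^ 2)
  mul_star_self_eq : ∀ a : K, a * star a = algebraMap ℝ K (‖a‖ ^ 2)
  exists_real : ∀ a : K, star a = a → ∃ r : ℝ, algebraMap ℝ K r = a

open CompositionStar (star_mul_self_eq mul_star_self_eq exists_real)

set_option linter.unusedSectionVars false

section Unitary

variable {n : ℕ} {K : Type*} [NormedDivisionRing K] [NormedAlgebra ℝ K] [StarRing K]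
  [CompositionStar K]

instance : StarModule ℝ K := ⟨CompositionStar.star_real_smul⟩

theorem star_algebraMap_real (r : ℝ) : star (algebraMap ℝ K r) = algebraMap ℝ K r := by
  rw [Algebra.algebraMap_eq_smul_one, star_smul, star_one, star_trivial]

theorem algebraMap_real_injective : Function.Injective (algebraMap ℝ K) :=
  FaithfulSMul.algebraMap_injective ℝ K

theorem norm_star_eq (a : K) : ‖star a‖ = ‖a‖ := by
  have h : algebraMap ℝ K (‖star a‖ ^ 2) = algebraMap ℝ K (‖a‖ ^ 2) := by
    rw [← star_mul_self_eq, star_star, mul_star_self_eq]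
  exact (pow_left_inj₀ (norm_nonneg _) (norm_nonneg _) two_ne_zero).mp (algebraMap_real_injective h)

/-- A unit `p` with `a = p |a|`. -/
def phase (a : K) : K := if ‖a‖ = 0 then 1 else ‖a‖⁻¹ • a

theorem norm_phase (a : K) : ‖phase a‖ = 1 := by
  unfold phase
  split_ifs with h
  · exact norm_one
  · rw [norm_smul, norm_inv, norm_norm, inv_mul_cancel₀ h]

theorem star_phase_mul (a : K) : star (phase a) * a = algebraMap ℝ K ‖a‖ := by
  unfold phase
  split_ifs with h
  · simp [norm_eq_zero.mp h]
  · rw [star_smul, star_trivial, smul_mul_assoc, star_mul_self_eq, Algebra.smul_def, ← map_mul]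
    congr 1
    field_simp

theorem star_mul_phase (a : K) : star a * phase a = algebraMap ℝ K ‖a‖ := by
  rw [← star_star (phase a), ← star_mul, star_phase_mul, star_algebraMap_real]

/-- The sum of the squared norms of the components. -/
def vecNormSq (v : Fin n → K) : ℝ := ∑ i, ‖v i‖ ^ 2

theorem vecNormSq_nonneg (v : Fin n → K) : 0 ≤ vecNormSq v :=
  Finset.sum_nonneg fun _ _ => sq_nonneg _

theorem vecNormSq_eq_zero {v : Fin n → K} : vecNormSq v = 0 ↔ v = 0 := by
  unfold vecNormSq
  rw [Finset.sum_eq_zero_iff_of_nonneg fun _ _ => sq_nonneg _]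
  constructor
  · intro h
    funext i
    simpa using h i (mem_univ i)
  · rintro rfl
    simp

theorem star_dotProduct_self (v : Fin n → K) :
    dotProduct (star v) v = algebraMap ℝ K (vecNormSq v) := by
  rw [dotProduct, vecNormSq, map_sum]
  exact Finset.sum_congr rfl fun i _ => star_mul_self_eq _

/-- The reflection in the hyperplane orthogonal to `v`. -/
def reflector (v : Fin n → K) : Matrix (Fin n) (Fin n) K :=
  1 - (2 / vecNormSq v) • Matrix.vecMulVec v (star v)

theorem star_reflector (v : Fin n → K) : star (reflector v) = reflector v := by
  rw [reflector, star_sub, star_one, star_smul, star_trivial]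
  congr 2
  ext i j
  simp [Matrix.star_apply, Matrix.vecMulVec_apply]

theorem reflector_mul_self (v : Fin n → K) : reflector v * reflector v = 1 := by
  have h : Matrix.vecMulVec v (star v) * Matrix.vecMulVec v (star v) =
      vecNormSq v • Matrix.vecMulVec v (star v) := by
    rw [Matrix.vecMulVec_mul_vecMulVec, star_dotProduct_self]
    ext i j
    simp [Matrix.vecMulVec_apply, Algebra.smul_def, Algebra.commutes, mul_assoc]
  rw [reflector, sub_mul, mul_sub, mul_sub, one_mul, one_mul, mul_one, smul_mul_smul_comm, h,
    smul_smul]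
  -- For v = 0 the convention 2 / 0 = 0 makes the reflector the identity.
  have : 2 / vecNormSq v * (2 / vecNormSq v) * vecNormSq v = 2 / vecNormSq v + 2 / vecNormSq v := by
    by_cases h0 : vecNormSq v = 0
    · simp [h0]
    · field_simp; norm_num
  rw [this, add_smul]
  abel

theorem reflector_mem_unitary (v : Fin n → K) :
    reflector v ∈ unitary (Matrix (Fin n) (Fin n) K) := by
  rw [Unitary.mem_iff, star_reflector, and_self]
  exact reflector_mul_self v

theorem diagonal_mem_unitary {d : Fin n → K} (hd : ∀ i, ‖d i‖ = 1) :
    Matrix.diagonal d ∈ unitary (Matrix (Fin n) (Fin n) K) := by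
  rw [Unitary.mem_iff, Matrix.star_eq_conjTranspose, Matrix.diagonal_conjTranspose,
    Matrix.diagonal_mul_diagonal, Matrix.diagonal_mul_diagonal]
  constructor
  all_goals
    rw [← Matrix.diagonal_one]
    congr 1
    funext i
  · rw [Pi.star_apply, star_mul_self_eq, hd]; simp
  · rw [Pi.star_apply, mul_star_self_eq, hd]; simp

/-- The normal vector of a reflection that maps `c` to a multiple of the first unit vector. -/
def reflectorNormal (c : Fin (n + 1) → K) : Fin (n + 1) → K :=
  c + Pi.single 0 (√(vecNormSq c) • phase (c 0))

/-- The normal v is chosen so that |v|² = 2 v*c, hence c is mapped to c - v. Taking the phase of the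
first component of c makes v*c real, and therefore central even over the quaternions. -/
theorem reflector_mulVec (c : Fin (n + 1) → K) :
    (reflector (reflectorNormal c)).mulVec c = -Pi.single 0 (√(vecNormSq c) • phase (c 0)) := by
  set S := vecNormSq c with hS
  set v := reflectorNormal c with hv
  have hS0 : 0 ≤ S := vecNormSq_nonneg c
  have hstar : star v = star c + Pi.single 0 (√S • star (phase (c 0))) := by
    rw [hv, reflectorNormal, star_add, ← Pi.single_star, star_smul, star_trivial (√_)]
  have h1 : dotProduct (star v) c = algebraMap ℝ K (S + √S * ‖c 0‖) := by
    rw [hstar, add_dotProduct, star_dotProduct_self, single_dotProduct, smul_mul_assoc,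
      star_phase_mul, map_add, map_mul, Algebra.smul_def]
  have h2 : algebraMap ℝ K (vecNormSq v) = algebraMap ℝ K (2 * (S + √S * ‖c 0‖)) := by
    have e1 : dotProduct (star v) v = dotProduct (star v) c +
        dotProduct (star v) (Pi.single 0 (√S • phase (c 0))) := by
      rw [← dotProduct_add]; rfl
    rw [← star_dotProduct_self, e1, h1, hstar, add_dotProduct, dotProduct_single, single_dotProduct,
      Pi.single_eq_same, Pi.star_apply, mul_smul_comm, star_mul_phase, smul_mul_smul_comm,
      star_mul_self_eq, norm_phase, Algebra.smul_def, Algebra.smul_def, ← map_mul, ← map_mul,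
      ← map_add, ← map_add, Real.mul_self_sqrt hS0]
    congr 1
    ring
  have h3 : vecNormSq v = 2 * (S + √S * ‖c 0‖) := algebraMap_real_injective h2
  have h4 : (reflector v).mulVec c = c - v := by
    rw [reflector, Matrix.sub_mulVec, Matrix.one_mulVec, Matrix.smul_mulVec]
    congr 1
    have h5 : (Matrix.vecMulVec v (star v)).mulVec c = (S + √S * ‖c 0‖) • v := by
      rw [Matrix.vecMulVec_mulVec, h1]
      funext i
      rw [Pi.smul_apply, Pi.smul_apply, op_smul_eq_mul, Algebra.smul_def,
        Algebra.commutes]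
    rw [h5, smul_smul]
    by_cases h0 : vecNormSq v = 0
    · rw [vecNormSq_eq_zero.mp h0, smul_zero]
    · have : 2 / vecNormSq v * (S + √S * ‖c 0‖) = 1 := by
        rw [div_mul_eq_mul_div, ← h3, div_self h0]
      rw [this, one_smul]
  rw [h4, hv, reflectorNormal, sub_add_cancel_left]

/-- A unitary matrix that maps `c` to a nonnegative multiple of the first unit vector. -/
def rotation (c : Fin (n + 1) → K) : Matrix (Fin (n + 1)) (Fin (n + 1)) K :=
  Matrix.diagonal (Fin.cons (-star (phase (c 0))) 1) * reflector (reflectorNormal c)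

theorem rotation_mem_unitary (c : Fin (n + 1) → K) :
    rotation c ∈ unitary (Matrix (Fin (n + 1)) (Fin (n + 1)) K) := by
  refine mul_mem (diagonal_mem_unitary fun i => ?_) (reflector_mem_unitary _)
  refine Fin.cases ?_ (fun j => ?_) i
  · rw [Fin.cons_zero, norm_neg, norm_star_eq, norm_phase]
  · simp

theorem rotation_mulVec (c : Fin (n + 1) → K) :
    (rotation c).mulVec c = Pi.single 0 (algebraMap ℝ K √(vecNormSq c)) := by
  rw [rotation, ← Matrix.mulVec_mulVec, reflector_mulVec, ← Pi.single_neg,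
    Matrix.diagonal_mulVec_single, Fin.cons_zero, neg_mul_neg, mul_smul_comm, star_mul_self_eq,
    norm_phase, Algebra.smul_def]
  simp

/-- If U is unitary and U c = |c| e₀, then c = |c| U* e₀; its adjoint gives the first row of U. -/
theorem star_eq_rotation_mul (c : Fin (n + 1) → K) (j : Fin (n + 1)) :
    star (c j) = algebraMap ℝ K √(vecNormSq c) * rotation c 0 j := by
  have h := congrArg (star (rotation c)).mulVec (rotation_mulVec c)
  rw [Matrix.mulVec_mulVec, Unitary.star_mul_self_of_mem (rotation_mem_unitary c),
    Matrix.one_mulVec] at h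
  have h1 := congrFun h j
  rw [Matrix.mulVec_single] at h1
  rw [h1]
  simp [Matrix.star_apply, star_algebraMap_real]

end Unitary

/-! ### Measurable dependence of the rotation on the vector. -/

section Measurability

variable {n : ℕ} {K : Type*} [NormedDivisionRing K] [NormedAlgebra ℝ K] [StarRing K]
  [CompositionStar K] [ContinuousStar K] [SecondCountableTopology K] [MeasurableSpace K]
  [BorelSpace K] {Ω : Type*} [MeasurableSpace Ω]

theorem measurable_star_real : Measurable (star : K → K) := continuous_star.measurable

theorem measurable_phase : Measurable (phase : K → K) := by
  unfold phase
  exact Measurable.ite (measurable_norm (measurableSet_singleton 0)) measurable_const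
    (measurable_norm.inv.smul measurable_id)

theorem measurable_vecNormSq : Measurable (vecNormSq : (Fin n → K) → ℝ) := by
  unfold vecNormSq; fun_prop

theorem measurable_reflector (i j : Fin n) : Measurable fun v : Fin n → K => reflector v i j := by
  have h : ∀ v : Fin n → K, reflector v i j = (1 : Matrix (Fin n) (Fin n) K) i j -
      (2 / vecNormSq v) • (v i * star (v j)) := fun v => by
    simp [reflector, Matrix.vecMulVec_apply]
  simp only [h]
  have h1 : Measurable fun v : Fin n → K => star (v j) :=
    measurable_star_real.comp (measurable_pi_apply j)
  exact measurable_const.sub ((measurable_vecNormSq.const_div 2).smul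
    ((measurable_pi_apply i).mul h1))

theorem measurable_reflectorNormal :
    Measurable (reflectorNormal : (Fin (n + 1) → K) → Fin (n + 1) → K) := by
  refine measurable_pi_iff.mpr fun i => ?_
  have h1 : Measurable fun c : Fin (n + 1) → K => √(vecNormSq c) • phase (c 0) :=
    (measurable_vecNormSq.sqrt).smul (measurable_phase.comp (measurable_pi_apply 0))
  refine Fin.cases ?_ (fun j => ?_) i
  · simp only [reflectorNormal, Pi.add_apply, Pi.single_eq_same]
    exact (measurable_pi_apply 0).add h1
  · simpa [reflectorNormal] using measurable_pi_apply j.succ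

theorem measurable_matrix_mul {A B : Ω → Matrix (Fin n) (Fin n) K}
    (hA : ∀ i j, Measurable fun ω => A ω i j) (hB : ∀ i j, Measurable fun ω => B ω i j)
    (i j : Fin n) : Measurable fun ω => (A ω * B ω) i j := by
  simp only [Matrix.mul_apply]
  exact Finset.measurable_fun_sum _ fun k _ => (hA i k).mul (hB k j)

theorem measurable_rotation (i j : Fin (n + 1)) :
    Measurable fun c : Fin (n + 1) → K => rotation c i j := by
  refine measurable_matrix_mul (fun i j => ?_)
    (fun i j => (measurable_reflector i j).comp measurable_reflectorNormal) i j
  simp only [Matrix.diagonal_apply]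
  split_ifs
  · refine Fin.cases ?_ (fun k => ?_) i
    · simp only [Fin.cons_zero]
      exact (measurable_star_real.comp (measurable_phase.comp (measurable_pi_apply 0))).neg
    · simp
  · exact measurable_const

end Measurability

end RankOne
end

noncomputable section

namespace RankOne

open Finset
open CompositionStar (star_mul_self_eq mul_star_self_eq exists_real)
open scoped ENNReal

/-! ### Unitary invariance of the Gaussian ensembles -/

section Coordinates

variable {n m : ℕ} {K : Type*} [NormedDivisionRing K] [NormedAlgebra ℝ K] [StarRing K]
  [CompositionStar K]

variable (K) in
theorem exists_realPart : ∃ f : K →ₗ[ℝ] ℝ, f ∘ₗ Algebra.linearMap ℝ K = LinearMap.id :=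
  LinearMap.exists_leftInverse_of_injective _
    (LinearMap.ker_eq_bot.mpr (algebraMap_real_injective (K := K)))

variable (K) in
/-- A linear projection onto the real numbers. -/
def realPart : K →ₗ[ℝ] ℝ := (exists_realPart K).choose

theorem realPart_algebraMap (r : ℝ) : realPart K (algebraMap ℝ K r) = r :=
  LinearMap.congr_fun (exists_realPart K).choose_spec r

variable (b : Module.Basis (Fin m) ℝ K)

theorem hermitianOf_diag (x : Coords n m) (i : Fin n) :
    hermitianOf b x i i = algebraMap ℝ K (x.1 i) := by
  simp [hermitianOf]

theorem hermitianOf_upper (x : Coords n m) (p : Upper n) :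
    hermitianOf b x p.1.1 p.1.2 = ∑ k, x.2 p k • b k := by
  simp [hermitianOf, p.2.ne, p.2]

theorem hermitianOf_lower (x : Coords n m) (p : Upper n) :
    hermitianOf b x p.1.2 p.1.1 = star (∑ k, x.2 p k • b k) := by
  simp [hermitianOf, p.2.ne', p.2, p.2.not_gt]

omit [NormedDivisionRing K] [NormedAlgebra ℝ K] [StarRing K] [CompositionStar K] in
theorem matrix_ext_upper {A B : Matrix (Fin n) (Fin n) K} (hd : ∀ i, A i i = B i i)
    (hu : ∀ p : Upper n, A p.1.1 p.1.2 = B p.1.1 p.1.2)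
    (hl : ∀ p : Upper n, A p.1.2 p.1.1 = B p.1.2 p.1.1) : A = B := by
  ext i j
  rcases lt_trichotomy i j with h | rfl | h
  · exact hu ⟨(i, j), h⟩
  · exact hd i
  · exact hl ⟨(j, i), h⟩

theorem star_hermitianOf (x : Coords n m) : star (hermitianOf b x) = hermitianOf b x := by
  refine matrix_ext_upper (fun i => ?_) (fun p => ?_) fun p => ?_
  · rw [Matrix.star_apply, hermitianOf_diag, star_algebraMap_real]
  · rw [Matrix.star_apply, hermitianOf_lower, hermitianOf_upper, star_star]
  · rw [Matrix.star_apply, hermitianOf_lower, hermitianOf_upper]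

/-- The real coordinates of a selfadjoint matrix. -/
def coordsOf (M : Matrix (Fin n) (Fin n) K) : Coords n m :=
  (fun i => realPart K (M i i), fun p k => b.repr (M p.1.1 p.1.2) k)

theorem hermitianOf_coordsOf {M : Matrix (Fin n) (Fin n) K} (hM : star M = M) :
    hermitianOf b (coordsOf b M) = M := by
  have h : ∀ i j, star (M i j) = M j i := fun i j => by
    conv_rhs => rw [← hM]
    rfl
  refine matrix_ext_upper (fun i => ?_) (fun p => ?_) fun p => ?_
  · obtain ⟨r, hr⟩ := exists_real (M i i) (h i i)
    rw [hermitianOf_diag]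
    change algebraMap ℝ K (realPart K (M i i)) = M i i
    rw [← hr, realPart_algebraMap]
  · rw [hermitianOf_upper, coordsOf, b.sum_repr]
  · rw [hermitianOf_lower, coordsOf, b.sum_repr, h]

theorem hermitianOf_add (x y : Coords n m) :
    hermitianOf b (x + y) = hermitianOf b x + hermitianOf b y := by
  refine matrix_ext_upper (fun i => ?_) (fun p => ?_) fun p => ?_
  · simp only [Matrix.add_apply, hermitianOf_diag, Prod.fst_add, Pi.add_apply, map_add]
  · simp only [Matrix.add_apply, hermitianOf_upper, Prod.snd_add, Pi.add_apply, add_smul,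
      Finset.sum_add_distrib]
  · simp only [Matrix.add_apply, hermitianOf_lower, Prod.snd_add, Pi.add_apply, add_smul,
      Finset.sum_add_distrib, star_add]

theorem hermitianOf_smul (r : ℝ) (x : Coords n m) :
    hermitianOf b (r • x) = r • hermitianOf b x := by
  refine matrix_ext_upper (fun i => ?_) (fun p => ?_) fun p => ?_
  · simp only [Matrix.smul_apply, hermitianOf_diag, Prod.smul_fst, Pi.smul_apply, smul_eq_mul,
      map_mul]
    rw [Algebra.smul_def]
  · simp only [Matrix.smul_apply, hermitianOf_upper, Prod.smul_snd, Pi.smul_apply, smul_eq_mul,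
      mul_smul, Finset.smul_sum]
  · simp only [Matrix.smul_apply, hermitianOf_lower, Prod.smul_snd, Pi.smul_apply, smul_eq_mul,
      mul_smul, ← Finset.smul_sum, star_smul, star_trivial]

/-- The action of the matrix `U` on the coordinates of selfadjoint matrices by `H ↦ U H U*`. -/
def conjCoords (U : Matrix (Fin n) (Fin n) K) : Coords n m →ₗ[ℝ] Coords n m where
  toFun x := coordsOf b (U * hermitianOf b x * star U)
  map_add' x y := by
    rw [hermitianOf_add, mul_add, add_mul]
    ext <;> simp [coordsOf]
  map_smul' r x := by
    rw [hermitianOf_smul, mul_smul_comm, smul_mul_assoc]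
    ext <;> simp [coordsOf]

theorem hermitianOf_conjCoords (U : Matrix (Fin n) (Fin n) K) (x : Coords n m) :
    hermitianOf b (conjCoords b U x) = U * hermitianOf b x * star U := by
  refine hermitianOf_coordsOf b ?_
  rw [star_mul, star_mul, star_star, star_hermitianOf, mul_assoc]

/-- The sum of the squared norms of the entries. -/
def frobeniusSq (M : Matrix (Fin n) (Fin n) K) : ℝ := ∑ i, ∑ j, ‖M i j‖ ^ 2

theorem frobeniusSq_star (M : Matrix (Fin n) (Fin n) K) : frobeniusSq (star M) = frobeniusSq M := by
  unfold frobeniusSq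
  rw [Finset.sum_comm]
  simp [Matrix.star_apply, norm_star_eq]

theorem vecNormSq_mulVec {U : Matrix (Fin n) (Fin n) K}
    (hU : U ∈ unitary (Matrix (Fin n) (Fin n) K)) (v : Fin n → K) :
    vecNormSq (U.mulVec v) = vecNormSq v := by
  refine algebraMap_real_injective (K := K) ?_
  rw [← star_dotProduct_self, ← star_dotProduct_self, Matrix.star_mulVec,
    ← Matrix.dotProduct_mulVec, Matrix.mulVec_mulVec, ← Matrix.star_eq_conjTranspose,
    Unitary.star_mul_self_of_mem hU, Matrix.one_mulVec]

theorem frobeniusSq_mul {U : Matrix (Fin n) (Fin n) K}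
    (hU : U ∈ unitary (Matrix (Fin n) (Fin n) K)) (M : Matrix (Fin n) (Fin n) K) :
    frobeniusSq (U * M) = frobeniusSq M := by
  unfold frobeniusSq
  rw [Finset.sum_comm, Finset.sum_comm (f := fun i j => ‖M i j‖ ^ 2)]
  exact Finset.sum_congr rfl fun j _ => vecNormSq_mulVec hU fun i => M i j

/-- Left multiplication preserves the norm of each column; right multiplication reduces to it by
taking adjoints. -/
theorem frobeniusSq_conjCoords {U : Matrix (Fin n) (Fin n) K}
    (hU : U ∈ unitary (Matrix (Fin n) (Fin n) K)) (x : Coords n m) :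
    frobeniusSq (hermitianOf b (conjCoords b U x)) = frobeniusSq (hermitianOf b x) := by
  rw [hermitianOf_conjCoords, mul_assoc, frobeniusSq_mul hU, ← frobeniusSq_star, star_mul, star_star,
    frobeniusSq_mul hU, frobeniusSq_star]

theorem sum_upper {f g : Fin n → Fin n → ℝ} (h : Upper n → ℝ)
    (hf : ∀ p : Upper n, f p.1.1 p.1.2 = h p) (hg : ∀ p : Upper n, g p.1.2 p.1.1 = h p)
    {F : Fin n → Fin n → ℝ}
    (hF : ∀ i j, F i j = (if i = j then F i i else 0) + (if i < j then f i j else 0) +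
      (if j < i then g i j else 0)) :
    ∑ i, ∑ j, F i j = ∑ i, F i i + 2 * ∑ p, h p := by
  have key : ∀ u : Fin n → Fin n → ℝ, (∀ p : Upper n, u p.1.1 p.1.2 = h p) →
      ∑ i, ∑ j, (if i < j then u i j else 0) = ∑ p, h p := fun u hu => by
    rw [← Fintype.sum_prod_type' (f := fun i j => if i < j then u i j else 0), ← Finset.sum_filter,
      ← Finset.sum_subtype_eq_sum_filter]
    simp only [subtype_univ]
    exact Finset.sum_congr rfl fun p _ => hu p
  have h1 : ∑ i, ∑ j, F i j = ∑ i, ∑ j, ((if i = j then F i i else 0) +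
      (if i < j then f i j else 0) + (if j < i then g i j else 0)) :=
    Finset.sum_congr rfl fun i _ => Finset.sum_congr rfl fun j _ => hF i j
  rw [h1]
  simp only [Finset.sum_add_distrib]
  rw [key f hf, Finset.sum_comm (f := fun i j => if j < i then g i j else 0),
    key (fun j i => g i j) hg]
  simp only [Finset.sum_ite_eq, mem_univ, if_true]
  ring

theorem frobeniusSq_hermitianOf (hb : ∀ a, ‖a‖ ^ 2 = ∑ k, b.repr a k ^ 2) (x : Coords n m) :
    frobeniusSq (hermitianOf b x) = ∑ i, x.1 i ^ 2 + 2 * ∑ p, ∑ k, x.2 p k ^ 2 := by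
  have hn : ∀ y : Fin m → ℝ, ‖∑ k, y k • b k‖ ^ 2 = ∑ k, y k ^ 2 := fun y => by
    rw [hb, b.repr_sum_self]
  rw [frobeniusSq, sum_upper (f := fun i j => ‖hermitianOf b x i j‖ ^ 2)
    (g := fun i j => ‖hermitianOf b x i j‖ ^ 2) (fun p => ∑ k, x.2 p k ^ 2)
    (fun p => by rw [hermitianOf_upper, hn]) (fun p => by rw [hermitianOf_lower, norm_star_eq, hn])]
  · congr 1
    refine Finset.sum_congr rfl fun i _ => ?_
    rw [hermitianOf_diag, norm_algebraMap', Real.norm_eq_abs, sq_abs]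
  · intro i j
    rcases lt_trichotomy i j with h | rfl | h
    · simp [h, h.ne, h.not_gt]
    · simp
    · simp [h, h.ne', h.not_gt]

end Coordinates

section Invariance

variable {n m : ℕ} {K : Type*} [NormedDivisionRing K] [NormedAlgebra ℝ K] [StarRing K]
  [CompositionStar K] (b : Module.Basis (Fin m) ℝ K)

/-- Variance 1/2 above the diagonal gives these coordinates weight 2, so the exponent is minus half
the squared Frobenius norm. The value of the constant is irrelevant. -/
theorem gaussianEnsemble_eq : ∃ C : ℝ, 0 ≤ C ∧ gaussianEnsemble n m = volume.withDensity fun x =>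
    ENNReal.ofReal (C * Real.exp (-(∑ i, x.1 i ^ 2 + 2 * ∑ p, ∑ k, x.2 p k ^ 2) / 2)) := by
  have hg : ∀ {v : NNReal}, v ≠ 0 →
      SigmaFinite ((volume : Measure ℝ).withDensity (gaussianPDF 0 v)) := fun {v} hv => by
    rw [← gaussianReal_of_var_ne_zero _ hv]; infer_instance
  have h1 : (1 : NNReal) ≠ 0 := one_ne_zero
  have h2 : (1 / 2 : NNReal) ≠ 0 := by norm_num
  have := hg h1
  have := hg h2
  have hm : ∀ v : NNReal, Measurable (gaussianPDF 0 v) := measurable_gaussianPDF 0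
  have e1 : (Measure.pi fun _ : Fin n => gaussianReal 0 1) =
      volume.withDensity fun x => ∏ i, gaussianPDF 0 1 (x i) := by
    rw [gaussianReal_of_var_ne_zero _ h1, pi_withDensity _ fun _ => hm 1, volume_pi]
  have e2 : (Measure.pi fun _ : Fin m => gaussianReal 0 (1 / 2)) =
      volume.withDensity fun y => ∏ k, gaussianPDF 0 (1 / 2) (y k) := by
    rw [gaussianReal_of_var_ne_zero _ h2, pi_withDensity _ fun _ => hm (1 / 2), volume_pi]
  have hs2 : SigmaFinite ((volume : Measure (Fin m → ℝ)).withDensity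
      fun y => ∏ k, gaussianPDF 0 (1 / 2) (y k)) := by rw [← e2]; infer_instance
  have e3 : (Measure.pi fun _ : Upper n => Measure.pi fun _ : Fin m => gaussianReal 0 (1 / 2)) =
      volume.withDensity fun y => ∏ p, ∏ k, gaussianPDF 0 (1 / 2) (y p k) := by
    simp only [e2]
    rw [pi_withDensity _ fun _ => by fun_prop]
    rfl
  have hs3 : SFinite ((volume : Measure (Upper n → Fin m → ℝ)).withDensity
      fun y => ∏ p, ∏ k, gaussianPDF 0 (1 / 2) (y p k)) := by rw [← e3]; infer_instance
  refine ⟨(∏ _i : Fin n, (√(2 * Real.pi))⁻¹) * ∏ _p : Upper n, ∏ _k : Fin m, (√Real.pi)⁻¹,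
    by positivity, ?_⟩
  rw [gaussianEnsemble, e1, e3, prod_withDensity (by fun_prop) (by fun_prop)]
  congr 1
  funext x
  have d1 : ∏ i, gaussianPDF 0 1 (x.1 i) =
      ENNReal.ofReal ((∏ _i : Fin n, (√(2 * Real.pi))⁻¹) * Real.exp (∑ i, -(x.1 i ^ 2 / 2))) := by
    rw [Real.exp_sum, ← Finset.prod_mul_distrib, ENNReal.ofReal_prod_of_nonneg fun _ _ => by positivity]
    refine Finset.prod_congr rfl fun i _ => ?_
    rw [gaussianPDF, gaussianPDFReal]
    simp [neg_div]
  have d2 : ∏ p, ∏ k, gaussianPDF 0 (1 / 2) (x.2 p k) =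
      ENNReal.ofReal ((∏ _p : Upper n, ∏ _k : Fin m, (√Real.pi)⁻¹) *
        Real.exp (∑ p, ∑ k, -x.2 p k ^ 2)) := by
    rw [Real.exp_sum, ← Finset.prod_mul_distrib, ENNReal.ofReal_prod_of_nonneg fun _ _ => by positivity]
    refine Finset.prod_congr rfl fun p _ => ?_
    rw [Real.exp_sum, ← Finset.prod_mul_distrib, ENNReal.ofReal_prod_of_nonneg fun _ _ => by positivity]
    refine Finset.prod_congr rfl fun k _ => ?_
    rw [gaussianPDF, gaussianPDFReal_zero_half]
  rw [d1, d2, ← ENNReal.ofReal_mul (by positivity), mul_mul_mul_comm, ← Real.exp_add]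
  congr 3
  simp only [Finset.sum_neg_distrib, ← Finset.sum_div]
  ring

/-- The density is invariant, and an invertible linear map multiplies Lebesgue measure by a
constant. Comparison of total masses shows that this constant is 1, without computing a determinant.
-/
theorem measurePreserving_conjCoords (hb : ∀ a, ‖a‖ ^ 2 = ∑ k, b.repr a k ^ 2)
    {U : Matrix (Fin n) (Fin n) K} (hU : U ∈ unitary (Matrix (Fin n) (Fin n) K)) :
    MeasurePreserving (conjCoords b U) (gaussianEnsemble n m) (gaussianEnsemble n m) := by
  have : IsProbabilityMeasure (gaussianEnsemble n m) := by unfold gaussianEnsemble; infer_instance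
  have hLm : Measurable (conjCoords b U) :=
    (LinearMap.continuous_of_finiteDimensional (conjCoords (n := n) b U)).measurable
  refine ⟨hLm, ?_⟩
  obtain ⟨C, hC, hE⟩ := gaussianEnsemble_eq (n := n) (m := m)
  set d : Coords n m → ℝ≥0∞ := fun x =>
    ENNReal.ofReal (C * Real.exp (-(∑ i, x.1 i ^ 2 + 2 * ∑ p, ∑ k, x.2 p k ^ 2) / 2)) with hd
  have hdm : Measurable d := by fun_prop
  have hq : ∀ x, d (conjCoords b U x) = d x := fun x => by
    simp only [hd]
    rw [← frobeniusSq_hermitianOf b hb, ← frobeniusSq_hermitianOf b hb, frobeniusSq_conjCoords b hU]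
  -- A kernel element has vanishing Frobenius norm, so all its coordinates are zero.
  have hdet : LinearMap.det (conjCoords (n := n) b U) ≠ 0 := by
    intro h0
    refine (LinearMap.bot_lt_ker_of_det_eq_zero h0).ne' ?_
    refine LinearMap.ker_eq_bot'.mpr fun x hx => ?_
    have h1 := frobeniusSq_conjCoords b hU x
    have h2 : frobeniusSq (hermitianOf b x) = 0 := by
      rw [← h1, hx, frobeniusSq_hermitianOf b hb]
      simp
    rw [frobeniusSq_hermitianOf b hb] at h2
    have p1 : 0 ≤ ∑ i, x.1 i ^ 2 := Finset.sum_nonneg fun _ _ => sq_nonneg _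
    have p2 : 0 ≤ ∑ p, ∑ k, x.2 p k ^ 2 :=
      Finset.sum_nonneg fun _ _ => Finset.sum_nonneg fun _ _ => sq_nonneg _
    have z1 : ∑ i, x.1 i ^ 2 = 0 := by linarith
    have z2 : ∑ p, ∑ k, x.2 p k ^ 2 = 0 := by linarith
    rw [Finset.sum_eq_zero_iff_of_nonneg fun _ _ => sq_nonneg _] at z1
    rw [Finset.sum_eq_zero_iff_of_nonneg fun _ _ => Finset.sum_nonneg fun _ _ => sq_nonneg _] at z2
    refine Prod.ext (funext fun i => ?_) (funext fun p => funext fun k => ?_)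
    · simpa using z1 i (mem_univ i)
    · have := z2 p (mem_univ p)
      rw [Finset.sum_eq_zero_iff_of_nonneg fun _ _ => sq_nonneg _] at this
      simpa using this k (mem_univ k)
  have : (volume : Measure (Coords n m)).IsAddHaarMeasure := by
    have : ∀ _ : Upper n, (volume : Measure (Fin m → ℝ)).IsAddHaarMeasure := fun _ => inferInstance
    have : (volume : Measure (Upper n → Fin m → ℝ)).IsAddHaarMeasure :=
      Measure.pi.isAddHaarMeasure fun _ : Upper n => (volume : Measure (Fin m → ℝ))
    exact Measure.prod.instIsAddHaarMeasure volume volume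
  set c : ℝ≥0∞ := ENNReal.ofReal |(LinearMap.det (conjCoords (n := n) b U))⁻¹| with hc
  have hmap : (gaussianEnsemble n m).map (conjCoords b U) = c • gaussianEnsemble n m := by
    have h1 : (volume.map (conjCoords (n := n) b U)) = c • (volume : Measure (Coords n m)) :=
      Measure.map_linearMap_addHaar_eq_smul_addHaar _ hdet
    rw [hE, ← withDensity_smul_measure, ← h1, withDensity_map _ hLm hdm]
    congr 2
    funext x
    exact (hq x).symm
  have hc1 : c = 1 := by
    have h1 := congrArg (fun μ => μ Set.univ) hmap
    simp only [Measure.map_apply hLm MeasurableSet.univ, Set.preimage_univ, Measure.smul_apply,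
      measure_univ, smul_eq_mul, mul_one] at h1
    exact h1.symm
  rw [hmap, hc1, one_smul]

end Invariance

end RankOne
end

noncomputable section

namespace RankOne

open Finset
open scoped ENNReal

/-! ### Reduction of the Gaussian ensembles to tridiagonal form -/

set_option linter.unusedSectionVars false

section Split

variable {n m : ℕ}

/-- The positions above the diagonal, divided into the first row and the rest. -/
def upperEquiv (n : ℕ) : Fin n ⊕ Upper n ≃ Upper (n + 1) :=
  Equiv.ofBijective
    (Sum.elim (fun j => ⟨(0, j.succ), Fin.succ_pos j⟩)
      fun p => ⟨(p.1.1.succ, p.1.2.succ), Fin.succ_lt_succ_iff.mpr p.2⟩) <| by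
    constructor
    · rintro (i | ⟨⟨i, j⟩, h⟩) (i' | ⟨⟨i', j'⟩, h'⟩) <;>
        simp [Fin.succ_ne_zero, (Fin.succ_ne_zero _).symm]
    · rintro ⟨⟨i, j⟩, h⟩
      obtain ⟨j, rfl⟩ := Fin.exists_succ_eq.mpr (Fin.ne_zero_of_lt h)
      induction i using Fin.cases with
      | zero => exact ⟨Sum.inl j, rfl⟩
      | succ i => exact ⟨Sum.inr ⟨(i, j), Fin.succ_lt_succ_iff.mp h⟩, rfl⟩

/-- The coordinates of the first row to the right of the diagonal. -/
def coordsRow (x : Coords (n + 1) m) : Fin n → Fin m → ℝ :=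
  fun j => x.2 ⟨(0, j.succ), Fin.succ_pos j⟩

/-- The coordinates of the matrix without its first row and column. -/
def coordsTail (x : Coords (n + 1) m) : Coords n m :=
  (Fin.tail x.1, fun p => x.2 ⟨(p.1.1.succ, p.1.2.succ), Fin.succ_lt_succ_iff.mpr p.2⟩)

theorem measurePreserving_coordsSplit (n m : ℕ) :
    MeasurePreserving (fun x : Coords (n + 1) m => ((coordsRow x, coordsTail x), x.1 0))
      (gaussianEnsemble (n + 1) m)
      (((Measure.pi fun _ : Fin n => Measure.pi fun _ : Fin m => gaussianReal 0 (1 / 2)).prod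
        (gaussianEnsemble n m)).prod (gaussianReal 0 1)) := by
  set g := Measure.pi fun _ : Fin m => gaussianReal 0 (1 / 2)
  set G := gaussianReal 0 1
  set D := Measure.pi fun _ : Fin n => G
  set R := Measure.pi fun _ : Fin n => g
  set O := Measure.pi fun _ : Upper n => g
  have h1 : MeasurePreserving (fun d : Fin (n + 1) → ℝ => (d 0, Fin.tail d))
      (Measure.pi fun _ => G) (G.prod D) :=
    measurePreserving_piFinSuccAbove (fun _ : Fin (n + 1) => G) 0
  have h2 : MeasurePreserving (fun y : Upper (n + 1) → Fin m → ℝ =>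
      ((fun j => y (upperEquiv n (Sum.inl j)) : Fin n → Fin m → ℝ),
        (fun p => y (upperEquiv n (Sum.inr p)) : Upper n → Fin m → ℝ)))
      (Measure.pi fun _ => g) (R.prod O) :=
    (measurePreserving_sumPiEquivProdPi (fun _ : Fin n ⊕ Upper n => g)).comp
      (measurePreserving_piCongrLeft (fun _ : Upper (n + 1) => g) (upperEquiv n)).symm
  have e1 := measurePreserving_prodAssoc G D (R.prod O)
  have e2 := Measure.measurePreserving_swap (μ := G) (ν := D.prod (R.prod O))
  have e3 := (measurePreserving_prodAssoc D R O).symm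
  have e4 := (Measure.measurePreserving_swap (μ := D) (ν := R)).prod (MeasurePreserving.id O)
  have e5 := measurePreserving_prodAssoc R D O
  have e6 := (e5.comp (e4.comp e3)).prod (MeasurePreserving.id G)
  exact e6.comp (e2.comp (e1.comp (h1.prod h2)))

end Split

section Block

variable {n m : ℕ} {K : Type*} [NormedDivisionRing K] [NormedAlgebra ℝ K] [StarRing K]
  [CompositionStar K] (b : Module.Basis (Fin m) ℝ K)

theorem star_block (a : K) (r c : Fin n → K) (M : Matrix (Fin n) (Fin n) K) :
    star (block a r c M) = block (star a) (star c) (star r) (star M) := by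
  ext i j
  rw [Matrix.star_apply]
  refine Fin.cases ?_ (fun i => ?_) i <;> refine Fin.cases ?_ (fun j => ?_) j <;> rfl

theorem block_mem_unitary {U : Matrix (Fin n) (Fin n) K}
    (hU : U ∈ unitary (Matrix (Fin n) (Fin n) K)) :
    block 1 0 0 U ∈ unitary (Matrix (Fin (n + 1)) (Fin (n + 1)) K) := by
  have h : ∀ A B : Matrix (Fin n) (Fin n) K, A * B = 1 →
      block 1 0 0 A * block 1 0 0 B = 1 := fun A B hAB => by
    rw [block_mul_block, ← block_one, ← hAB]
    congr 1
    · simp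
    · funext; simp
    · funext; simp
    · ext i j; simp [Matrix.mul_apply]
  rw [Unitary.mem_iff, star_block, star_one, star_zero]
  exact ⟨h _ _ (Unitary.star_mul_self_of_mem hU), h _ _ (Unitary.mul_star_self_of_mem hU)⟩

/-- The first column of a selfadjoint matrix, below the diagonal. -/
def firstColumn (y : Fin n → Fin m → ℝ) : Fin n → K := fun j => star (∑ k, y j k • b k)

theorem hermitianOf_eq_block (x : Coords (n + 1) m) :
    hermitianOf b x = block (algebraMap ℝ K (x.1 0)) (star (firstColumn b (coordsRow x)))
      (firstColumn b (coordsRow x)) (hermitianOf b (coordsTail x)) := by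
  ext i j
  refine Fin.cases ?_ (fun i => ?_) i <;> refine Fin.cases ?_ (fun j => ?_) j
  · exact hermitianOf_diag b x 0
  · refine (hermitianOf_upper b x ⟨(0, j.succ), Fin.succ_pos j⟩).trans ?_
    simp [firstColumn, coordsRow]
  · exact hermitianOf_lower b x ⟨(0, i.succ), Fin.succ_pos i⟩
  · simp [hermitianOf, coordsTail, Fin.tail]

theorem vecNormSq_firstColumn (hb : ∀ a, ‖a‖ ^ 2 = ∑ k, b.repr a k ^ 2) (y : Fin n → Fin m → ℝ) :
    vecNormSq (firstColumn b y) = ∑ i, ∑ k, y i k ^ 2 := by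
  refine Finset.sum_congr rfl fun i _ => ?_
  rw [firstColumn, norm_star_eq, hb, b.repr_sum_self]

/-- U turns the border c into |c| e₀, and W, whose first row and column are those of the identity,
leaves this border alone while carrying the rotated minor to T. -/
theorem block_mul_hermitian {W U H : Matrix (Fin (n + 1)) (Fin (n + 1)) K}
    {T : Matrix (Fin (n + 1)) (Fin (n + 1)) K} {c : Fin (n + 1) → K} (a : K) (hUc : U = rotation c)
    (hcol : ∀ i, W i 0 = (Pi.single 0 1 : Fin (n + 1) → K) i)
    (hrow : ∀ j, W 0 j = (Pi.single 0 1 : Fin (n + 1) → K) j)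
    (h : W * (U * H * star U) = T * W) :
    block 1 0 0 (W * U) * block a (star c) c H =
      block a (Pi.single 0 (algebraMap ℝ K √(vecNormSq c)))
        (Pi.single 0 (algebraMap ℝ K √(vecNormSq c))) T * block 1 0 0 (W * U) := by
  have hU : U ∈ unitary (Matrix (Fin (n + 1)) (Fin (n + 1)) K) := hUc ▸ rotation_mem_unitary c
  rw [block_mul_block, block_mul_block]
  congr 1
  · simp
  · funext j
    have h1 : (W * U) 0 j = U 0 j := by
      rw [Matrix.mul_apply]
      simp [hrow, Pi.single_apply]
    simp only [one_mul, Pi.star_apply, Pi.zero_apply, zero_mul, Finset.sum_const_zero, add_zero,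
      mul_zero, zero_add, Pi.single_apply, ite_mul, Finset.sum_ite_eq', mem_univ, if_true]
    rw [h1, star_eq_rotation_mul, hUc]
  · funext i
    have h1 : ((W * U).mulVec c) i =
        (Pi.single 0 (algebraMap ℝ K √(vecNormSq c)) : Fin (n + 1) → K) i := by
      rw [← Matrix.mulVec_mulVec, hUc, rotation_mulVec, Matrix.mulVec_single]
      simp only [Pi.smul_apply, op_smul_eq_mul, Matrix.col_apply, hcol]
      by_cases hi : i = 0 <;> simp [hi]
    simp only [Pi.zero_apply, zero_mul, zero_add, mul_one, mul_zero, Finset.sum_const_zero, add_zero]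
    exact h1
  · have h2 : W * U * H = T * (W * U) := by
      rw [← mul_assoc T, ← h]
      simp only [mul_assoc]
      rw [Unitary.star_mul_self_of_mem hU, mul_one]
    ext i j
    simpa [Matrix.mul_apply] using congrFun (congrFun h2 i) j

end Block

section Tridiagonalization

variable {n m : ℕ} {K : Type*} [NormedDivisionRing K] [NormedAlgebra ℝ K] [StarRing K]
  [CompositionStar K] [ContinuousStar K] [SecondCountableTopology K] [MeasurableSpace K]
  [BorelSpace K]

theorem measurable_hermitianOf (b : Module.Basis (Fin m) ℝ K) (i j : Fin n) :
    Measurable fun x : Coords n m => hermitianOf b x i j := by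
  have := Module.Finite.of_basis b
  let f : Coords n m →ₗ[ℝ] K :=
    { toFun := fun x => hermitianOf b x i j
      map_add' := fun x y => by rw [hermitianOf_add]; rfl
      map_smul' := fun r x => by rw [hermitianOf_smul]; rfl }
  exact (LinearMap.continuous_of_finiteDimensional f).measurable

theorem measurable_coordsOf (b : Module.Basis (Fin m) ℝ K) {Ω : Type*} [MeasurableSpace Ω]
    {A : Ω → Matrix (Fin n) (Fin n) K} (hA : ∀ i j, Measurable fun ω => A ω i j) :
    Measurable fun ω => coordsOf b (A ω) := by
  have := Module.Finite.of_basis b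
  refine Measurable.prodMk (measurable_pi_iff.mpr fun i => ?_)
    (measurable_pi_iff.mpr fun p => measurable_pi_iff.mpr fun k => ?_)
  · exact (LinearMap.continuous_of_finiteDimensional (realPart K)).measurable.comp (hA i i)
  · exact (LinearMap.continuous_of_finiteDimensional (b.coord k)).measurable.comp (hA _ _)

theorem measurable_firstColumn (b : Module.Basis (Fin m) ℝ K) :
    Measurable (firstColumn b : (Fin n → Fin m → ℝ) → Fin n → K) := by
  refine measurable_pi_iff.mpr fun j => measurable_star_real.comp ?_
  fun_prop

/-- The rotation depends on the random column, so the skew product needs measurability jointly in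
column and minor. -/
theorem measurable_conjCoords_rotation (b : Module.Basis (Fin m) ℝ K) :
    Measurable (Function.uncurry fun (y : Fin (n + 1) → Fin m → ℝ) (x : Coords (n + 1) m) =>
      conjCoords b (rotation (firstColumn b y)) x) := by
  have hU : ∀ i j, Measurable fun p : (Fin (n + 1) → Fin m → ℝ) × Coords (n + 1) m =>
      rotation (firstColumn b p.1) i j := fun i j =>
    (measurable_rotation i j).comp ((measurable_firstColumn b).comp measurable_fst)
  refine measurable_coordsOf b (A := fun p : (Fin (n + 1) → Fin m → ℝ) × Coords (n + 1) m =>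
    rotation (firstColumn b p.1) * hermitianOf b p.2 * star (rotation (firstColumn b p.1))) ?_
  refine measurable_matrix_mul (measurable_matrix_mul hU fun i j =>
    (measurable_hermitianOf b i j).comp measurable_snd) fun i j => ?_
  simp only [Matrix.star_apply]
  exact measurable_star_real.comp (hU j i)

/-- The matrix of the ensemble is conjugate to a tridiagonal matrix with the law `jacobiLaw` under a
unitary matrix that fixes the first unit vector. -/
theorem exists_tridiagonalization {β : ℝ} (hβ : β = (m : ℝ) + 1) (b : Module.Basis (Fin (m + 1)) ℝ K)
    (hb : ∀ a, ‖a‖ ^ 2 = ∑ k, b.repr a k ^ 2) (n : ℕ) :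
    ∃ Φ : Coords (n + 1) (m + 1) → (Fin (n + 1) → ℝ) × (Fin n → ℝ),
      MeasurePreserving Φ (gaussianEnsemble (n + 1) (m + 1)) (jacobiLaw β n) ∧
      ∀ x, ∃ W ∈ unitary (Matrix (Fin (n + 1)) (Fin (n + 1)) K),
        (∀ i, W i 0 = (Pi.single 0 1 : Fin (n + 1) → K) i) ∧
        (∀ j, W 0 j = (Pi.single 0 1 : Fin (n + 1) → K) j) ∧
        W * hermitianOf b x = (jacobiMatrix (Φ x)).map (algebraMap ℝ K) * W := by
  have hβ0 : 0 < β := by rw [hβ]; positivity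
  induction n with
  | zero =>
    have hP := fun i : Fin 0 => isProbabilityMeasure_chiTilde (chiTilde_index_pos hβ0 i)
    refine ⟨fun x => (x.1, Fin.elim0), ?_, fun x => ⟨1, one_mem _, fun i => ?_, fun j => ?_, ?_⟩⟩
    · refine (MeasurePreserving.id _).prod (g := fun _ => Fin.elim0) ⟨measurable_const, ?_⟩
      rw [Measure.map_const, measure_univ, one_smul, Measure.pi_of_empty _ Fin.elim0]
    · rw [Fin.fin_one_eq_zero i]; simp
    · rw [Fin.fin_one_eq_zero j]; simp
    · rw [one_mul, mul_one]
      ext i j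
      rw [Fin.fin_one_eq_zero i, Fin.fin_one_eq_zero j, hermitianOf_diag, Matrix.map_apply,
        jacobiMatrix_zero_zero]
  | succ n ih =>
    obtain ⟨Φ, hΦ, hW⟩ := ih
    have hk : 0 < ((n : ℝ) + 1) * (β / 2) := by positivity
    have := isProbabilityMeasure_gammaMeasure hk one_pos
    have := isProbabilityMeasure_jacobiLaw hβ0 n
    have : IsProbabilityMeasure (gaussianEnsemble (n + 1) (m + 1)) := by
      unfold gaussianEnsemble; infer_instance
    set R := Measure.pi fun _ : Fin (n + 1) => Measure.pi fun _ : Fin (m + 1) =>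
      gaussianReal 0 (1 / 2) with hR
    have h1 := measurePreserving_sum_sum_sq_gaussianReal n m
    rw [← hβ] at h1
    -- For each fixed column the rotated minor has the law of the ensemble, by unitary invariance.
    -- Thus the squared length of the column and the reduced minor are independent, although the
    -- rotation depends on the column.
    have h2 := h1.skew_product (μc := gaussianEnsemble (n + 1) (m + 1)) (μd := jacobiLaw β n)
      (g := fun y x => Φ (conjCoords b (rotation (firstColumn b y)) x))
      (hΦ.measurable.comp (measurable_conjCoords_rotation b)) (Eventually.of_forall fun y =>
        (hΦ.comp (measurePreserving_conjCoords b hb (rotation_mem_unitary (firstColumn b y)))).map_eq)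
    have h3 := (Measure.measurePreserving_swap.comp h2).prod (MeasurePreserving.id (gaussianReal 0 1))
    have h4 := (measurePreserving_jacobiCons hβ0 n).comp
      (h3.comp (measurePreserving_coordsSplit (n + 1) (m + 1)))
    refine ⟨_, h4, fun x => ?_⟩
    set c : Fin (n + 1) → K := firstColumn b (coordsRow x) with hc
    obtain ⟨W, hWu, hcol, hrow, hWH⟩ := hW (conjCoords b (rotation c) (coordsTail x))
    refine ⟨block 1 0 0 (W * rotation c), block_mem_unitary (mul_mem hWu (rotation_mem_unitary c)),
      fun i => ?_, fun j => ?_, ?_⟩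
    · refine Fin.cases ?_ (fun i => ?_) i <;> simp
    · refine Fin.cases ?_ (fun i => ?_) j <;> simp
    · rw [hermitianOf_conjCoords] at hWH
      rw [hermitianOf_eq_block, ← hc, block_mul_hermitian _ rfl hcol hrow hWH]
      congr 1
      simp only [Function.comp_apply, Prod.map_apply, id_eq, Prod.swap_prod_mk, jacobiCons]
      rw [jacobiMatrix_cons, hc, vecNormSq_firstColumn b hb]
      ext i j
      rw [Matrix.map_apply]
      refine Fin.cases ?_ (fun i => ?_) i <;> refine Fin.cases ?_ (fun j => ?_) j
      · rfl
      · simp only [block_zero_succ, Pi.single_apply]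
        split_ifs <;> simp
      · simp only [block_succ_zero, Pi.single_apply]
        split_ifs <;> simp
      · rfl

end Tridiagonalization

end RankOne
end

noncomputable section

namespace RankOne

open Finset
open scoped ENNReal

/-! ### Rank one perturbations of the Gaussian ensembles -/

set_option linter.unusedSectionVars false

/-! ### Transfer of eigenvalue densities along measure preserving maps. -/

section Transfer

theorem HasOrderedEigenvaluePDF.congr_density {Ω : Type*} [MeasurableSpace Ω] {N : ℕ} {K : Type*}
    [Ring K] [Algebra ℝ K] {P : Measure Ω} {H : Ω → Matrix (Fin N) (Fin N) K}
    {f g : (Fin N → ℝ) → ℝ} (h : HasOrderedEigenvaluePDF P H f)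
    (hfg : ∀ l, StrictAnti l → f l = g l) : HasOrderedEigenvaluePDF P H g := by
  obtain ⟨h0, Λ, hΛ, hs, hmap⟩ := h
  refine ⟨fun l hl => hfg l hl ▸ h0 l hl, Λ, hΛ, hs, hmap.trans (withDensity_congr_ae ?_)⟩
  filter_upwards [ae_restrict_mem measurableSet_strictAnti] with l hl
  rw [hfg l hl]

theorem HasOrderedEigenvaluePDF.comp {Ω Ω' : Type*} [MeasurableSpace Ω] [MeasurableSpace Ω'] {N : ℕ}
    {K K' : Type*} [Ring K] [Algebra ℝ K] [Ring K'] [Algebra ℝ K'] {P : Measure Ω} {P' : Measure Ω'}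
    {H : Ω → Matrix (Fin N) (Fin N) K} {H' : Ω' → Matrix (Fin N) (Fin N) K'}
    {f : (Fin N → ℝ) → ℝ} (h : HasOrderedEigenvaluePDF P H f) {Φ : Ω' → Ω}
    (hΦ : MeasurePreserving Φ P' P)
    (hH : ∀ x l, IsOrderedSpectrum (H (Φ x)) l → IsOrderedSpectrum (H' x) l) :
    HasOrderedEigenvaluePDF P' H' f := by
  obtain ⟨h0, Λ, hΛ, hs, hmap⟩ := h
  refine ⟨h0, Λ ∘ Φ, hΛ.comp_quasiMeasurePreserving hΦ.quasiMeasurePreserving, ?_, ?_⟩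
  · filter_upwards [hΦ.quasiMeasurePreserving.ae hs] with x hx using hH x _ hx
  · rw [← hmap, ← hΦ.map_eq, AEMeasurable.map_map_of_aemeasurable (by rwa [hΦ.map_eq])
      hΦ.measurable.aemeasurable]

end Transfer

/-! ### The rank one term as a shift of the corner. -/

section Perturbation

variable {n m : ℕ}

theorem measurePreserving_shiftCorner {β : ℝ} (hβ : 0 < β) (α : ℝ) (n : ℕ) :
    MeasurePreserving (fun x : (Fin (n + 1) → ℝ) × (Fin n → ℝ) =>
      (x.1 + Pi.single 0 (α * √(2 * β * (n + 1 : ℕ))), x.2)) (jacobiLaw β n)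
      (tridiagonalLaw (n + 1) β α) := by
  have hP := fun i : Fin n => isProbabilityMeasure_chiTilde (chiTilde_index_pos hβ i)
  set s : ℝ := α * √(2 * β * (n + 1 : ℕ)) with hs
  have h1 := measurePreserving_pi (fun _ : Fin (n + 1) => gaussianReal 0 1)
    (fun i : Fin (n + 1) => gaussianReal (if i.1 = 0 then s else 0) 1)
    (f := fun i x => x + (Pi.single 0 s : Fin (n + 1) → ℝ) i) fun i => by
      refine ⟨by fun_prop, ?_⟩
      rw [gaussianReal_map_add_const, zero_add, Pi.single_apply]
      exact congrArg (gaussianReal · 1) (if_congr Fin.ext_iff rfl rfl)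
  have h2 : (Measure.pi fun i : Fin n => chiTilde (β * (((n + 1 : ℕ) : ℝ) - 1 - (i.1 : ℝ)))) =
      Measure.pi fun i : Fin n => chiTilde (β * ((n : ℝ) - i.1)) := by
    congr 1; funext i; push_cast; ring_nf
  have h3 := h1.prod (MeasurePreserving.id
    (Measure.pi fun i : Fin n => chiTilde (β * ((n : ℝ) - i.1))))
  refine ⟨h3.measurable, h3.map_eq.trans ?_⟩
  rw [← h2, hs]
  rfl

theorem jacobiMatrix_add_single (x : (Fin (n + 1) → ℝ) × (Fin n → ℝ)) (s : ℝ) :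
    jacobiMatrix (x.1 + Pi.single 0 s, x.2) = jacobiMatrix x + Matrix.single 0 0 s := by
  ext i j
  rw [Matrix.add_apply, Matrix.single_apply]
  simp only [jacobiMatrix, Matrix.of_apply, Pi.add_apply, Pi.single_apply]
  by_cases hij : i = j
  · subst hij
    by_cases hi : i = 0
    · simp [hi]
    · simp [hi, Ne.symm hi]
  · have : ¬(0 = i ∧ 0 = j) := fun h => hij (h.1.symm.trans h.2)
    simp [hij, this]

variable {K : Type*} [NormedDivisionRing K] [NormedAlgebra ℝ K] [StarRing K]
  [CompositionStar K]

/-- If v is a real eigenvector of T, then W* v is one of H. The entries of T and v are real and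
hence central, so noncommutativity of K does no harm. -/
theorem IsOrderedSpectrum.of_unitary {T : Matrix (Fin n) (Fin n) ℝ} {H W : Matrix (Fin n) (Fin n) K}
    (hW : W ∈ unitary (Matrix (Fin n) (Fin n) K)) (h : W * H = T.map (algebraMap ℝ K) * W)
    {l : Fin n → ℝ} (hT : IsOrderedSpectrum T l) : IsOrderedSpectrum H l := by
  refine ⟨hT.1, fun j => ?_⟩
  obtain ⟨v, hv0, hv⟩ := hT.2 j
  set u : Fin n → K := fun i => algebraMap ℝ K (v i) with hu
  have hTu : (T.map (algebraMap ℝ K)).mulVec u = l j • u := by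
    funext i
    have h1 := congrFun hv i
    simp only [Matrix.mulVec, dotProduct, Pi.smul_apply, smul_eq_mul] at h1
    simp only [Matrix.mulVec, dotProduct, Matrix.map_apply, hu, Pi.smul_apply]
    rw [Algebra.smul_def, ← map_mul, ← h1, map_sum]
    exact Finset.sum_congr rfl fun k _ => (map_mul _ _ _).symm
  have hHW : H * star W = star W * T.map (algebraMap ℝ K) := by
    calc H * star W = star W * (W * H) * star W := by
          rw [← mul_assoc, Unitary.star_mul_self_of_mem hW, one_mul]
      _ = star W * T.map (algebraMap ℝ K) := by
          rw [h, mul_assoc, mul_assoc, Unitary.mul_star_self_of_mem hW, mul_one]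
  refine ⟨(star W).mulVec u, fun h0 => hv0 ?_, ?_⟩
  · have h1 : u = 0 := by
      rw [← Matrix.one_mulVec u, ← Unitary.mul_star_self_of_mem hW, ← Matrix.mulVec_mulVec, h0,
        Matrix.mulVec_zero]
    funext i
    exact algebraMap_real_injective (K := K) ((congrFun h1 i).trans (map_zero _).symm)
  · rw [Matrix.mulVec_mulVec, hHW, ← Matrix.mulVec_mulVec, hTu, Matrix.mulVec_smul]

theorem vecNormSq_unitOnes : vecNormSq (unitOnes (n + 1) K) = 1 := by
  have h : ∀ i, ‖unitOnes (n + 1) K i‖ ^ 2 = 1 / (n + 1 : ℕ) := fun i => by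
    rw [unitOnes, norm_algebraMap', Real.norm_eq_abs, sq_abs, div_pow, Real.sq_sqrt (by positivity),
      one_pow]
  unfold vecNormSq
  simp only [h]
  rw [Finset.sum_const, card_univ, Fintype.card_fin, nsmul_eq_mul, mul_one_div_cancel]
  positivity

theorem unitOnes_eq_rotation (j : Fin (n + 1)) :
    unitOnes (n + 1) K j = rotation (unitOnes (n + 1) K) 0 j := by
  have h := star_eq_rotation_mul (unitOnes (n + 1) K) j
  rw [vecNormSq_unitOnes, Real.sqrt_one, map_one, one_mul] at h
  rw [← h, unitOnes, star_algebraMap_real]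

theorem rankOnePerturbed_eq {β : ℝ} (hβ : 0 < β) (α : ℝ) (H : Matrix (Fin (n + 1)) (Fin (n + 1)) K) :
    rankOnePerturbed β α H = (1 / √(2 * β * (n + 1 : ℕ))) • (H + (α * √(2 * β * (n + 1 : ℕ))) •
      Matrix.vecMulVec (unitOnes (n + 1) K) (unitOnes (n + 1) K)) := by
  have hσ : 0 < √(2 * β * (n + 1 : ℕ)) := Real.sqrt_pos.mpr (by positivity)
  rw [rankOnePerturbed, smul_add, smul_smul]
  congr 2
  field_simp

/-- The unitary matrix WQ maps u to e₀, and its first row is uᵀ because u is real. Hence WQ u uᵀ =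
e₀ uᵀ = e₀ e₀ᵀ WQ. -/
theorem unitary_mul_rankOne {W H T : Matrix (Fin (n + 1)) (Fin (n + 1)) K} (s : ℝ)
    (hcol : ∀ i, W i 0 = (Pi.single 0 1 : Fin (n + 1) → K) i)
    (hrow : ∀ j, W 0 j = (Pi.single 0 1 : Fin (n + 1) → K) j)
    (h : W * (rotation (unitOnes (n + 1) K) * H * star (rotation (unitOnes (n + 1) K))) = T * W) :
    W * rotation (unitOnes (n + 1) K) *
        (H + s • Matrix.vecMulVec (unitOnes (n + 1) K) (unitOnes (n + 1) K)) =
      (T + Matrix.single 0 0 (algebraMap ℝ K s)) * (W * rotation (unitOnes (n + 1) K)) := by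
  set u := unitOnes (n + 1) K with hu
  set Q := rotation u with hQdef
  have hQ : Q ∈ unitary (Matrix (Fin (n + 1)) (Fin (n + 1)) K) := rotation_mem_unitary u
  have h1 : W * Q * H = T * (W * Q) := by
    rw [← mul_assoc T, ← h]
    simp only [mul_assoc]
    rw [Unitary.star_mul_self_of_mem hQ, mul_one]
  have h2 : (W * Q).mulVec u = Pi.single 0 1 := by
    rw [← Matrix.mulVec_mulVec, rotation_mulVec, vecNormSq_unitOnes, Real.sqrt_one, map_one,
      Matrix.mulVec_single]
    funext i
    simp [Matrix.col_apply, hcol]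
  have h3 : ∀ j, (W * Q) 0 j = u j := fun j => by
    rw [Matrix.mul_apply, hu, unitOnes_eq_rotation]
    simp [hrow, Pi.single_apply, hQdef, hu]
  rw [mul_add, add_mul, h1, mul_smul_comm, Matrix.mul_vecMulVec, h2]
  congr 1
  ext i j
  rw [Matrix.smul_apply, Matrix.vecMulVec_apply]
  by_cases hi : i = 0
  · subst hi
    rw [Matrix.single_mul_apply_same, h3, Pi.single_eq_same, one_mul, Algebra.smul_def]
  · rw [Matrix.single_mul_apply_of_ne _ _ _ _ _ hi, Pi.single_eq_of_ne hi, zero_mul, smul_zero]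

variable [ContinuousStar K] [SecondCountableTopology K] [MeasurableSpace K] [BorelSpace K]

/-- A deterministic rotation, under which the ensemble is invariant, moves the perturbation to the
corner; the tridiagonalization fixes the first unit vector and so leaves it there. -/
theorem HasOrderedEigenvaluePDF.rankOnePerturbed {β : ℝ} (hβ : β = (m : ℝ) + 1)
    (b : Module.Basis (Fin (m + 1)) ℝ K) (hb : ∀ a, ‖a‖ ^ 2 = ∑ k, b.repr a k ^ 2) {α : ℝ}
    {f : (Fin (n + 1) → ℝ) → ℝ}
    (hf : HasOrderedEigenvaluePDF (tridiagonalLaw (n + 1) β α) (fun x => tridiagonal β x) f) :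
    HasOrderedEigenvaluePDF (gaussianEnsemble (n + 1) (m + 1))
      (fun x => RankOne.rankOnePerturbed β α (hermitianOf b x)) f := by
  have hβ0 : 0 < β := by rw [hβ]; positivity
  obtain ⟨Φ, hΦ, hW⟩ := exists_tridiagonalization hβ b hb n
  have hQ := rotation_mem_unitary (unitOnes (n + 1) K)
  refine hf.comp ((measurePreserving_shiftCorner hβ0 α n).comp
    (hΦ.comp (measurePreserving_conjCoords b hb hQ))) fun x l hl => ?_
  set s : ℝ := α * √(2 * β * (n + 1 : ℕ)) with hs
  obtain ⟨W, hWu, hcol, hrow, hWH⟩ := hW (conjCoords b (rotation (unitOnes (n + 1) K)) x)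
  rw [hermitianOf_conjCoords] at hWH
  have h1 := unitary_mul_rankOne s hcol hrow hWH
  refine hl.of_unitary (mul_mem hWu hQ) ?_
  simp only [Function.comp_apply]
  rw [rankOnePerturbed_eq hβ0, ← hs, mul_smul_comm, h1]
  set y := Φ (conjCoords b (rotation (unitOnes (n + 1) K)) x)
  have h2 : tridiagonal (N := n + 1) β (y.1 + Pi.single 0 s, y.2) =
      (1 / √(2 * β * (n + 1 : ℕ))) • (jacobiMatrix y + Matrix.single 0 0 s) := by
    rw [← jacobiMatrix_add_single]; rfl
  have h3 : (tridiagonal (N := n + 1) β (y.1 + Pi.single 0 s, y.2)).map (algebraMap ℝ K) =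
      (1 / √(2 * β * (n + 1 : ℕ))) • ((jacobiMatrix y).map (algebraMap ℝ K) +
        Matrix.single 0 0 (algebraMap ℝ K s)) := by
    rw [h2]
    ext i j
    simp only [Matrix.map_apply, Matrix.smul_apply, Matrix.add_apply, smul_eq_mul, map_mul, map_add,
      Matrix.single_apply, apply_ite (algebraMap ℝ K), map_zero]
    rw [Algebra.smul_def]
  exact ((congrArg (· * _) h3).trans (smul_mul_assoc _ _ _)).symm

end Perturbation

/-! ### The real, complex and quaternion algebras with their orthonormal bases. -/

section Scalars

instance : CompositionStar ℝ where
  star_real_smul r a := by simp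
  star_mul_self_eq a := by simp [sq]
  mul_star_self_eq a := by simp [sq]
  exists_real a _ := ⟨a, rfl⟩

instance : CompositionStar ℂ where
  star_real_smul r a := by simp
  star_mul_self_eq a := by simpa using Complex.conj_mul' a
  mul_star_self_eq a := by simpa using Complex.mul_conj' a
  exists_real a ha := ⟨a.re, Complex.conj_eq_iff_re.mp ha⟩

instance : CompositionStar ℍ[ℝ] where
  star_real_smul r a := by ext <;> simp
  star_mul_self_eq a := by
    rw [Quaternion.star_mul_self, Quaternion.normSq_eq_norm_mul_self, sq]; rfl
  mul_star_self_eq a := by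
    rw [Quaternion.self_mul_star, Quaternion.normSq_eq_norm_mul_self, sq]; rfl
  exists_real a ha := ⟨a.re, (Quaternion.star_eq_self.mp ha).symm⟩

theorem exists_basis_realUnits : ∃ b : Module.Basis (Fin 1) ℝ ℝ, ⇑b = realUnits ∧
    ∀ a, ‖a‖ ^ 2 = ∑ k, b.repr a k ^ 2 := by
  refine ⟨Module.Basis.singleton (Fin 1) ℝ, ?_, fun a => ?_⟩
  · funext i
    fin_cases i
    simp [realUnits]
  · simp

theorem exists_basis_complexUnits : ∃ b : Module.Basis (Fin 2) ℝ ℂ, ⇑b = complexUnits ∧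
    ∀ a, ‖a‖ ^ 2 = ∑ k, b.repr a k ^ 2 := by
  refine ⟨Complex.basisOneI, Complex.coe_basisOneI, fun a => ?_⟩
  rw [Complex.coe_basisOneI_repr, ← Complex.normSq_eq_norm_sq, Complex.normSq_apply,
    Fin.sum_univ_two]
  simp [sq]

theorem exists_basis_quaternionUnits : ∃ b : Module.Basis (Fin 4) ℝ ℍ[ℝ], ⇑b = quaternionUnits ∧
    ∀ a, ‖a‖ ^ 2 = ∑ k, b.repr a k ^ 2 := by
  let e : ℍ[ℝ] ≃ₗ[ℝ] (Fin 4 → ℝ) :=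
    { toFun := fun q => ![q.re, q.imI, q.imJ, q.imK]
      invFun := fun v => ⟨v 0, v 1, v 2, v 3⟩
      left_inv := fun q => rfl
      right_inv := fun v => by ext i; fin_cases i <;> rfl
      map_add' := fun p q => by ext i; fin_cases i <;> rfl
      map_smul' := fun r q => by ext i; fin_cases i <;> rfl }
  refine ⟨Module.Basis.ofEquivFun e, ?_, fun a => ?_⟩
  · funext i
    rw [Module.Basis.coe_ofEquivFun]
    refine e.symm_apply_eq.mpr ?_
    have he : ∀ q : ℍ[ℝ], e q = ![q.re, q.imI, q.imJ, q.imK] := fun _ => rfl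
    rw [he]
    funext j
    fin_cases i <;> fin_cases j <;> simp [quaternionUnits]
  · rw [sq, ← Quaternion.normSq_eq_norm_mul_self, Quaternion.normSq_def', Fin.sum_univ_four]
    simp only [Module.Basis.ofEquivFun_repr_apply]
    rfl

end Scalars

theorem hasLineIntegral_eigenvalueIntegral {n : ℕ} {β : ℝ} (hβ : 0 < β) (α : ℝ)
    {l : Fin (n + 1) → ℝ} {c : ℝ} (hc : ∀ j, 2 * α * β * (n + 1 : ℕ) * l j < c) :
    HasLineIntegral (fun t => Complex.exp (Complex.I * t) *
      ∏ j, (Complex.I * t - ((2 * α * β * (n + 1 : ℕ) * l j : ℝ) : ℂ)) ^ ((-(β / 2) : ℝ) : ℂ))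
      c (eigenvalueIntegral β α l : ℂ) :=
  hasLineIntegral_dirichletMoment (half_pos hβ) hc

theorem eigenvalueDensity_one {n : ℕ} (α : ℝ) {l : Fin (n + 1) → ℝ} (hl : StrictAnti l) :
    eigenvalueDensity 1 α l = (∏ j, Real.exp (-((n + 1 : ℕ) * l j ^ 2))) *
      (∏ j, ∏ k ∈ Finset.Ioi j, (l j - l k)) * eigenvalueIntegral 1 α l := by
  have h : ∀ j, ∀ k ∈ Finset.Ioi j, |l j - l k| ^ (1 : ℝ) = l j - l k := fun j k hk => by
    rw [Real.rpow_one, abs_of_pos (sub_pos.mpr (hl (Finset.mem_Ioi.mp hk)))]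
  rw [eigenvalueDensity, Finset.prod_congr rfl fun j _ => Finset.prod_congr rfl (h j)]
  simp only [one_mul]

end RankOne
end

theorem proposition2p3 (N : ℕ) (hN : 1 ≤ N) (α : ℝ) :
    -- the rank one perturbed GOE
    (∃ (J : (Fin N → ℝ) → ℝ) (Z : ℝ), 0 < Z ∧
      (∀ l : Fin N → ℝ, StrictAnti l → ∀ c : ℝ, (∀ j, 2 * α * N * l j < c) →
        RankOne.HasLineIntegral
          (fun t => Complex.exp (Complex.I * t) *
            ∏ j, (Complex.I * t - ((2 * α * N * l j : ℝ) : ℂ)) ^ (-(1 / 2) : ℂ))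
          c (J l : ℂ)) ∧
      RankOne.HasOrderedEigenvaluePDF (RankOne.gaussianEnsemble N 1)
        (fun x => RankOne.rankOnePerturbed 1 α (RankOne.hermitianOf RankOne.realUnits x))
        (fun l => Z⁻¹ * ((∏ j, Real.exp (-(N * l j ^ 2))) *
          (∏ j, ∏ k ∈ Finset.Ioi j, (l j - l k)) * J l))) ∧
    -- general `β > 0`: the tridiagonal model, and the GOE, GUE, GSE for `β = 1, 2, 4`
    (∀ β : ℝ, 0 < β → ∃ (J : (Fin N → ℝ) → ℝ) (Z : ℝ), 0 < Z ∧
      (∀ l : Fin N → ℝ, StrictAnti l → ∀ c : ℝ, (∀ j, 2 * α * β * N * l j < c) →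
        RankOne.HasLineIntegral
          (fun t => Complex.exp (Complex.I * t) *
            ∏ j, (Complex.I * t - ((2 * α * β * N * l j : ℝ) : ℂ)) ^ ((-(β / 2) : ℝ) : ℂ))
          c (J l : ℂ)) ∧
      ∃ f : (Fin N → ℝ) → ℝ,
        (∀ l, f l = Z⁻¹ * ((∏ j, Real.exp (-(β * N * l j ^ 2))) *
          (∏ j, ∏ k ∈ Finset.Ioi j, |l j - l k| ^ β) * J l)) ∧
        RankOne.HasOrderedEigenvaluePDF (RankOne.tridiagonalLaw N β α)
          (fun x => RankOne.tridiagonal β x) f ∧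
        (β = 1 → RankOne.HasOrderedEigenvaluePDF (RankOne.gaussianEnsemble N 1)
          (fun x => RankOne.rankOnePerturbed β α (RankOne.hermitianOf RankOne.realUnits x)) f) ∧
        (β = 2 → RankOne.HasOrderedEigenvaluePDF (RankOne.gaussianEnsemble N 2)
          (fun x => RankOne.rankOnePerturbed β α (RankOne.hermitianOf RankOne.complexUnits x)) f) ∧
        (β = 4 → RankOne.HasOrderedEigenvaluePDF (RankOne.gaussianEnsemble N 4)
          (fun x => RankOne.rankOnePerturbed β α
            (RankOne.hermitianOf RankOne.quaternionUnits x)) f)) := by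
  obtain ⟨n, rfl⟩ : ∃ n, N = n + 1 := ⟨N - 1, by omega⟩
  have main : ∀ β : ℝ, 0 < β → ∃ Z : ℝ, 0 < Z ∧
      RankOne.HasOrderedEigenvaluePDF (RankOne.tridiagonalLaw (n + 1) β α)
        (fun x => RankOne.tridiagonal β x) (fun l => Z⁻¹ * RankOne.eigenvalueDensity β α l) :=
    fun β hβ => RankOne.exists_hasOrderedEigenvaluePDF_tridiagonal hβ α n
  have real : ∀ {β : ℝ} {f : (Fin (n + 1) → ℝ) → ℝ}, β = 1 →
      RankOne.HasOrderedEigenvaluePDF (RankOne.tridiagonalLaw (n + 1) β α)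
        (fun x => RankOne.tridiagonal β x) f →
      RankOne.HasOrderedEigenvaluePDF (RankOne.gaussianEnsemble (n + 1) 1)
        (fun x => RankOne.rankOnePerturbed β α (RankOne.hermitianOf RankOne.realUnits x)) f := by
    intro β f h1 hf
    obtain ⟨b, hbe, hb⟩ := RankOne.exists_basis_realUnits
    rw [← hbe]
    exact hf.rankOnePerturbed (m := 0) (by rw [h1]; norm_num) b hb
  refine ⟨?_, fun β hβ => ?_⟩
  · obtain ⟨Z, hZ, h⟩ := main 1 one_pos
    refine ⟨RankOne.eigenvalueIntegral 1 α, Z, hZ, fun l _ c hc => ?_, ?_⟩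
    · have h1 := RankOne.hasLineIntegral_eigenvalueIntegral one_pos α (l := l) (c := c)
        (by simpa only [mul_one] using hc)
      simp only [mul_one] at h1
      convert h1 using 8
      push_cast
      ring
    · refine (real rfl h).congr_density fun l hl => ?_
      rw [RankOne.eigenvalueDensity_one α hl]
  · obtain ⟨Z, hZ, h⟩ := main β hβ
    refine ⟨RankOne.eigenvalueIntegral β α, Z, hZ, fun l _ c hc =>
      RankOne.hasLineIntegral_eigenvalueIntegral hβ α hc,
      fun l => Z⁻¹ * RankOne.eigenvalueDensity β α l, fun l => rfl, h, fun h1 => real h1 h,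
      fun h2 => ?_, fun h4 => ?_⟩
    · obtain ⟨b, hbe, hb⟩ := RankOne.exists_basis_complexUnits
      rw [← hbe]
      exact h.rankOnePerturbed (m := 1) (by rw [h2]; norm_num) b hb
    · obtain ⟨b, hbe, hb⟩ := RankOne.exists_basis_quaternionUnits
      -- The ensemble is a measure on real coordinates, so the σ-algebra on the quaternions is only
      -- auxiliary and does not enter the conclusion.
      let _ : MeasurableSpace (Quaternion ℝ) := borel _
      have : BorelSpace (Quaternion ℝ) := ⟨rfl⟩
      rw [← hbe]
      exact h.rankOnePerturbed (m := 3) (by rw [h4]; norm_num) b hb
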